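/- Let $M$ be a smooth manifold of dimension $n$. A Finsler structure on $M$ is a function $F:TM\to[0,\infty)$ that is $C^\infty$ on the bundle $TM_0$ of nonzero tangent vectors, satisfies $F(x,\lambda y)=\lambda F(x,y)$ for all $\lambda>0$, and whose fundamental tensor $g_{ij}(x,y)=\tfrac12\,\partial^2F^2/\partial y^i\partial y^j$ is positive definite at every $(x,y)\in TM_0$; then $(M,g)$ is called a Finsler manifold. Put $$G^i=\tfrac14 g^{il}\Big(\frac{\partial^2F^2}{\partial x^m\partial y^l}y^m-\frac{\partial F^2}{\partial x^l}\Big),\qquad N^i_j=\frac{\partial G^i}{\partial y^j},\qquad \frac{\delta}{\delta x^j}=\frac{\partial}{\partial x^j}-N^s_j\frac{\partial}{\partial y^s},$$ $$\Gamma^i_{jk}=\tfrac12 g^{ih}\Big(\frac{\delta g_{hk}}{\delta x^j}+\frac{\delta g_{hj}}{\delta x^k}-\frac{\delta g_{jk}}{\delta x^h}\Big),\qquad C^i_{hk}=\tfrac12 g^{im}\frac{\partial g_{mk}}{\partial y^h}.$$ The Cartan covariant derivative of a vector field $X$ along a curve $c=(x^i(t))$ with nonzero velocity $\dot c$ is the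 field $\nabla_{\dot c}X$ along $c$ with components $$(\nabla_{\dot c}X)^i=\frac{dX^i}{dt}+\Big(\Gamma^i_{kh}\dot x^h+C^i_{ks}\big(\ddot x^s+N^s_h\dot x^h\big)\Big)X^k,$$ all coefficients being evaluated at $(x,\dot x)$; it does not depend on the coordinates. A smooth curve $c$ on an open interval, parameterized by arc length (that is, $F(c,c')=1$), is called a circle if there are a constant $k>0$ and a vector field $Y$ along $c$ with $g_{c'}(Y,Y)=1$ such that, with $X=c'$, $$\nabla_{c'}X=kY,\qquad \nabla_{c'}Y=-kX .$$ Theorem. Let $(M,g)$ and $(\bar M,\bar g)$ be Finsler manifolds of dimension $n\ge 2$, and let $\phi:M\to\bar M$ be a smooth local diffeomorphism that preserves circles: for every circle $c$ of $(M,g)$, the curve $\phi\circ c$, reparameterized with the same orientation by its arc length for $\bar g$, is a circle of $(\bar M,\bar g)$. Then $\phi$ is conformal: there is a smooth function $\alpha:M\to(0,\infty)$ such that $\phi^*\bar g=\alpha^2 g$, that is, $$\bar g_{d\phi(y)}\big(d\phi(u),d\phi(v)\big)=\alpha(x)^2\,g_y(u,v)$$ for all $x\in M$, all nonzero $y\in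 T_xM$ and all $u,v\in T_xM$. -/

import Mathlib

open scoped ContDiff Manifold Topology

noncomputable section

namespace Finsler

/-- The coordinate space `ℝⁿ`. -/
abbrev Coord (n : ℕ) : Type := EuclideanSpace ℝ (Fin n)

/-- The `i`-th standard basis vector of `ℝⁿ`. -/
def basisVec {n : ℕ} (i : Fin n) : Coord n := EuclideanSpace.single i 1

/-- The bilinear form `½ ∂²(f²)/∂u∂v` at the point `y` of a real vector space, for a real function
`f` on that space. For the restriction of a Finsler structure to a tangent space this is the
fundamental tensor `g_y(u, v)`. -/
def hessForm {V : Type*} [AddCommGroup V] [Module ℝ V] (f : V → ℝ) (y u v : V) : ℝ :=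
  (1 / 2) * lineDeriv ℝ (fun z : V => lineDeriv ℝ (fun w : V => f w ^ 2) z v) y u

section Structure

variable (n : ℕ) (M : Type*) [TopologicalSpace M] [ChartedSpace (Coord n) M]
  [IsManifold (𝓡 n) ∞ M]

/-- A Finsler structure on the `n`-dimensional smooth manifold `M`: a nonnegative function on `TM`,
smooth on the slit tangent bundle, positively homogeneous of degree one on each tangent space, such
that the fundamental tensor `½ ∂²F²/∂yⁱ∂yʲ` is positive definite at every nonzero tangent vector.
No reversibility `F(-y) = F(y)` is assumed. -/
structure FinslerStructure where
  toFun : TangentBundle (𝓡 n) M → ℝ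
  nonneg : ∀ p, 0 ≤ toFun p
  smooth : ContMDiffOn (𝓡 n).tangent 𝓘(ℝ, ℝ) ∞ toFun {p | p.2 ≠ 0}
  homogeneous : ∀ (x : M) (y : TangentSpace (𝓡 n) x) (r : ℝ), 0 < r →
    toFun ⟨x, r • y⟩ = r * toFun ⟨x, y⟩
  posDef : ∀ (x : M) (y v : TangentSpace (𝓡 n) x), y ≠ 0 → v ≠ 0 →
    0 < hessForm (fun z : TangentSpace (𝓡 n) x => toFun ⟨x, z⟩) y v v

end Structure

section Coordinates

/-! Functions of the coordinates `(x, y)` of a tangent vector, and the objects derived from the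
coordinate expression `L = L(x, y)` of a Finsler structure. -/

variable {n : ℕ}

/-- `∂f/∂xⁱ`. -/
def dX (i : Fin n) (f : Coord n → Coord n → ℝ) (x y : Coord n) : ℝ :=
  lineDeriv ℝ (fun x' => f x' y) x (basisVec i)

/-- `∂f/∂yⁱ`. -/
def dY (i : Fin n) (f : Coord n → Coord n → ℝ) (x y : Coord n) : ℝ :=
  lineDeriv ℝ (fun y' => f x y') y (basisVec i)

variable (L : Coord n → Coord n → ℝ)

/-- `g_{ij} = ½ ∂²L²/∂yⁱ∂yʲ`. -/
def gLower (i j : Fin n) (x y : Coord n) : ℝ :=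
  hessForm (L x) y (basisVec i) (basisVec j)

/-- `g^{ij}`, the inverse matrix of `g_{ij}`. -/
def gUpper (i j : Fin n) (x y : Coord n) : ℝ :=
  (Matrix.of fun a b : Fin n => gLower L a b x y)⁻¹ i j

/-- The spray coefficients
`Gⁱ = ¼ g^{il} (∂²L²/∂xᵐ∂yˡ yᵐ - ∂L²/∂xˡ)`. -/
def sprayCoeff (i : Fin n) (x y : Coord n) : ℝ :=
  ∑ l, gUpper L i l x y / 4 *
    ((∑ m, dX m (dY l fun x y => L x y ^ 2) x y * y m) - dX l (fun x y => L x y ^ 2) x y)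

/-- The nonlinear connection `Nⁱ_j = ∂Gⁱ/∂yʲ`. -/
def nonlinConn (i j : Fin n) (x y : Coord n) : ℝ :=
  dY j (sprayCoeff L i) x y

/-- The horizontal derivative `δf/δxʲ = ∂f/∂xʲ - Nˢ_j ∂f/∂yˢ`. -/
def deltaX (j : Fin n) (f : Coord n → Coord n → ℝ) (x y : Coord n) : ℝ :=
  dX j f x y - ∑ s, nonlinConn L s j x y * dY s f x y

/-- The horizontal coefficients of the Cartan connection,
`Γⁱ_{jk} = ½ g^{ih} (δg_{hk}/δxʲ + δg_{hj}/δxᵏ - δg_{jk}/δxʰ)`. -/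
def horizCoeff (i j k : Fin n) (x y : Coord n) : ℝ :=
  (1 / 2) * ∑ h, gUpper L i h x y *
    (deltaX L j (gLower L h k) x y + deltaX L k (gLower L h j) x y
      - deltaX L h (gLower L j k) x y)

/-- The Cartan torsion tensor `Cⁱ_{hk} = ½ g^{im} ∂g_{mk}/∂yʰ`. -/
def cartanTensor (i h k : Fin n) (x y : Coord n) : ℝ :=
  (1 / 2) * ∑ m, gUpper L i m x y * dY h (gLower L m k) x y

/-- The `i`-th component of the Cartan covariant derivative at time `t` of the vector field `X`
along the curve `γ`, both given in coordinates. The connection form `ωⁱ_k = Γⁱ_{kh} dxʰ + Cⁱ_{ks} δyˢ`,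
`δyˢ = dyˢ + Nˢ_h dxʰ`, is evaluated on the velocity of the canonical lift `(γ, γ')` of `γ`:
`Xⁱ' + (Γⁱ_{kh} γʰ' + Cⁱ_{ks} (γˢ'' + Nˢ_h γʰ')) Xᵏ`. -/
def covDeriv (γ X : ℝ → Coord n) (t : ℝ) (i : Fin n) : ℝ :=
  deriv X t i
    + ∑ k, ((∑ h, horizCoeff L i k h (γ t) (deriv γ t) * deriv γ t h)
      + ∑ s, cartanTensor L i k s (γ t) (deriv γ t) *
          (deriv (deriv γ) t s + ∑ h, nonlinConn L s h (γ t) (deriv γ t) * deriv γ t h)) * X t k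

end Coordinates

section Manifold

variable {n : ℕ} {M : Type*} [TopologicalSpace M] [ChartedSpace (Coord n) M]
  [IsManifold (𝓡 n) ∞ M]

/-- The fundamental tensor `g` of `F` at the tangent vector `y ∈ T_x M`: a bilinear form on
`T_x M` (for `y ≠ 0`). -/
def FinslerStructure.fundTensor (F : FinslerStructure n M) (x : M)
    (y u v : TangentSpace (𝓡 n) x) : ℝ :=
  hessForm (fun z : TangentSpace (𝓡 n) x => F.toFun ⟨x, z⟩) y u v

/-- The coordinate expression of `F` in the chart `e`: `(x, y) ↦ F(yⁱ ∂/∂xⁱ)`, the tangent vector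
being attached at the point with coordinates `x`. -/
def FinslerStructure.localExpr (F : FinslerStructure n M)
    (e : OpenPartialHomeomorph M (Coord n)) (x y : Coord n) : ℝ :=
  F.toFun ⟨e.symm x, mfderiv 𝓘(ℝ, Coord n) (𝓡 n) e.symm x y⟩

/-- The velocity `c'(s) ∈ T_{c(s)} M`. -/
def velocity (c : ℝ → M) (s : ℝ) : TangentSpace (𝓡 n) (c s) :=
  mfderiv 𝓘(ℝ, ℝ) (𝓡 n) c s (1 : ℝ)

/-- The components, in the chart `e`, of a vector field `Y` along the curve `c`. -/
def components (e : OpenPartialHomeomorph M (Coord n)) (c : ℝ → M)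
    (Y : ∀ s : ℝ, TangentSpace (𝓡 n) (c s)) (s : ℝ) : Coord n :=
  mfderiv (𝓡 n) 𝓘(ℝ, Coord n) e (c s) (Y s)

/-- In the chart `e`, on a neighbourhood of the parameter `s₀`: the field `Y` along `c` is smooth
and `∇_{c'} c' = k Y`, `∇_{c'} Y = -k c'` for the Cartan covariant derivative `∇` of `F`. -/
def CircleEquationsAt (F : FinslerStructure n M) (e : OpenPartialHomeomorph M (Coord n))
    (c : ℝ → M) (Y : ∀ s : ℝ, TangentSpace (𝓡 n) (c s)) (k s₀ : ℝ) : Prop :=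
  ContDiffAt ℝ ∞ (components e c Y) s₀ ∧
  ∀ᶠ s in 𝓝 s₀, ∀ i : Fin n,
    covDeriv (F.localExpr e) (e ∘ c) (deriv (e ∘ c)) s i = k * components e c Y s i ∧
    covDeriv (F.localExpr e) (e ∘ c) (components e c Y) s i = -k * deriv (e ∘ c) s i

/-- `c`, restricted to the open interval `J`, is a circle of `(M, F)`: it is smooth and
parameterized by arc length, and there are a constant `k > 0` and a field `Y` along `c`, of unit
length for `g_{c'}`, with `∇_{c'} c' = k Y` and `∇_{c'} Y = -k c'`. The two equations are tensorial:
they hold in one chart around a point of the curve if and only if they hold in all of them. -/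
def IsCircle (F : FinslerStructure n M) (J : Set ℝ) (c : ℝ → M) : Prop :=
  IsOpen J ∧ J.OrdConnected ∧
  ContMDiffOn 𝓘(ℝ, ℝ) (𝓡 n) ∞ c J ∧
  (∀ s ∈ J, F.toFun ⟨c s, velocity c s⟩ = 1) ∧
  ∃ k : ℝ, 0 < k ∧ ∃ Y : ∀ s : ℝ, TangentSpace (𝓡 n) (c s),
    (∀ s ∈ J, F.fundTensor (c s) (velocity c s) (Y s) (Y s) = 1) ∧
    ∀ s₀ ∈ J, ∃ e ∈ IsManifold.maximalAtlas (𝓡 n) ∞ M,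
      c s₀ ∈ e.source ∧ CircleEquationsAt F e c Y k s₀

variable {M' : Type*} [TopologicalSpace M'] [ChartedSpace (Coord n) M'] [IsManifold (𝓡 n) ∞ M']

/-- `φ : (M, F) → (M', F')` preserves circles: for every circle `c` of `(M, F)`, the
reparameterization `φ ∘ c ∘ σ` of `φ ∘ c` by its arc length for `F'` is a circle of `(M', F')`.
Here `σ : J' → J`, the parameter `s` as a function of the arc length of `φ ∘ c`, is an orientation
preserving diffeomorphism of open intervals; that the new parameter is arc length is part of
`IsCircle`. -/
def PreservesCircles (F : FinslerStructure n M) (F' : FinslerStructure n M') (φ : M → M') : Prop :=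
  ∀ (J : Set ℝ) (c : ℝ → M), IsCircle F J c →
    ∃ (J' : Set ℝ) (σ : ℝ → ℝ), Set.BijOn σ J' J ∧ ContDiffOn ℝ ∞ σ J' ∧
      (∀ t ∈ J', 0 < deriv σ t) ∧ IsCircle F' J' (φ ∘ c ∘ σ)

/-- `φ : (M, F) → (M', F')` is conformal: the pull-back by `φ` of the fundamental tensor of `F'` is
`α² g`, where `g` is the fundamental tensor of `F` and `α` a smooth positive function on `M`. -/
def IsConformal (F : FinslerStructure n M) (F' : FinslerStructure n M') (φ : M → M') : Prop :=
  ∃ α : M → ℝ, ContMDiff (𝓡 n) 𝓘(ℝ, ℝ) ∞ α ∧ (∀ x, 0 < α x) ∧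
    ∀ (x : M) (y u v : TangentSpace (𝓡 n) x), y ≠ 0 →
      F'.fundTensor (φ x) (mfderiv (𝓡 n) (𝓡 n) φ x y) (mfderiv (𝓡 n) (𝓡 n) φ x u)
          (mfderiv (𝓡 n) (𝓡 n) φ x v)
        = α x ^ 2 * F.fundTensor x y u v

end Manifold

end Finsler

end

/-!
A chart of `M` and the pull-back by `φ` turn the data into two Finsler functions `L`, `L'` on one
open set of `ℝⁿ` (`IsLocalFinsler`), and it has to be shown that `L' / L` depends on the position
only.

*Circles through a point.* The connection is metric along the canonical lift of a curve, so the two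
circle equations preserve `g(X, X) = g(Y, Y) = 1` and `g(X, Y) = 0`. Solving them as an ordinary
differential equation, every unit vector `X` and every nonzero `V` with `g_X(X, V) = 0` are the
velocity and the covariant acceleration of a circle (`IsLocalFinsler.exists_circle`). A circle
satisfies `∇∇c' = -k² c'`, and its image, in the new parameter, has `∇'∇'c'` parallel to `c'` and
`∇'c'` orthogonal to `c'`.

*The quadratic identity.* Comparing the third derivatives of `c` in the two equations modulo `X`
gives an identity which is polynomial of degree two in `V`, for `V` in the hyperplane orthogonal to
`X`. Its part of degree two involves only the fundamental tensors and the Cartan torsions: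
`g'(X, X) (C'(V, V) - C(V, V)) ≡ 3 g'(V, X) V` modulo `X` (`IsLocalFinsler.quadratic_identity`).

*Rigidity in a tangent space.* The trace of the Cartan torsion is half the differential of
`log det g`, hence polarizing the identity and taking the trace yields
`d log (det g' / det g) = 3n d log (L' / L)` on the nonzero vectors of each tangent space. These
form a connected set as `n ≥ 2`, so `log (det g' / det g) - 3n log (L' / L)` is a constant `A`
there. At a maximum `μ` of the homogeneous function `L' / L` the second-order condition reads
`g' ≤ μ² g`, hence `det g' / det g ≤ μ²ⁿ` and `A ≤ -n log μ`. At a minimum `m` likewise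
`A ≥ -n log m`. So `μ ≤ m`, and `L' / L` is constant on the tangent space
(`IsLocalFinsler.exists_energy_eq`).

The factor `α` is smooth, being in a chart the ratio of two Finsler functions at a fixed vector.
-/

noncomputable section

namespace Finsler

/-! ### Third-order jets of real functions -/

section Jets

variable {V : Type*} [NormedAddCommGroup V] [NormedSpace ℝ V] {q : V → ℝ} {p : V}

/-- The second derivative of `q` at `p`, as a bilinear form. -/
abbrev jet2 (q : V → ℝ) (p : V) : V →L[ℝ] V →L[ℝ] ℝ := fderiv ℝ (fderiv ℝ q) p

/-- The third derivative of `q` at `p`, as a trilinear form. -/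
abbrev jet3 (q : V → ℝ) (p : V) : V →L[ℝ] V →L[ℝ] V →L[ℝ] ℝ :=
  fderiv ℝ (fderiv ℝ (fderiv ℝ q)) p

lemma contDiffAt_fderiv {W : Type*} [NormedAddCommGroup W] [NormedSpace ℝ W] {f : V → W}
    (h : ContDiffAt ℝ ∞ f p) : ContDiffAt ℝ ∞ (fderiv ℝ f) p :=
  h.fderiv_right (by simp)

lemma differentiableAt_of_smooth {W : Type*} [NormedAddCommGroup W] [NormedSpace ℝ W] {f : V → W}
    (h : ContDiffAt ℝ ∞ f p) : DifferentiableAt ℝ f p :=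
  h.differentiableAt (by simp)

lemma hasFDerivAt_of_smooth {W : Type*} [NormedAddCommGroup W] [NormedSpace ℝ W] {f : V → W}
    (h : ContDiffAt ℝ ∞ f p) : HasFDerivAt f (fderiv ℝ f p) p :=
  (differentiableAt_of_smooth h).hasFDerivAt

lemma contDiffAt_of_mem_isOpen {W : Type*} [NormedAddCommGroup W] [NormedSpace ℝ W] {f : V → W}
    {Ω : Set V} (hΩ : IsOpen Ω) (h : ContDiffOn ℝ ∞ f Ω) (hp : p ∈ Ω) : ContDiffAt ℝ ∞ f p :=
  h.contDiffAt (hΩ.mem_nhds hp)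

lemma fderiv_fderiv_symm {W : Type*} [NormedAddCommGroup W] [NormedSpace ℝ W] {f : V → W}
    (h : ContDiffAt ℝ ∞ f p) (a b : V) :
    fderiv ℝ (fderiv ℝ f) p a b = fderiv ℝ (fderiv ℝ f) p b a :=
  (h.isSymmSndFDerivAt (by simpa using (WithTop.coe_le_coe.2 (le_top : (2 : ℕ∞) ≤ ⊤)))) a b

lemma jet3_symm_left (h : ContDiffAt ℝ ∞ q p) (a b c : V) :
    jet3 q p a b c = jet3 q p b a c := by
  rw [jet3, fderiv_fderiv_symm (contDiffAt_fderiv h)]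

lemma hasFDerivAt_jet2_apply (h : ContDiffAt ℝ ∞ q p) (b c : V) :
    HasFDerivAt (fun z => jet2 q z b c) (((jet3 q p).flip b).flip c) p := by
  have h3 := hasFDerivAt_of_smooth (contDiffAt_fderiv (contDiffAt_fderiv h))
  convert! ((h3.clm_apply (hasFDerivAt_const b p)).clm_apply (hasFDerivAt_const c p)) using 1
  ext a
  simp

lemma jet3_symm_right {Ω : Set V} (hΩ : IsOpen Ω) (h : ContDiffOn ℝ ∞ q Ω) (hp : p ∈ Ω)
    (a b c : V) : jet3 q p a b c = jet3 q p a c b := by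
  have h1 := hasFDerivAt_jet2_apply (contDiffAt_of_mem_isOpen hΩ h hp) b c
  have h2 := hasFDerivAt_jet2_apply (contDiffAt_of_mem_isOpen hΩ h hp) c b
  have h3 : (fun z => jet2 q z b c) =ᶠ[𝓝 p] fun z => jet2 q z c b := by
    filter_upwards [hΩ.mem_nhds hp] with z hz
    exact fderiv_fderiv_symm (contDiffAt_of_mem_isOpen hΩ h hz) b c
  have := congrArg (fun T => T a) (h1.unique (h2.congr_of_eventuallyEq h3))
  simpa using this

end Jets

section Vertical

variable {E A B P : Type*} [NormedAddCommGroup E] [NormedSpace ℝ E] [NormedAddCommGroup A]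
  [NormedSpace ℝ A] [NormedAddCommGroup B] [NormedSpace ℝ B] [NormedAddCommGroup P]
  [NormedSpace ℝ P] {p : P}

/-- Restriction of a linear map on pairs `(x, y)` to the vertical vectors `(0, u)`. -/
def vertOne : ((E × E) →L[ℝ] A) →L[ℝ] (E →L[ℝ] A) :=
  (ContinuousLinearMap.compL ℝ E (E × E) A).flip (ContinuousLinearMap.inr ℝ E E)

lemma vertOne_apply (T : (E × E) →L[ℝ] A) (u : E) : vertOne T u = T (0, u) := by
  simp [vertOne]

/-- Composition of a bilinear map with a linear map on the target. -/
def postComp (K : A →L[ℝ] B) (T : E →L[ℝ] E →L[ℝ] A) : E →L[ℝ] E →L[ℝ] B :=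
  (ContinuousLinearMap.compL ℝ E A B K).comp T

lemma postComp_apply (K : A →L[ℝ] B) (T : E →L[ℝ] E →L[ℝ] A) (u w : E) :
    postComp K T u w = K (T u w) := rfl

/-- Restriction of a bilinear map on pairs `(x, y)` to the vertical vectors `(0, u)`. -/
def vert (T : (E × E) →L[ℝ] (E × E) →L[ℝ] A) : E →L[ℝ] E →L[ℝ] A :=
  vertOne.comp (vertOne T)

lemma vert_apply (T : (E × E) →L[ℝ] (E × E) →L[ℝ] A) (u w : E) :
    vert T u w = T (0, u) (0, w) := by
  simp [vert, vertOne_apply]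

lemma vertOne_smooth {f : P → (E × E) →L[ℝ] A} (h : ContDiffAt ℝ ∞ f p) :
    ContDiffAt ℝ ∞ (fun z => vertOne (f z)) p :=
  ContDiffAt.continuousLinearMap_comp (vertOne : ((E × E) →L[ℝ] A) →L[ℝ] (E →L[ℝ] A)) h

lemma vert_smooth {f : P → (E × E) →L[ℝ] (E × E) →L[ℝ] A} (h : ContDiffAt ℝ ∞ f p) :
    ContDiffAt ℝ ∞ (fun z => vert (f z)) p :=
  contDiffAt_const.clm_comp (vertOne_smooth h)

lemma postComp_smooth {K : P → A →L[ℝ] B} {f : P → E →L[ℝ] E →L[ℝ] A} (hK : ContDiffAt ℝ ∞ K p)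
    (h : ContDiffAt ℝ ∞ f p) : ContDiffAt ℝ ∞ (fun z => postComp (K z) (f z)) p := by
  have h1 : ContDiffAt ℝ ∞ (fun z => ContinuousLinearMap.compL ℝ E A B (K z)) p :=
    ContDiffAt.clm_apply contDiffAt_const hK
  exact h1.clm_comp h

end Vertical

/-! ### Local Finsler functions and their Euler identities -/

variable {n : ℕ}

/-- The set of pairs `(x, y)` with `x ∈ U` and `y ≠ 0`: coordinates of the slit tangent bundle. -/
def slit (U : Set (Coord n)) : Set (Coord n × Coord n) := {p | p.1 ∈ U ∧ p.2 ≠ 0}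

/-- The coordinate expression of a Finsler structure on an open set `U` of `ℝⁿ`. -/
structure IsLocalFinsler (U : Set (Coord n)) (L : Coord n → Coord n → ℝ) : Prop where
  isOpen : IsOpen U
  nonneg : ∀ x ∈ U, ∀ y, 0 ≤ L x y
  smooth : ContDiffOn ℝ ∞ (fun p : Coord n × Coord n => L p.1 p.2) (slit U)
  homogeneous : ∀ x ∈ U, ∀ (y : Coord n) (r : ℝ), 0 < r → L x (r • y) = r * L x y
  posDef : ∀ x ∈ U, ∀ y v : Coord n, y ≠ 0 → v ≠ 0 → 0 < hessForm (L x) y v v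

/-- The function `L²` of the pair `(x, y)`. -/
def energy (L : Coord n → Coord n → ℝ) (p : Coord n × Coord n) : ℝ := L p.1 p.2 ^ 2

lemma isOpen_slit {U : Set (Coord n)} (hU : IsOpen U) : IsOpen (slit U) :=
  (hU.preimage continuous_fst).inter (isOpen_ne.preimage continuous_snd)

lemma basisVec_apply (i j : Fin n) : (basisVec i : Coord n) j = if j = i then 1 else 0 := by
  simp [basisVec]

lemma sum_smul_basisVec (y : Coord n) : ∑ i, y i • basisVec i = y := by
  ext j
  simp [basisVec_apply]

lemma map_eq_sum {W : Type*} [NormedAddCommGroup W] [NormedSpace ℝ W] (T : Coord n →L[ℝ] W)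
    (y : Coord n) : T y = ∑ i, y i • T (basisVec i) := by
  conv_lhs => rw [← sum_smul_basisVec y]
  simp

namespace IsLocalFinsler

variable {U : Set (Coord n)} {L : Coord n → Coord n → ℝ} {p : Coord n × Coord n}

lemma energy_contDiffOn (hL : IsLocalFinsler U L) : ContDiffOn ℝ ∞ (energy L) (slit U) :=
  hL.smooth.pow 2

lemma slit_isOpen (hL : IsLocalFinsler U L) : IsOpen (slit U) := isOpen_slit hL.isOpen

lemma energy_smooth (hL : IsLocalFinsler U L) (hp : p ∈ slit U) : ContDiffAt ℝ ∞ (energy L) p :=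
  contDiffAt_of_mem_isOpen hL.slit_isOpen hL.energy_contDiffOn hp

lemma slit_mem_nhds (hL : IsLocalFinsler U L) (hp : p ∈ slit U) : slit U ∈ 𝓝 p :=
  hL.slit_isOpen.mem_nhds hp

lemma energy_homogeneous (hL : IsLocalFinsler U L) (hp : p ∈ slit U) {r : ℝ} (hr : 0 < r) :
    energy L (p.1, r • p.2) = r ^ 2 * energy L p := by
  simp [energy, hL.homogeneous p.1 hp.1 p.2 r hr, mul_pow]

/-- Euler's identity for `L²`. -/
lemma euler_one (hL : IsLocalFinsler U L) (hp : p ∈ slit U) :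
    fderiv ℝ (energy L) p (0, p.2) = 2 * energy L p := by
  have h1 : HasDerivAt (fun r : ℝ => ((p.1, r • p.2) : Coord n × Coord n)) (0, p.2) 1 := by
    have := (hasDerivAt_const (1 : ℝ) p.1).prodMk ((hasDerivAt_id (1 : ℝ)).smul_const p.2)
    simpa using this
  have h2 : HasFDerivAt (energy L) (fderiv ℝ (energy L) p) ((p.1, (1 : ℝ) • p.2)) := by
    simpa using hasFDerivAt_of_smooth (hL.energy_smooth hp)
  have h3 := h2.comp_hasDerivAt (1 : ℝ) h1
  have h4 : HasDerivAt (fun r : ℝ => r ^ 2 * energy L p) (2 * energy L p) 1 := by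
    simpa using (hasDerivAt_pow 2 (1 : ℝ)).mul_const (energy L p)
  refine h3.unique (h4.congr_of_eventuallyEq ?_)
  filter_upwards [lt_mem_nhds (zero_lt_one' ℝ)] with r hr
  exact hL.energy_homogeneous hp hr

/-- The Euler vector field `(0, y)`, as a linear map. -/
def eulerField : (Coord n × Coord n) →L[ℝ] (Coord n × Coord n) :=
  (ContinuousLinearMap.inr ℝ (Coord n) (Coord n)).comp
    (ContinuousLinearMap.snd ℝ (Coord n) (Coord n))

lemma euler_two (hL : IsLocalFinsler U L) (hp : p ∈ slit U) (a : Coord n × Coord n) :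
    jet2 (energy L) p a (0, p.2) = 2 * fderiv ℝ (energy L) p a
      - fderiv ℝ (energy L) p (0, a.2) := by
  have hs := hL.energy_smooth hp
  have h1 := (hasFDerivAt_of_smooth (contDiffAt_fderiv hs)).clm_apply
    (eulerField (n := n)).hasFDerivAt
  have h2 := (hasFDerivAt_of_smooth hs).const_mul 2
  have h3 : (fun z => fderiv ℝ (energy L) z (eulerField z)) =ᶠ[𝓝 p] fun z => 2 * energy L z := by
    filter_upwards [hL.slit_mem_nhds hp] with z hz
    exact hL.euler_one hz
  have := congrArg (fun T => T a) (h1.unique (h2.congr_of_eventuallyEq h3))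
  simp [eulerField] at this
  linarith

lemma euler_three (hL : IsLocalFinsler U L) (hp : p ∈ slit U) (b a : Coord n × Coord n) :
    jet3 (energy L) p b a (0, p.2) = 2 * jet2 (energy L) p b a - jet2 (energy L) p b (0, a.2)
      - jet2 (energy L) p a (0, b.2) := by
  have hs := hL.energy_smooth hp
  have hs1 := contDiffAt_fderiv hs
  have h1 := ((hasFDerivAt_of_smooth (contDiffAt_fderiv hs1)).clm_apply
    (hasFDerivAt_const a p)).clm_apply (eulerField (n := n)).hasFDerivAt
  have h2 := (((hasFDerivAt_of_smooth hs1).clm_apply (hasFDerivAt_const a p)).const_mul 2).sub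
    ((hasFDerivAt_of_smooth hs1).clm_apply
      (hasFDerivAt_const ((0, a.2) : Coord n × Coord n) p))
  have h3 : (fun z => jet2 (energy L) z a (eulerField z)) =ᶠ[𝓝 p]
      fun z => 2 * fderiv ℝ (energy L) z a - fderiv ℝ (energy L) z (0, a.2) := by
    filter_upwards [hL.slit_mem_nhds hp] with z hz
    exact hL.euler_two hz a
  have := congrArg (fun T => T b) (h1.unique (h2.congr_of_eventuallyEq h3))
  simp [eulerField] at this
  linarith

end IsLocalFinsler

/-! ### The fundamental tensor in coordinates -/

/-- The fundamental tensor `g_{(x, y)}(u, w)`, as half a second derivative of `L²`. -/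
def gForm (L : Coord n → Coord n → ℝ) (p : Coord n × Coord n) (u w : Coord n) : ℝ :=
  1 / 2 * jet2 (energy L) p (0, u) (0, w)

namespace IsLocalFinsler

variable {U : Set (Coord n)} {L : Coord n → Coord n → ℝ} {p : Coord n × Coord n}

lemma lineDeriv_snd {f : Coord n × Coord n → ℝ} (h : DifferentiableAt ℝ f p) (u : Coord n) :
    lineDeriv ℝ (fun y => f (p.1, y)) p.2 u = fderiv ℝ f p (0, u) := by
  have h1 : HasFDerivAt (fun y : Coord n => ((p.1, y) : Coord n × Coord n))
      (ContinuousLinearMap.inr ℝ (Coord n) (Coord n)) p.2 := hasFDerivAt_prodMk_right p.1 p.2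
  have h2 : HasFDerivAt f (fderiv ℝ f p) (p.1, p.2) := h.hasFDerivAt
  have := ((h2.comp p.2 h1).hasLineDerivAt u).lineDeriv
  simpa [Function.comp_def] using this

lemma lineDeriv_fst {f : Coord n × Coord n → ℝ} (h : DifferentiableAt ℝ f p) (u : Coord n) :
    lineDeriv ℝ (fun x => f (x, p.2)) p.1 u = fderiv ℝ f p (u, 0) := by
  have h1 : HasFDerivAt (fun y : Coord n => ((y, p.2) : Coord n × Coord n))
      (ContinuousLinearMap.inl ℝ (Coord n) (Coord n)) p.1 := hasFDerivAt_prodMk_left p.1 p.2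
  have h2 : HasFDerivAt f (fderiv ℝ f p) (p.1, p.2) := h.hasFDerivAt
  have := ((h2.comp p.1 h1).hasLineDerivAt u).lineDeriv
  simpa [Function.comp_def] using this

lemma dX_eq {f : Coord n → Coord n → ℝ}
    (h : DifferentiableAt ℝ (fun z : Coord n × Coord n => f z.1 z.2) p) (i : Fin n) :
    dX i f p.1 p.2 = fderiv ℝ (fun z : Coord n × Coord n => f z.1 z.2) p (basisVec i, 0) :=
  lineDeriv_fst h _

lemma dY_eq {f : Coord n → Coord n → ℝ}
    (h : DifferentiableAt ℝ (fun z : Coord n × Coord n => f z.1 z.2) p) (i : Fin n) :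
    dY i f p.1 p.2 = fderiv ℝ (fun z : Coord n × Coord n => f z.1 z.2) p (0, basisVec i) :=
  lineDeriv_snd h _

lemma eventually_snd {P : Coord n × Coord n → Prop} (h : ∀ᶠ z in 𝓝 p, P z) :
    ∀ᶠ y in 𝓝 p.2, P (p.1, y) :=
  (Continuous.tendsto' (Continuous.prodMk_right p.1) p.2 p rfl).eventually h

lemma hessForm_eq (hL : IsLocalFinsler U L) (hp : p ∈ slit U) (u w : Coord n) :
    hessForm (L p.1) p.2 u w = gForm L p u w := by
  have hs := hL.energy_smooth hp
  have h1 : (fun z => lineDeriv ℝ (fun v => L p.1 v ^ 2) z w) =ᶠ[𝓝 p.2]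
      fun z => (fun z' => fderiv ℝ (energy L) z' (0, w)) (p.1, z) := by
    filter_upwards [eventually_snd (hL.slit_mem_nhds hp)] with z hz
    exact lineDeriv_snd (p := (p.1, z)) (differentiableAt_of_smooth (hL.energy_smooth hz)) w
  have hd := (hasFDerivAt_of_smooth (contDiffAt_fderiv hs)).clm_apply
    (hasFDerivAt_const ((0, w) : Coord n × Coord n) p)
  rw [hessForm, h1.lineDeriv_eq, lineDeriv_snd hd.differentiableAt, hd.fderiv, gForm]
  simp

lemma gForm_pos (hL : IsLocalFinsler U L) (hp : p ∈ slit U) {v : Coord n} (hv : v ≠ 0) :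
    0 < gForm L p v v := by
  rw [← hL.hessForm_eq hp]
  exact hL.posDef _ hp.1 _ _ hp.2 hv

lemma gForm_symm (hL : IsLocalFinsler U L) (hp : p ∈ slit U) (u w : Coord n) :
    gForm L p u w = gForm L p w u := by
  rw [gForm, gForm, jet2, fderiv_fderiv_symm (hL.energy_smooth hp)]

end IsLocalFinsler

/-- The fundamental tensor as a continuous bilinear form. -/
def gBilin (L : Coord n → Coord n → ℝ) (p : Coord n × Coord n) :
    Coord n →L[ℝ] Coord n →L[ℝ] ℝ :=
  (1 / 2 : ℝ) • vert (jet2 (energy L) p)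

lemma gBilin_apply (L : Coord n → Coord n → ℝ) (p : Coord n × Coord n) (u w : Coord n) :
    gBilin L p u w = gForm L p u w := by
  simp [gBilin, gForm, vert_apply]

lemma gForm_sum (L : Coord n → Coord n → ℝ) (p : Coord n × Coord n) (u w : Coord n) :
    gForm L p u w = ∑ i, u i * gForm L p (basisVec i) w := by
  simp only [← gBilin_apply]
  rw [map_eq_sum (gBilin L p) u]
  simp

namespace IsLocalFinsler

variable {U : Set (Coord n)} {L : Coord n → Coord n → ℝ} {p : Coord n × Coord n}

/-- Nondegeneracy of the fundamental tensor. -/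
lemma eq_of_gForm_eq (hL : IsLocalFinsler U L) (hp : p ∈ slit U) {u v : Coord n}
    (h : ∀ w, gForm L p u w = gForm L p v w) : u = v := by
  by_contra hne
  have h1 := hL.gForm_pos hp (sub_ne_zero.2 hne)
  have h2 : gForm L p (u - v) (u - v) = 0 := by
    simp only [← gBilin_apply] at h ⊢
    rw [map_sub (gBilin L p), sub_apply, h, sub_self]
  exact h1.ne' h2

/-- The matrix `g_{ij}` at a point. -/
def gMat (L : Coord n → Coord n → ℝ) (p : Coord n × Coord n) : Matrix (Fin n) (Fin n) ℝ :=
  Matrix.of fun i j => gLower L i j p.1 p.2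

lemma gMat_apply (hL : IsLocalFinsler U L) (hp : p ∈ slit U) (i j : Fin n) :
    gMat L p i j = gForm L p (basisVec i) (basisVec j) := hL.hessForm_eq hp _ _

lemma dotProduct_gMat_mulVec (hL : IsLocalFinsler U L) (hp : p ∈ slit U) (v : Fin n → ℝ) :
    star v ⬝ᵥ (gMat L p).mulVec v = gForm L p (WithLp.toLp 2 v) (WithLp.toLp 2 v) := by
  rw [gForm_sum]
  simp only [dotProduct, Matrix.mulVec, star_trivial]
  refine Finset.sum_congr rfl fun i _ => ?_
  rw [hL.gForm_symm hp, gForm_sum]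
  congr 1
  refine Finset.sum_congr rfl fun j _ => ?_
  rw [hL.gMat_apply hp, hL.gForm_symm hp, mul_comm]

lemma gMat_isHermitian (hL : IsLocalFinsler U L) (hp : p ∈ slit U) : (gMat L p).IsHermitian := by
  ext i j
  simp [hL.gMat_apply hp, hL.gForm_symm hp (basisVec i)]

lemma gMat_posDef (hL : IsLocalFinsler U L) (hp : p ∈ slit U) : (gMat L p).PosDef := by
  refine Matrix.PosDef.of_dotProduct_mulVec_pos (hL.gMat_isHermitian hp) fun v hv => ?_
  rw [hL.dotProduct_gMat_mulVec hp]
  exact hL.gForm_pos hp (v := WithLp.toLp 2 v) (by simpa using hv)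

/-- Raising an index: the vector with components `g^{ik} β_k` represents `β` with respect to the
fundamental tensor. -/
lemma gForm_raise (hL : IsLocalFinsler U L) (hp : p ∈ slit U) (β : Coord n →L[ℝ] ℝ)
    {v : Coord n} (hv : ∀ i, v i = ∑ k, gUpper L i k p.1 p.2 * β (basisVec k)) (w : Coord n) :
    gForm L p v w = β w := by
  have hdet : IsUnit (gMat L p).det := (hL.gMat_posDef hp).det_pos.ne'.isUnit
  have key : ∀ j, gForm L p v (basisVec j) = β (basisVec j) := by
    intro j
    have h1 := congrFun (congrArg (fun A => Matrix.mulVec A (fun k => β (basisVec k)))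
      (Matrix.mul_nonsing_inv (gMat L p) hdet)) j
    simp only [← Matrix.mulVec_mulVec, Matrix.one_mulVec] at h1
    rw [← h1, gForm_sum]
    refine Finset.sum_congr rfl fun i _ => ?_
    rw [hL.gForm_symm hp, ← hL.gMat_apply hp, mul_comm, hv]
    rfl
  rw [hL.gForm_symm hp, gForm_sum, map_eq_sum β w]
  refine Finset.sum_congr rfl fun i _ => ?_
  rw [hL.gForm_symm hp, key, smul_eq_mul]

lemma raise_eq (hL : IsLocalFinsler U L) (hp : p ∈ slit U) (β : Coord n →L[ℝ] ℝ)
    {v : Coord n} (hv : ∀ w, gForm L p v w = β w) (i : Fin n) :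
    v i = ∑ k, gUpper L i k p.1 p.2 * β (basisVec k) := by
  have : v = WithLp.toLp 2 (fun i => ∑ k, gUpper L i k p.1 p.2 * β (basisVec k)) := by
    refine hL.eq_of_gForm_eq hp fun w => ?_
    rw [hv, hL.gForm_raise hp β (fun i => rfl)]
  rw [this]

end IsLocalFinsler

/-! ### Spray, nonlinear connection and Cartan tensor without indices -/

/-- The isomorphism from covectors to vectors given by the fundamental tensor. -/
def sharp (L : Coord n → Coord n → ℝ) (p : Coord n × Coord n) :
    (Coord n →L[ℝ] ℝ) →L[ℝ] Coord n :=
  (gBilin L p).inverse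

/-- The covector `w ↦ ¼ (∂²L²/∂x∂y (y, w) - ∂L²/∂x (w))`. -/
def sprayForm (L : Coord n → Coord n → ℝ) (p : Coord n × Coord n) : Coord n →L[ℝ] ℝ :=
  (1 / 4 : ℝ) • ((jet2 (energy L) p (p.2, 0)).comp (ContinuousLinearMap.inr ℝ _ _)
    - (fderiv ℝ (energy L) p).comp (ContinuousLinearMap.inl ℝ _ _))

/-- The vector with components the spray coefficients `Gⁱ`. -/
def sprayVec (L : Coord n → Coord n → ℝ) (p : Coord n × Coord n) : Coord n :=
  sharp L p (sprayForm L p)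

/-- The endomorphism with matrix `Nⁱ_j`. -/
def connOp (L : Coord n → Coord n → ℝ) (p : Coord n × Coord n) : Coord n →L[ℝ] Coord n :=
  (fderiv ℝ (sprayVec L) p).comp (ContinuousLinearMap.inr ℝ _ _)

/-- The bilinear map with components `Cⁱ_{hk}`. The factor is `¼` since the third derivatives are
those of `L²`, while `g` is half its second derivative. -/
def cartanOp (L : Coord n → Coord n → ℝ) (p : Coord n × Coord n) :
    Coord n →L[ℝ] Coord n →L[ℝ] Coord n :=
  (1 / 4 : ℝ) • postComp ((sharp L p).comp vertOne) (vert (jet3 (energy L) p))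

namespace IsLocalFinsler

variable {U : Set (Coord n)} {L : Coord n → Coord n → ℝ} {p : Coord n × Coord n}

lemma exists_gBilin_equiv (hL : IsLocalFinsler U L) (hp : p ∈ slit U) :
    ∃ e : Coord n ≃L[ℝ] (Coord n →L[ℝ] ℝ), (e : Coord n →L[ℝ] (Coord n →L[ℝ] ℝ)) = gBilin L p := by
  have hT : Function.Injective (gBilin L p : Coord n →ₗ[ℝ] (Coord n →L[ℝ] ℝ)) := by
    intro u v huv
    refine hL.eq_of_gForm_eq hp fun w => ?_
    have : gBilin L p u = gBilin L p v := huv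
    simp [← gBilin_apply, this]
  have hd : Module.finrank ℝ (Coord n) = Module.finrank ℝ (Coord n →L[ℝ] ℝ) := by
    rw [← (LinearMap.toContinuousLinearMap (𝕜 := ℝ) (E := Coord n) (F' := ℝ)).finrank_eq]
    exact (Subspace.dual_finrank_eq (K := ℝ) (V := Coord n)).symm
  exact ⟨(LinearMap.linearEquivOfInjective _ hT hd).toContinuousLinearEquiv, by ext; rfl⟩

lemma gForm_sharp (hL : IsLocalFinsler U L) (hp : p ∈ slit U) (β : Coord n →L[ℝ] ℝ)
    (w : Coord n) : gForm L p (sharp L p β) w = β w := by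
  obtain ⟨e, he⟩ := hL.exists_gBilin_equiv hp
  rw [← gBilin_apply, sharp, ← he, ContinuousLinearMap.inverse_equiv]
  simp

lemma sharp_apply (hL : IsLocalFinsler U L) (hp : p ∈ slit U) (β : Coord n →L[ℝ] ℝ) (i : Fin n) :
    sharp L p β i = ∑ k, gUpper L i k p.1 p.2 * β (basisVec k) :=
  hL.raise_eq hp β (hL.gForm_sharp hp β) i

lemma gBilin_smooth (hL : IsLocalFinsler U L) (hp : p ∈ slit U) :
    ContDiffAt ℝ ∞ (gBilin L) p :=
  (vert_smooth (contDiffAt_fderiv (contDiffAt_fderiv (hL.energy_smooth hp)))).const_smul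
    (1 / 2 : ℝ)

lemma sharp_smooth (hL : IsLocalFinsler U L) (hp : p ∈ slit U) : ContDiffAt ℝ ∞ (sharp L) p := by
  obtain ⟨e, he⟩ := hL.exists_gBilin_equiv hp
  have := contDiffAt_map_inverse (n := ∞) e
  rw [he] at this
  exact this.comp p (hL.gBilin_smooth hp)

lemma sprayForm_smooth (hL : IsLocalFinsler U L) (hp : p ∈ slit U) :
    ContDiffAt ℝ ∞ (sprayForm L) p := by
  have h1 := contDiffAt_fderiv (hL.energy_smooth hp)
  have h2 := contDiffAt_fderiv h1
  have h3 : ContDiffAt ℝ ∞ (fun z : Coord n × Coord n => ((z.2, 0) : Coord n × Coord n)) p :=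
    contDiffAt_snd.prodMk contDiffAt_const
  exact (((h2.clm_apply h3).clm_comp contDiffAt_const).sub
    (h1.clm_comp contDiffAt_const)).const_smul (1 / 4 : ℝ)

lemma sprayVec_smooth (hL : IsLocalFinsler U L) (hp : p ∈ slit U) :
    ContDiffAt ℝ ∞ (sprayVec L) p :=
  (hL.sharp_smooth hp).clm_apply (hL.sprayForm_smooth hp)

lemma connOp_smooth (hL : IsLocalFinsler U L) (hp : p ∈ slit U) :
    ContDiffAt ℝ ∞ (connOp L) p :=
  (contDiffAt_fderiv (hL.sprayVec_smooth hp)).clm_comp contDiffAt_const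

lemma cartanOp_smooth (hL : IsLocalFinsler U L) (hp : p ∈ slit U) :
    ContDiffAt ℝ ∞ (cartanOp L) p := by
  have h3 := contDiffAt_fderiv (contDiffAt_fderiv (contDiffAt_fderiv (hL.energy_smooth hp)))
  exact (postComp_smooth ((hL.sharp_smooth hp).clm_comp contDiffAt_const)
    (vert_smooth h3)).const_smul (1 / 4 : ℝ)

/-- The defining equation of the spray: `(y, -2G)` is the Euler–Lagrange field of `L²`. -/
lemma spray_eq (hL : IsLocalFinsler U L) (hp : p ∈ slit U) (w : Coord n) :
    jet2 (energy L) p (p.2, (-2 : ℝ) • sprayVec L p) (0, w) = fderiv ℝ (energy L) p (w, 0) := by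
  have h1 := hL.gForm_sharp hp (sprayForm L p) w
  have h2 : ((p.2, (-2 : ℝ) • sprayVec L p) : Coord n × Coord n)
      = (p.2, 0) + (-2 : ℝ) • (0, sprayVec L p) := by simp
  rw [h2, map_add, map_smul, add_apply, smul_apply, smul_eq_mul]
  simp only [gForm, sprayForm, smul_apply, sub_apply, ContinuousLinearMap.comp_apply,
    ContinuousLinearMap.inr_apply, ContinuousLinearMap.inl_apply, smul_eq_mul] at h1
  rw [sprayVec]
  simp only [sprayForm]
  linarith

lemma sprayVec_unique (hL : IsLocalFinsler U L) (hp : p ∈ slit U) {v : Coord n}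
    (h : ∀ w, jet2 (energy L) p (p.2, (-2 : ℝ) • v) (0, w) = fderiv ℝ (energy L) p (w, 0)) :
    v = sprayVec L p := by
  refine hL.eq_of_gForm_eq hp fun w => ?_
  have h1 : ∀ v : Coord n, ((p.2, (-2 : ℝ) • v) : Coord n × Coord n)
      = (p.2, 0) + (-2 : ℝ) • (0, v) := by simp
  have h2 := h w
  rw [← hL.spray_eq hp w, h1, h1 (sprayVec L p)] at h2
  simp only [map_add, map_smul, add_apply, smul_apply, smul_eq_mul] at h2
  simp only [gForm]
  linarith

lemma sprayVec_apply (hL : IsLocalFinsler U L) (hp : p ∈ slit U) (i : Fin n) :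
    sprayVec L p i = sprayCoeff L i p.1 p.2 := by
  have hs := hL.energy_smooth hp
  rw [sprayVec, hL.sharp_apply hp, sprayCoeff]
  refine Finset.sum_congr rfl fun l _ => ?_
  have h1 : dX l (fun x y => L x y ^ 2) p.1 p.2 = fderiv ℝ (energy L) p (basisVec l, 0) :=
    dX_eq (differentiableAt_of_smooth hs) l
  have hd := (hasFDerivAt_of_smooth (contDiffAt_fderiv hs)).clm_apply
    (hasFDerivAt_const ((0, basisVec l) : Coord n × Coord n) p)
  have hev : (fun z : Coord n × Coord n => dY l (fun x y => L x y ^ 2) z.1 z.2) =ᶠ[𝓝 p]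
      fun z => fderiv ℝ (energy L) z (0, basisVec l) := by
    filter_upwards [hL.slit_mem_nhds hp] with z hz
    exact dY_eq (differentiableAt_of_smooth (hL.energy_smooth hz)) l
  have h2 : ∀ m, dX m (dY l fun x y => L x y ^ 2) p.1 p.2
      = jet2 (energy L) p (basisVec m, 0) (0, basisVec l) := by
    intro m
    rw [dX_eq (hd.differentiableAt.congr_of_eventuallyEq hev), hev.fderiv_eq, hd.fderiv]
    simp
  have h3 : jet2 (energy L) p (p.2, 0) (0, basisVec l)
      = ∑ m, jet2 (energy L) p (basisVec m, 0) (0, basisVec l) * p.2 m := by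
    have := map_eq_sum ((((jet2 (energy L) p).flip (0, basisVec l))).comp
      (ContinuousLinearMap.inl ℝ _ _)) p.2
    simpa [mul_comm] using this
  simp only [h1, h2, sprayForm, smul_apply, sub_apply, ContinuousLinearMap.comp_apply,
    ContinuousLinearMap.inr_apply, ContinuousLinearMap.inl_apply, smul_eq_mul, h3]
  ring

lemma connOp_basisVec (hL : IsLocalFinsler U L) (hp : p ∈ slit U) (i j : Fin n) :
    connOp L p (basisVec j) i = nonlinConn L i j p.1 p.2 := by
  have hev : (fun z : Coord n × Coord n => sprayCoeff L i z.1 z.2) =ᶠ[𝓝 p]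
      fun z => EuclideanSpace.proj (𝕜 := ℝ) i (sprayVec L z) := by
    filter_upwards [hL.slit_mem_nhds hp] with z hz
    exact (hL.sprayVec_apply hz i).symm
  have hd := (EuclideanSpace.proj (𝕜 := ℝ) i).hasFDerivAt.comp p
    (hasFDerivAt_of_smooth (hL.sprayVec_smooth hp))
  have hd' := hd.congr_of_eventuallyEq hev
  rw [nonlinConn, dY_eq hd'.differentiableAt, hd'.fderiv]
  rfl

lemma hasFDerivAt_sprayVec (hL : IsLocalFinsler U L) (hp : p ∈ slit U) :
    HasFDerivAt (sprayVec L) (fderiv ℝ (sprayVec L) p) p :=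
  hasFDerivAt_of_smooth (hL.sprayVec_smooth hp)

/-- The vertical derivative of the equation of the spray. -/
lemma spray_eq_deriv (hL : IsLocalFinsler U L) (hp : p ∈ slit U) (u w : Coord n) :
    jet3 (energy L) p (p.2, (-2 : ℝ) • sprayVec L p) (0, w) (0, u)
      + jet2 (energy L) p (u, (-2 : ℝ) • connOp L p u) (0, w)
      = jet2 (energy L) p (w, 0) (0, u) := by
  have hs := hL.energy_smooth hp
  have h1 := contDiffAt_fderiv hs
  have h2 := contDiffAt_fderiv h1
  have hξ : HasFDerivAt (fun z : Coord n × Coord n => (z.2, (-2 : ℝ) • sprayVec L z))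
      ((ContinuousLinearMap.snd ℝ _ _).prod ((-2 : ℝ) • fderiv ℝ (sprayVec L) p)) p :=
    hasFDerivAt_snd.prodMk ((hL.hasFDerivAt_sprayVec hp).const_smul (-2 : ℝ))
  have hl := ((hasFDerivAt_of_smooth h2).clm_apply hξ).clm_apply
    (hasFDerivAt_const ((0, w) : Coord n × Coord n) p)
  have hr := (hasFDerivAt_of_smooth h1).clm_apply
    (hasFDerivAt_const ((w, 0) : Coord n × Coord n) p)
  have hev : (fun z => jet2 (energy L) z (z.2, (-2 : ℝ) • sprayVec L z) (0, w)) =ᶠ[𝓝 p]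
      fun z => fderiv ℝ (energy L) z (w, 0) := by
    filter_upwards [hL.slit_mem_nhds hp] with z hz
    exact hL.spray_eq hz w
  have := congrArg (fun T => T (0, u)) (hl.unique (hr.congr_of_eventuallyEq hev))
  simp at this
  rw [jet3_symm_right hL.slit_isOpen hL.energy_contDiffOn hp, jet3_symm_left hs,
    jet3_symm_right hL.slit_isOpen hL.energy_contDiffOn hp, fderiv_fderiv_symm hs (w, 0), ← this,
    jet3_symm_right hL.slit_isOpen hL.energy_contDiffOn hp]
  simp [connOp, add_comm, two_smul]

/-- Euler's identity for the spray: `N y = 2 G`. -/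
lemma connOp_self (hL : IsLocalFinsler U L) (hp : p ∈ slit U) :
    connOp L p p.2 = (2 : ℝ) • sprayVec L p := by
  have hs := hL.energy_smooth hp
  refine hL.eq_of_gForm_eq hp fun w => ?_
  have h1 := hL.spray_eq_deriv hp p.2 w
  have h2 := hL.euler_three hp (p.2, (-2 : ℝ) • sprayVec L p) (0, w)
  have h3 := hL.euler_two hp (w, 0)
  have h4 := hL.spray_eq hp w
  have e : ∀ v : Coord n, ((p.2, (-2 : ℝ) • v) : Coord n × Coord n)
      = (p.2, 0) + (-2 : ℝ) • (0, v) := by simp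
  have e' : ∀ v : Coord n, ((0, (-2 : ℝ) • v) : Coord n × Coord n) = (-2 : ℝ) • (0, v) := by simp
  simp only [e] at h1 h2 h4
  rw [e' (sprayVec L p), fderiv_fderiv_symm hs (0, w)] at h2
  have h5 : fderiv ℝ (energy L) p (0, (0 : Coord n)) = 0 := by
    rw [Prod.mk_zero_zero, map_zero]
  have e'' : ((0, (2 : ℝ) • sprayVec L p) : Coord n × Coord n)
    = (2 : ℝ) • (0, sprayVec L p) := by simp
  simp only [gForm, e'']
  simp only [map_add, map_smul, add_apply, smul_apply, smul_eq_mul, h5] at h1 h2 h3 h4 ⊢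
  linarith

lemma gForm_cartanOp (hL : IsLocalFinsler U L) (hp : p ∈ slit U) (u w z : Coord n) :
    gForm L p (cartanOp L p u w) z = 1 / 4 * jet3 (energy L) p (0, u) (0, w) (0, z) := by
  have h := hL.gForm_sharp hp (vertOne (vert (jet3 (energy L) p) u w)) z
  rw [vertOne_apply, vert_apply] at h
  rw [← h, ← gBilin_apply, ← gBilin_apply]
  simp [cartanOp, postComp_apply, vert_apply]

lemma cartanOp_symm (hL : IsLocalFinsler U L) (hp : p ∈ slit U) (u w : Coord n) :
    cartanOp L p u w = cartanOp L p w u :=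
  hL.eq_of_gForm_eq hp fun z => by
    rw [hL.gForm_cartanOp hp, hL.gForm_cartanOp hp, jet3_symm_left (hL.energy_smooth hp)]

lemma jet3_self (hL : IsLocalFinsler U L) (hp : p ∈ slit U) (u w : Coord n) :
    jet3 (energy L) p (0, u) (0, w) (0, p.2) = 0 := by
  rw [hL.euler_three hp, fderiv_fderiv_symm (hL.energy_smooth hp) (0, w)]
  ring

lemma cartanOp_self (hL : IsLocalFinsler U L) (hp : p ∈ slit U) (u : Coord n) :
    cartanOp L p u p.2 = 0 :=
  hL.eq_of_gForm_eq hp fun z => by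
    rw [hL.gForm_cartanOp hp, jet3_symm_right hL.slit_isOpen hL.energy_contDiffOn hp,
      hL.jet3_self hp, ← gBilin_apply]
    simp

/-- The fundamental tensor is parallel along the spray. -/
lemma jet3_spray (hL : IsLocalFinsler U L) (hp : p ∈ slit U) (u w : Coord n) :
    1 / 2 * jet3 (energy L) p (p.2, (-2 : ℝ) • sprayVec L p) (0, u) (0, w)
      = gForm L p (connOp L p u) w + gForm L p u (connOp L p w) := by
  have hs := hL.energy_smooth hp
  have h1 := hL.spray_eq_deriv hp u w
  have h2 := hL.spray_eq_deriv hp w u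
  rw [jet3_symm_right hL.slit_isOpen hL.energy_contDiffOn hp] at h1
  have e : ∀ v v' : Coord n, ((v, (-2 : ℝ) • v') : Coord n × Coord n)
      = (v, 0) + (-2 : ℝ) • (0, v') := by simp
  rw [hL.gForm_symm hp u]
  simp only [gForm]
  rw [e u] at h1
  rw [e w] at h2
  simp only [map_add, map_smul, add_apply, smul_apply, smul_eq_mul] at h1 h2 ⊢
  linarith

/-! ### The covariant derivative without indices -/

lemma hasFDerivAt_gLower (hL : IsLocalFinsler U L) (hp : p ∈ slit U) (i j : Fin n) :
    HasFDerivAt (fun z : Coord n × Coord n => gLower L i j z.1 z.2)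
      ((1 / 2 : ℝ) • ((jet3 (energy L) p).flip (0, basisVec i)).flip (0, basisVec j)) p := by
  refine ((hasFDerivAt_jet2_apply (hL.energy_smooth hp) _ _).const_mul
    (1 / 2 : ℝ)).congr_of_eventuallyEq ?_
  filter_upwards [hL.slit_mem_nhds hp] with z hz
  exact hL.hessForm_eq hz _ _

lemma dX_gLower (hL : IsLocalFinsler U L) (hp : p ∈ slit U) (k i j : Fin n) :
    dX k (gLower L i j) p.1 p.2
      = 1 / 2 * jet3 (energy L) p (basisVec k, 0) (0, basisVec i) (0, basisVec j) := by
  have h := hL.hasFDerivAt_gLower hp i j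
  rw [dX_eq h.differentiableAt, h.fderiv]
  simp

lemma dY_gLower (hL : IsLocalFinsler U L) (hp : p ∈ slit U) (k i j : Fin n) :
    dY k (gLower L i j) p.1 p.2
      = 1 / 2 * jet3 (energy L) p (0, basisVec k) (0, basisVec i) (0, basisVec j) := by
  have h := hL.hasFDerivAt_gLower hp i j
  rw [dY_eq h.differentiableAt, h.fderiv]
  simp

lemma sum_connOp_smul (hL : IsLocalFinsler U L) (hp : p ∈ slit U) (k : Fin n) :
    ∑ s, nonlinConn L s k p.1 p.2 • basisVec s = connOp L p (basisVec k) := by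
  simp_rw [← hL.connOp_basisVec hp]
  exact sum_smul_basisVec _

lemma deltaX_gLower (hL : IsLocalFinsler U L) (hp : p ∈ slit U) (k i j : Fin n) :
    deltaX L k (gLower L i j) p.1 p.2 = 1 / 2 * jet3 (energy L) p
      (basisVec k, -connOp L p (basisVec k)) (0, basisVec i) (0, basisVec j) := by
  have e : ((basisVec k, -connOp L p (basisVec k)) : Coord n × Coord n)
      = (basisVec k, 0) - ContinuousLinearMap.inr ℝ _ _ (connOp L p (basisVec k)) := by simp
  rw [e, ← hL.sum_connOp_smul hp, deltaX, hL.dX_gLower hp]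
  simp only [hL.dY_gLower hp, map_sum, map_smul, map_sub, sub_apply, sum_apply,
    smul_apply, ContinuousLinearMap.inr_apply, smul_eq_mul, mul_sub, Finset.mul_sum]
  congr 1
  refine Finset.sum_congr rfl fun s _ => ?_
  ring

/-- The horizontal derivatives of `g` contracted with the vector `y`: by homogeneity and the
equation of the spray only the nonlinear connection remains. -/
lemma sum_deltaX_gLower (hL : IsLocalFinsler U L) (hp : p ∈ slit U) (k m : Fin n) :
    ∑ h, (deltaX L k (gLower L m h) p.1 p.2 + deltaX L h (gLower L m k) p.1 p.2
      - deltaX L m (gLower L k h) p.1 p.2) * p.2 h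
      = 2 * gForm L p (connOp L p (basisVec k)) (basisVec m) := by
  have hs := hL.energy_smooth hp
  have hsum : ∀ T : Coord n →L[ℝ] ℝ, ∑ h, T (basisVec h) * p.2 h = T p.2 := by
    intro T
    rw [map_eq_sum T p.2]
    exact Finset.sum_congr rfl fun h _ => by rw [smul_eq_mul, mul_comm]
  have h1 : ∀ k m : Fin n, ∑ h, deltaX L k (gLower L m h) p.1 p.2 * p.2 h
      = 1 / 2 * jet2 (energy L) p (basisVec k, 0) (0, basisVec m) := by
    intro k m
    have h2 := hsum ((1 / 2 : ℝ) • vertOne (jet3 (energy L) p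
      (basisVec k, -connOp L p (basisVec k)) (0, basisVec m)))
    simp only [smul_apply, vertOne_apply, smul_eq_mul] at h2
    simp only [hL.deltaX_gLower hp]
    rw [h2, hL.euler_three hp]
    have e : ((basisVec k, -connOp L p (basisVec k)) : Coord n × Coord n)
      = (basisVec k, 0) + (0, -connOp L p (basisVec k)) := by simp
    rw [e, fderiv_fderiv_symm hs (0, basisVec m)]
    simp only [map_add, add_apply, Prod.snd_add, zero_add]
    ring
  have h3 : ∑ h, deltaX L h (gLower L m k) p.1 p.2 * p.2 h
      = 1 / 2 * jet3 (energy L) p (p.2, (-2 : ℝ) • sprayVec L p) (0, basisVec m)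
        (0, basisVec k) := by
    have h2 := hsum ((1 / 2 : ℝ) • (((jet3 (energy L) p).flip (0, basisVec m)).flip
      (0, basisVec k)).comp ((ContinuousLinearMap.id ℝ _).prod (-connOp L p)))
    simp only [smul_apply, ContinuousLinearMap.comp_apply, ContinuousLinearMap.flip_apply,
      smul_eq_mul, ContinuousLinearMap.prod_apply, ContinuousLinearMap.id_apply,
      neg_apply] at h2
    simp only [hL.deltaX_gLower hp]
    rw [h2, hL.connOp_self hp, neg_smul]
  have h4 := hL.spray_eq_deriv hp (basisVec k) (basisVec m)
  have e : ∀ v v' : Coord n, ((v, (-2 : ℝ) • v') : Coord n × Coord n)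
      = (v, 0) + (-2 : ℝ) • (0, v') := by simp
  rw [e (basisVec k)] at h4
  simp only [sub_mul, add_mul, Finset.sum_add_distrib, Finset.sum_sub_distrib, h1, h3, gForm]
  simp only [map_add, map_smul, add_apply, smul_apply, smul_eq_mul] at h4 ⊢
  linarith

lemma sum_horizCoeff (hL : IsLocalFinsler U L) (hp : p ∈ slit U) (i k : Fin n) :
    ∑ h, horizCoeff L i k h p.1 p.2 * p.2 h = connOp L p (basisVec k) i := by
  rw [hL.raise_eq hp (gBilin L p (connOp L p (basisVec k))) (fun w => (gBilin_apply _ _ _ _).symm)]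
  simp only [gBilin_apply, horizCoeff]
  have : ∀ m, gForm L p (connOp L p (basisVec k)) (basisVec m) = 1 / 2 *
      ∑ h, (deltaX L k (gLower L m h) p.1 p.2 + deltaX L h (gLower L m k) p.1 p.2
      - deltaX L m (gLower L k h) p.1 p.2) * p.2 h := by
    intro m
    rw [hL.sum_deltaX_gLower hp]
    ring
  simp only [this, Finset.mul_sum, Finset.sum_mul]
  rw [Finset.sum_comm]
  refine Finset.sum_congr rfl fun m _ => Finset.sum_congr rfl fun h _ => ?_
  ring

lemma cartanOp_basisVec (hL : IsLocalFinsler U L) (hp : p ∈ slit U) (i k s : Fin n) :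
    cartanOp L p (basisVec k) (basisVec s) i = cartanTensor L i k s p.1 p.2 := by
  rw [hL.raise_eq hp (gBilin L p (cartanOp L p (basisVec k) (basisVec s)))
    (fun w => (gBilin_apply _ _ _ _).symm)]
  simp only [gBilin_apply, cartanTensor, Finset.mul_sum]
  refine Finset.sum_congr rfl fun m _ => ?_
  rw [hL.gForm_cartanOp hp, hL.dY_gLower hp,
    jet3_symm_right hL.slit_isOpen hL.energy_contDiffOn hp]
  ring

end IsLocalFinsler

/-- The covariant acceleration `γ'' + 2G(γ, γ')`. -/
def accel (L : Coord n → Coord n → ℝ) (γ : ℝ → Coord n) (t : ℝ) : Coord n :=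
  deriv (deriv γ) t + (2 : ℝ) • sprayVec L (γ t, deriv γ t)

/-- The covariant derivative `X' + N X + C(X, a)` along `γ`, where `a` is the covariant
acceleration. -/
def covVec (L : Coord n → Coord n → ℝ) (γ X : ℝ → Coord n) (t : ℝ) : Coord n :=
  deriv X t + connOp L (γ t, deriv γ t) (X t) + cartanOp L (γ t, deriv γ t) (X t) (accel L γ t)

namespace IsLocalFinsler

variable {U : Set (Coord n)} {L : Coord n → Coord n → ℝ} {p : Coord n × Coord n}

/-- The covariant derivative along `γ` in terms of the nonlinear connection and the Cartan tensor.
The horizontal coefficients enter only through `Γⁱ_{kh} yʰ = Nⁱ_k`. -/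
lemma covDeriv_eq (hL : IsLocalFinsler U L) {γ X : ℝ → Coord n} {t : ℝ}
    (hp : (γ t, deriv γ t) ∈ slit U) (i : Fin n) :
    covDeriv L γ X t i = covVec L γ X t i := by
  have h1 : ∀ s, deriv (deriv γ) t s
      + ∑ h, nonlinConn L s h (γ t) (deriv γ t) * deriv γ t h = accel L γ t s := by
    intro s
    have h2 := congrArg (fun v : Coord n => v s) (map_eq_sum (connOp L (γ t, deriv γ t))
      (deriv γ t))
    have h3 := hL.connOp_self hp
    simp only at h3
    rw [h3] at h2
    simp only [WithLp.ofLp_sum, Finset.sum_apply, PiLp.smul_apply, smul_eq_mul,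
      hL.connOp_basisVec hp] at h2
    simp only [accel, PiLp.add_apply, PiLp.smul_apply, smul_eq_mul]
    rw [h2]
    congr 1
    exact Finset.sum_congr rfl fun h _ => mul_comm _ _
  have h4 : connOp L (γ t, deriv γ t) (X t) i
      = ∑ k, X t k * ∑ h, horizCoeff L i k h (γ t) (deriv γ t) * deriv γ t h := by
    rw [map_eq_sum (connOp L (γ t, deriv γ t)) (X t)]
    simp only [WithLp.ofLp_sum, Finset.sum_apply, PiLp.smul_apply, smul_eq_mul]
    exact Finset.sum_congr rfl fun k _ => by rw [← hL.sum_horizCoeff hp i k]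
  have h5 : cartanOp L (γ t, deriv γ t) (X t) (accel L γ t) i
      = ∑ k, X t k * ∑ s, cartanTensor L i k s (γ t) (deriv γ t) * accel L γ t s := by
    rw [map_eq_sum (cartanOp L (γ t, deriv γ t)) (X t)]
    simp only [sum_apply, smul_apply, WithLp.ofLp_sum, Finset.sum_apply, PiLp.smul_apply,
      smul_eq_mul]
    refine Finset.sum_congr rfl fun k _ => ?_
    rw [map_eq_sum (cartanOp L (γ t, deriv γ t) (basisVec k)) (accel L γ t)]
    simp only [WithLp.ofLp_sum, Finset.sum_apply, PiLp.smul_apply, smul_eq_mul,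
      hL.cartanOp_basisVec hp]
    congr 1
    exact Finset.sum_congr rfl fun h _ => mul_comm _ _
  simp only [covDeriv, covVec, h1, PiLp.add_apply, h4, h5, add_assoc]
  rw [← Finset.sum_add_distrib]
  congr 1
  exact Finset.sum_congr rfl fun k _ => by ring

lemma covVec_velocity (hL : IsLocalFinsler U L) {γ : ℝ → Coord n} {t : ℝ}
    (hp : (γ t, deriv γ t) ∈ slit U) : covVec L γ (deriv γ) t = accel L γ t := by
  have h1 := hL.connOp_self hp
  have h2 := hL.cartanOp_self hp (accel L γ t)
  rw [hL.cartanOp_symm hp] at h2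
  simp only at h1 h2
  rw [covVec, h1, h2, add_zero, accel]

end IsLocalFinsler

/-! ### Behaviour under linear maps of the fibres -/

section Fibre

variable {U U' : Set (Coord n)} {L L' : Coord n → Coord n → ℝ} {x x' : Coord n}
  {A : Coord n →L[ℝ] Coord n} {κ : ℝ}

lemma fderiv_vertical {F F' : Coord n × Coord n → ℝ} (h : ∀ y ≠ 0, F (x, y) = κ * F' (x', A y))
    {y : Coord n} (hy : y ≠ 0) (hF : DifferentiableAt ℝ F (x, y))
    (hF' : DifferentiableAt ℝ F' (x', A y)) (u : Coord n) :
    fderiv ℝ F (x, y) (0, u) = κ * fderiv ℝ F' (x', A y) (0, A u) := by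
  have h1 := hF.hasFDerivAt.comp y (hasFDerivAt_prodMk_right x y)
  have h2 := ((hF'.hasFDerivAt.comp y ((hasFDerivAt_prodMk_right x' (A y)).comp y
    A.hasFDerivAt))).const_mul κ
  have h3 : (F ∘ fun y => (x, y)) =ᶠ[𝓝 y] fun y => κ * (F' ∘ (fun y => (x', y)) ∘ A) y := by
    filter_upwards [isOpen_ne.mem_nhds hy] with z hz using h z hz
  have := congrArg (fun T => T u) (h1.unique (h2.congr_of_eventuallyEq h3))
  simpa using this

variable (hL : IsLocalFinsler U L) (hL' : IsLocalFinsler U' L') (hx : x ∈ U) (hx' : x' ∈ U')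
  (hA : ∀ y ≠ 0, A y ≠ 0) (h : ∀ y ≠ 0, energy L (x, y) = κ * energy L' (x', A y))

include hL hL' hx hx' hA h

lemma fderiv_energy_fibre {y : Coord n} (hy : y ≠ 0) (u : Coord n) :
    fderiv ℝ (energy L) (x, y) (0, u) = κ * fderiv ℝ (energy L') (x', A y) (0, A u) :=
  fderiv_vertical h hy (differentiableAt_of_smooth (hL.energy_smooth ⟨hx, hy⟩))
    (differentiableAt_of_smooth (hL'.energy_smooth (p := (x', A y)) ⟨hx', hA y hy⟩)) u

lemma jet2_fibre {y : Coord n} (hy : y ≠ 0) (u w : Coord n) :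
    jet2 (energy L) (x, y) (0, u) (0, w) = κ * jet2 (energy L') (x', A y) (0, A u) (0, A w) := by
  have h1 := (hasFDerivAt_of_smooth (contDiffAt_fderiv (hL.energy_smooth
    (p := (x, y)) ⟨hx, hy⟩))).clm_apply (hasFDerivAt_const ((0, w) : Coord n × Coord n) (x, y))
  have h2 := (hasFDerivAt_of_smooth (contDiffAt_fderiv (hL'.energy_smooth (p := (x', A y))
    ⟨hx', hA y hy⟩))).clm_apply (hasFDerivAt_const ((0, A w) : Coord n × Coord n) (x', A y))
  have := fderiv_vertical (fun y hy => fderiv_energy_fibre hL hL' hx hx' hA h hy w) hy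
    h1.differentiableAt h2.differentiableAt u
  rw [h1.fderiv, h2.fderiv] at this
  simpa using this

lemma jet3_fibre {y : Coord n} (hy : y ≠ 0) (u w z : Coord n) :
    jet3 (energy L) (x, y) (0, u) (0, w) (0, z)
      = κ * jet3 (energy L') (x', A y) (0, A u) (0, A w) (0, A z) := by
  have h1 := hasFDerivAt_jet2_apply (hL.energy_smooth (p := (x, y)) ⟨hx, hy⟩) (0, w) (0, z)
  have h2 := hasFDerivAt_jet2_apply (hL'.energy_smooth (p := (x', A y)) ⟨hx', hA y hy⟩)
    (0, A w) (0, A z)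
  have := fderiv_vertical (fun y hy => jet2_fibre hL hL' hx hx' hA h hy w z) hy
    h1.differentiableAt h2.differentiableAt u
  rw [h1.fderiv, h2.fderiv] at this
  simpa using this

lemma gForm_fibre {y : Coord n} (hy : y ≠ 0) (u w : Coord n) :
    gForm L (x, y) u w = κ * gForm L' (x', A y) (A u) (A w) := by
  rw [gForm, gForm, jet2_fibre hL hL' hx hx' hA h hy]
  ring

lemma cartanOp_fibre (hκ : κ ≠ 0) (hsurj : Function.Surjective A) {y : Coord n} (hy : y ≠ 0)
    (u w : Coord n) :
    cartanOp L' (x', A y) (A u) (A w) = A (cartanOp L (x, y) u w) := by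
  refine hL'.eq_of_gForm_eq (p := (x', A y)) ⟨hx', hA y hy⟩ fun z' => ?_
  obtain ⟨z, rfl⟩ := hsurj z'
  refine mul_left_cancel₀ hκ ?_
  rw [← gForm_fibre hL hL' hx hx' hA h hy, hL.gForm_cartanOp ⟨hx, hy⟩,
    hL'.gForm_cartanOp (p := (x', A y)) ⟨hx', hA y hy⟩, jet3_fibre hL hL' hx hx' hA h hy]
  ring

end Fibre

namespace IsLocalFinsler

variable {U : Set (Coord n)} {L : Coord n → Coord n → ℝ} {x : Coord n}

lemma gForm_smul (hL : IsLocalFinsler U L) (hx : x ∈ U) {y : Coord n} (hy : y ≠ 0) {r : ℝ}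
    (hr : 0 < r) (u w : Coord n) : gForm L (x, r • y) u w = gForm L (x, y) u w := by
  have h := gForm_fibre (A := r • ContinuousLinearMap.id ℝ (Coord n)) (κ := (r ^ 2)⁻¹) hL hL hx hx
    (fun y hy => by simp [hr.ne', hy]) (fun y hy => by
      have := hL.energy_homogeneous (p := (x, y)) ⟨hx, hy⟩ hr
      simp only [smul_apply, ContinuousLinearMap.id_apply]
      rw [this]
      field_simp) hy u w
  rw [h]
  simp only [smul_apply, ContinuousLinearMap.id_apply, ← gBilin_apply, map_smul, smul_eq_mul]
  field_simp

lemma cartanOp_smul (hL : IsLocalFinsler U L) (hx : x ∈ U) {y : Coord n} (hy : y ≠ 0) {r : ℝ}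
    (hr : 0 < r) (u w : Coord n) :
    cartanOp L (x, r • y) u w = r⁻¹ • cartanOp L (x, y) u w := by
  have h := cartanOp_fibre (A := r • ContinuousLinearMap.id ℝ (Coord n)) (κ := (r ^ 2)⁻¹) hL hL
    hx hx (fun y hy => by simp [hr.ne', hy]) (fun y hy => by
      have := hL.energy_homogeneous (p := (x, y)) ⟨hx, hy⟩ hr
      simp only [smul_apply, ContinuousLinearMap.id_apply]
      rw [this]
      field_simp) (by positivity) (fun z => ⟨r⁻¹ • z, by simp [smul_smul, hr.ne']⟩) hy
      (r⁻¹ • u) (r⁻¹ • w)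
  simp only [smul_apply, ContinuousLinearMap.id_apply, smul_smul, map_smul] at h
  have e1 : r⁻¹ * r * (r⁻¹ * r) = 1 := by field_simp
  have e2 : r⁻¹ * r⁻¹ * r = r⁻¹ := by field_simp
  rwa [e1, e2, one_smul] at h

end IsLocalFinsler

/-! ### Change of coordinates -/

/-- `ψ` is a local diffeomorphism from `W` carrying the local Finsler function `L` to `L'`. -/
structure IsCoordChange (W : Set (Coord n)) (ψ : Coord n → Coord n)
    (L L' : Coord n → Coord n → ℝ) : Prop where
  isOpen : IsOpen W
  smooth : ContDiffOn ℝ ∞ ψ W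
  bijective : ∀ x ∈ W, Function.Bijective (fderiv ℝ ψ x)
  eq : ∀ x ∈ W, ∀ y, L x y = L' (ψ x) (fderiv ℝ ψ x y)

/-- The differential `(x, y) ↦ (ψ x, dψ_x y)`. -/
def tangentLift (ψ : Coord n → Coord n) (p : Coord n × Coord n) : Coord n × Coord n :=
  (ψ p.1, fderiv ℝ ψ p.1 p.2)

namespace IsCoordChange

variable {U U' W : Set (Coord n)} {L L' : Coord n → Coord n → ℝ} {ψ : Coord n → Coord n}
  {p : Coord n × Coord n}

lemma smoothAt (hψ : IsCoordChange W ψ L L') {x : Coord n} (hx : x ∈ W) : ContDiffAt ℝ ∞ ψ x :=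
  contDiffAt_of_mem_isOpen hψ.isOpen hψ.smooth hx

lemma fderiv_ne_zero (hψ : IsCoordChange W ψ L L') {x : Coord n} (hx : x ∈ W) {y : Coord n}
    (hy : y ≠ 0) : fderiv ℝ ψ x y ≠ 0 := by
  rw [← map_zero (fderiv ℝ ψ x)]
  exact (hψ.bijective x hx).1.ne hy

lemma tangentLift_mem (hψ : IsCoordChange W ψ L L') (hW : Set.MapsTo ψ W U') (hp : p ∈ slit W) :
    tangentLift ψ p ∈ slit U' :=
  ⟨hW hp.1, hψ.fderiv_ne_zero hp.1 hp.2⟩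

lemma hasFDerivAt_tangentLift (hψ : IsCoordChange W ψ L L') (hp : p ∈ slit W) :
    HasFDerivAt (tangentLift ψ)
      (((fderiv ℝ ψ p.1).comp (ContinuousLinearMap.fst ℝ (Coord n) (Coord n))).prod
        ((fderiv ℝ ψ p.1).comp (ContinuousLinearMap.snd ℝ (Coord n) (Coord n)) +
          ((fderiv ℝ (fderiv ℝ ψ) p.1).comp
            (ContinuousLinearMap.fst ℝ (Coord n) (Coord n))).flip p.2)) p := by
  have h := hψ.smoothAt hp.1
  have h1 := (hasFDerivAt_of_smooth h).comp p hasFDerivAt_fst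
  have h2 := ((hasFDerivAt_of_smooth (contDiffAt_fderiv h)).comp p hasFDerivAt_fst).clm_apply
    hasFDerivAt_snd
  exact h1.prodMk h2

lemma fderiv_energy (hψ : IsCoordChange W ψ L L') (hL' : IsLocalFinsler U' L')
    (hW : Set.MapsTo ψ W U') (hp : p ∈ slit W) (a : Coord n × Coord n) :
    fderiv ℝ (energy L) p a = fderiv ℝ (energy L') (tangentLift ψ p)
      (fderiv ℝ ψ p.1 a.1, fderiv ℝ ψ p.1 a.2 + fderiv ℝ (fderiv ℝ ψ) p.1 a.1 p.2) := by
  have h1 := (hasFDerivAt_of_smooth (hL'.energy_smooth (hψ.tangentLift_mem hW hp))).comp p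
    (hψ.hasFDerivAt_tangentLift hp)
  have h2 : energy L =ᶠ[𝓝 p] energy L' ∘ tangentLift ψ := by
    filter_upwards [(isOpen_slit hψ.isOpen).mem_nhds hp] with z hz
    simp [energy, tangentLift, hψ.eq z.1 hz.1 z.2]
  rw [(h1.congr_of_eventuallyEq h2).fderiv]
  simp

lemma jet2_energy (hψ : IsCoordChange W ψ L L') (hL : IsLocalFinsler U L)
    (hL' : IsLocalFinsler U' L') (hWU : W ⊆ U) (hW : Set.MapsTo ψ W U') (hp : p ∈ slit W)
    (a : Coord n × Coord n) (w : Coord n) :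
    jet2 (energy L) p a (0, w) = jet2 (energy L') (tangentLift ψ p)
      (fderiv ℝ ψ p.1 a.1, fderiv ℝ ψ p.1 a.2 + fderiv ℝ (fderiv ℝ ψ) p.1 a.1 p.2)
        (0, fderiv ℝ ψ p.1 w)
      + fderiv ℝ (energy L') (tangentLift ψ p) (0, fderiv ℝ (fderiv ℝ ψ) p.1 a.1 w) := by
  have hpU : p ∈ slit U := ⟨hWU hp.1, hp.2⟩
  have h := hψ.smoothAt hp.1
  have h1 := (hasFDerivAt_of_smooth (contDiffAt_fderiv (hL.energy_smooth hpU))).clm_apply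
    (hasFDerivAt_const ((0, w) : Coord n × Coord n) p)
  have h2 := (((hasFDerivAt_of_smooth (contDiffAt_fderiv (hL'.energy_smooth
    (hψ.tangentLift_mem hW hp)))).comp p (hψ.hasFDerivAt_tangentLift hp))).clm_apply
    ((hasFDerivAt_const (0 : Coord n) p).prodMk
      (((hasFDerivAt_of_smooth (contDiffAt_fderiv h)).comp p hasFDerivAt_fst).clm_apply
        (hasFDerivAt_const w p)))
  have h3 : (fun z => fderiv ℝ (energy L) z (0, w)) =ᶠ[𝓝 p] fun z =>
      (fderiv ℝ (energy L') ∘ tangentLift ψ) z (0, (fderiv ℝ ψ ∘ Prod.fst) z w) := by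
    filter_upwards [(isOpen_slit hψ.isOpen).mem_nhds hp] with z hz
    rw [hψ.fderiv_energy hL' hW hz]
    simp
  have := congrArg (fun T => T a) (h1.unique (h2.congr_of_eventuallyEq h3))
  simp at this
  rw [this]
  ring

/-- The transformation law of the spray. -/
lemma sprayVec_eq (hψ : IsCoordChange W ψ L L') (hL : IsLocalFinsler U L)
    (hL' : IsLocalFinsler U' L') (hWU : W ⊆ U) (hW : Set.MapsTo ψ W U') (hp : p ∈ slit W) :
    sprayVec L' (tangentLift ψ p) = fderiv ℝ ψ p.1 (sprayVec L p)
      - (1 / 2 : ℝ) • fderiv ℝ (fderiv ℝ ψ) p.1 p.2 p.2 := by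
  have hpU : p ∈ slit U := ⟨hWU hp.1, hp.2⟩
  refine (hL'.sprayVec_unique (hψ.tangentLift_mem hW hp) fun w' => ?_).symm
  obtain ⟨w, rfl⟩ := (hψ.bijective p.1 hp.1).2 w'
  have h1 := hL.spray_eq hpU w
  rw [hψ.jet2_energy hL hL' hWU hW hp, hψ.fderiv_energy hL' hW hp] at h1
  have e1 : ((fderiv ℝ ψ p.1 w, fderiv ℝ ψ p.1 0 + fderiv ℝ (fderiv ℝ ψ) p.1 w p.2)
      : Coord n × Coord n)
      = (fderiv ℝ ψ p.1 w, 0) + (0, fderiv ℝ (fderiv ℝ ψ) p.1 w p.2) := by simp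
  have e2 : (-2 : ℝ) • (fderiv ℝ ψ p.1 (sprayVec L p)
      - (1 / 2 : ℝ) • fderiv ℝ (fderiv ℝ ψ) p.1 p.2 p.2)
      = fderiv ℝ ψ p.1 ((-2 : ℝ) • sprayVec L p) + fderiv ℝ (fderiv ℝ ψ) p.1 p.2 p.2 := by
    rw [smul_sub, smul_smul, map_smul]
    norm_num
  simp only [e1, map_add, fderiv_fderiv_symm (hψ.smoothAt hp.1) p.2 w] at h1
  rw [e2]
  simpa [tangentLift] using h1

lemma connOp_eq (hψ : IsCoordChange W ψ L L') (hL : IsLocalFinsler U L)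
    (hL' : IsLocalFinsler U' L') (hWU : W ⊆ U) (hW : Set.MapsTo ψ W U') (hp : p ∈ slit W)
    (w : Coord n) :
    connOp L' (tangentLift ψ p) (fderiv ℝ ψ p.1 w) = fderiv ℝ ψ p.1 (connOp L p w)
      - fderiv ℝ (fderiv ℝ ψ) p.1 p.2 w := by
  have hpU : p ∈ slit U := ⟨hWU hp.1, hp.2⟩
  have h := hψ.smoothAt hp.1
  have h1 := (hL'.hasFDerivAt_sprayVec (hψ.tangentLift_mem hW hp)).comp p
    (hψ.hasFDerivAt_tangentLift hp)
  have hb := (hasFDerivAt_of_smooth (contDiffAt_fderiv h)).comp p hasFDerivAt_fst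
  have hc := (hasFDerivAt_of_smooth (contDiffAt_fderiv (contDiffAt_fderiv h))).comp p
    hasFDerivAt_fst
  have h2 := (hb.clm_apply (hL.hasFDerivAt_sprayVec hpU)).sub
    (((hc.clm_apply hasFDerivAt_snd).clm_apply hasFDerivAt_snd).const_smul (1 / 2 : ℝ))
  have h3 : (sprayVec L' ∘ tangentLift ψ) =ᶠ[𝓝 p] fun z =>
      (fderiv ℝ ψ ∘ Prod.fst) z (sprayVec L z)
        - (1 / 2 : ℝ) • (fderiv ℝ (fderiv ℝ ψ) ∘ Prod.fst) z z.2 z.2 := by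
    filter_upwards [(isOpen_slit hψ.isOpen).mem_nhds hp] with z hz
    exact hψ.sprayVec_eq hL hL' hWU hW hz
  have := congrArg (fun T => T ((0, w) : Coord n × Coord n))
    (h1.unique (h2.congr_of_eventuallyEq h3))
  simp [fderiv_fderiv_symm h w, ← two_smul ℝ, smul_smul] at this
  simpa [connOp] using this

lemma cartanOp_eq (hψ : IsCoordChange W ψ L L') (hL : IsLocalFinsler U L)
    (hL' : IsLocalFinsler U' L') (hWU : W ⊆ U) (hW : Set.MapsTo ψ W U') (hp : p ∈ slit W)
    (u w : Coord n) :
    cartanOp L' (tangentLift ψ p) (fderiv ℝ ψ p.1 u) (fderiv ℝ ψ p.1 w)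
      = fderiv ℝ ψ p.1 (cartanOp L p u w) :=
  cartanOp_fibre hL hL' (hWU hp.1) (hW hp.1) (fun y hy => hψ.fderiv_ne_zero hp.1 hy)
    (κ := 1) (fun y _ => by simp [energy, hψ.eq p.1 hp.1]) one_ne_zero (hψ.bijective p.1 hp.1).2
    hp.2 u w

end IsCoordChange

/-- The covariant derivative of the covariant acceleration of `γ`. -/
def jerk (L : Coord n → Coord n → ℝ) (γ : ℝ → Coord n) (t : ℝ) : Coord n :=
  covVec L γ (accel L γ) t

lemma deriv_smooth {W : Type*} [NormedAddCommGroup W] [NormedSpace ℝ W] {γ : ℝ → W} {t : ℝ}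
    (h : ContDiffAt ℝ ∞ γ t) : ContDiffAt ℝ ∞ (deriv γ) t := by
  have : deriv γ = fun s => fderiv ℝ γ s 1 := by
    ext1 s
    simp
  rw [this]
  exact (contDiffAt_fderiv h).clm_apply contDiffAt_const

lemma smooth_hasDerivAt {W : Type*} [NormedAddCommGroup W] [NormedSpace ℝ W] {γ : ℝ → W} {t : ℝ}
    (h : ContDiffAt ℝ ∞ γ t) :
    HasDerivAt γ (deriv γ t) t := (differentiableAt_of_smooth h).hasDerivAt

namespace IsLocalFinsler

variable {U : Set (Coord n)} {L : Coord n → Coord n → ℝ}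

lemma accel_smooth (hL : IsLocalFinsler U L) {γ : ℝ → Coord n} {t : ℝ}
    (hγ : ContDiffAt ℝ ∞ γ t) (hp : (γ t, deriv γ t) ∈ slit U) :
    ContDiffAt ℝ ∞ (accel L γ) t :=
  (deriv_smooth (deriv_smooth hγ)).add
    (((hL.sprayVec_smooth hp).comp t (hγ.prodMk (deriv_smooth hγ))).const_smul (2 : ℝ))

end IsLocalFinsler

namespace IsCoordChange

variable {U U' W : Set (Coord n)} {L L' : Coord n → Coord n → ℝ} {ψ : Coord n → Coord n}
  {γ : ℝ → Coord n} {t : ℝ}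

lemma deriv_comp_eq (hψ : IsCoordChange W ψ L L') (hγ : ContDiffAt ℝ ∞ γ t) (hp : γ t ∈ W) :
    deriv (ψ ∘ γ) t = fderiv ℝ ψ (γ t) (deriv γ t) :=
  ((hasFDerivAt_of_smooth (hψ.smoothAt hp)).comp_hasDerivAt t (smooth_hasDerivAt hγ)).deriv

lemma accel_eq (hψ : IsCoordChange W ψ L L') (hL : IsLocalFinsler U L)
    (hL' : IsLocalFinsler U' L') (hWU : W ⊆ U) (hW : Set.MapsTo ψ W U')
    (hγ : ∀ᶠ s in 𝓝 t, ContDiffAt ℝ ∞ γ s) (hp : (γ t, deriv γ t) ∈ slit W) :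
    accel L' (ψ ∘ γ) t = fderiv ℝ ψ (γ t) (accel L γ t) := by
  have hγt := hγ.self_of_nhds
  have h1 : deriv (ψ ∘ γ) =ᶠ[𝓝 t] fun s => (fderiv ℝ ψ ∘ γ) s (deriv γ s) := by
    filter_upwards [hγ, hγt.continuousAt.eventually (hψ.isOpen.mem_nhds hp.1)] with s hs hs'
    exact hψ.deriv_comp_eq hs hs'
  have h2 := (((hasFDerivAt_of_smooth (contDiffAt_fderiv (hψ.smoothAt hp.1))).comp_hasDerivAt t
    (smooth_hasDerivAt hγt)).clm_apply (smooth_hasDerivAt (deriv_smooth hγt)))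
  have h3 := hψ.sprayVec_eq hL hL' hWU hW hp
  rw [tangentLift, ← hψ.deriv_comp_eq hγt hp.1] at h3
  simp only at h3
  rw [accel, h1.deriv_eq, h2.deriv]
  simp only [Function.comp_apply]
  rw [h3, accel, map_add, map_smul, smul_sub, smul_smul]
  norm_num
  abel

/-- The third-order operator whose zeros, up to multiples of the velocity, are the circles does not
depend on the coordinates. -/
lemma jerk_eq (hψ : IsCoordChange W ψ L L') (hL : IsLocalFinsler U L)
    (hL' : IsLocalFinsler U' L') (hWU : W ⊆ U) (hW : Set.MapsTo ψ W U')
    (hγ : ∀ᶠ s in 𝓝 t, ContDiffAt ℝ ∞ γ s) (hp : (γ t, deriv γ t) ∈ slit W) :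
    jerk L' (ψ ∘ γ) t = fderiv ℝ ψ (γ t) (jerk L γ t) := by
  have hγt := hγ.self_of_nhds
  have hγp : ContDiffAt ℝ ∞ (fun s => (γ s, deriv γ s)) t := hγt.prodMk (deriv_smooth hγt)
  have h1 : accel L' (ψ ∘ γ) =ᶠ[𝓝 t] fun s => (fderiv ℝ ψ ∘ γ) s (accel L γ s) := by
    filter_upwards [hγ.eventually_nhds, hγp.continuousAt.eventually
      ((isOpen_slit hψ.isOpen).mem_nhds hp)] with s hs hs'
    exact hψ.accel_eq hL hL' hWU hW hs hs'
  have h2 := (((hasFDerivAt_of_smooth (contDiffAt_fderiv (hψ.smoothAt hp.1))).comp_hasDerivAt t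
    (smooth_hasDerivAt hγt)).clm_apply (smooth_hasDerivAt (hL.accel_smooth hγt
      ⟨hWU hp.1, hp.2⟩)))
  have h3 := hψ.connOp_eq hL hL' hWU hW hp (accel L γ t)
  have h4 := hψ.cartanOp_eq hL hL' hWU hW hp (accel L γ t) (accel L γ t)
  rw [tangentLift, ← hψ.deriv_comp_eq hγt hp.1] at h3 h4
  simp only at h3 h4
  rw [jerk, covVec, h1.deriv_eq, h2.deriv, hψ.accel_eq hL hL' hWU hW hγ hp]
  simp only [Function.comp_apply]
  rw [h3, h4, jerk, covVec, map_add, map_add]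
  abel

end IsCoordChange

/-! ### Metric compatibility and existence of circles in coordinates -/

namespace IsLocalFinsler

variable {U : Set (Coord n)} {L : Coord n → Coord n → ℝ} {p : Coord n × Coord n}

lemma fderiv_energy_vertical (hL : IsLocalFinsler U L) (hp : p ∈ slit U) (w : Coord n) :
    fderiv ℝ (energy L) p (0, w) = 2 * gForm L p w p.2 := by
  rw [gForm, hL.euler_two hp]
  ring

lemma gForm_self (hL : IsLocalFinsler U L) (hp : p ∈ slit U) :
    gForm L p p.2 p.2 = energy L p := by
  have h1 := hL.fderiv_energy_vertical hp p.2
  rw [hL.euler_one hp] at h1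
  linarith

/-- `L²` is constant along its spray. -/
lemma fderiv_energy_spray (hL : IsLocalFinsler U L) (hp : p ∈ slit U) :
    fderiv ℝ (energy L) p (p.2, (-2 : ℝ) • sprayVec L p) = 0 := by
  have h1 := hL.spray_eq hp p.2
  rw [hL.euler_two hp] at h1
  have e : ((p.2, (-2 : ℝ) • sprayVec L p) : Coord n × Coord n)
      = (p.2, 0) + (0, (-2 : ℝ) • sprayVec L p) := by simp
  rw [e] at h1 ⊢
  simp only [Prod.snd_add, zero_add] at h1
  rw [map_add] at h1 ⊢
  linarith

variable {γ : ℝ → Coord n} {t : ℝ}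

lemma velocity_eq_spray_add_accel (L : Coord n → Coord n → ℝ) (γ : ℝ → Coord n) (t : ℝ) :
    ((deriv γ t, deriv (deriv γ) t) : Coord n × Coord n)
      = (deriv γ t, (-2 : ℝ) • sprayVec L (γ t, deriv γ t)) + (0, accel L γ t) := by
  simp [accel]

/-- The derivative of `L²` along a curve. -/
lemma hasDerivAt_energy (hL : IsLocalFinsler U L) (hγ : ContDiffAt ℝ ∞ γ t)
    (hp : (γ t, deriv γ t) ∈ slit U) :
    HasDerivAt (fun s => energy L (γ s, deriv γ s))
      (2 * gForm L (γ t, deriv γ t) (accel L γ t) (deriv γ t)) t := by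
  have h1 := (hasFDerivAt_of_smooth (hL.energy_smooth hp)).comp_hasDerivAt t
    ((smooth_hasDerivAt hγ).prodMk (smooth_hasDerivAt (deriv_smooth hγ)))
  have h2 := hL.fderiv_energy_spray hp
  simp only at h2
  rwa [velocity_eq_spray_add_accel L, map_add, h2, hL.fderiv_energy_vertical hp, zero_add] at h1

/-- Metric compatibility of the Cartan covariant derivative along a curve. -/
lemma hasDerivAt_gForm (hL : IsLocalFinsler U L) (hγ : ContDiffAt ℝ ∞ γ t)
    (hp : (γ t, deriv γ t) ∈ slit U) {X Z : ℝ → Coord n} (hX : DifferentiableAt ℝ X t)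
    (hZ : DifferentiableAt ℝ Z t) :
    HasDerivAt (fun s => gForm L (γ s, deriv γ s) (X s) (Z s))
      (gForm L (γ t, deriv γ t) (covVec L γ X t) (Z t)
        + gForm L (γ t, deriv γ t) (X t) (covVec L γ Z t)) t := by
  have hs := hL.energy_smooth hp
  have h1 := (hasFDerivAt_of_smooth (contDiffAt_fderiv (contDiffAt_fderiv hs))).comp_hasDerivAt t
    ((smooth_hasDerivAt hγ).prodMk (smooth_hasDerivAt (deriv_smooth hγ)))
  have h0 := hasDerivAt_const t (0 : Coord n)
  have h2 := ((h1.clm_apply (h0.prodMk hX.hasDerivAt)).clm_apply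
    (h0.prodMk hZ.hasDerivAt)).const_mul (1 / 2 : ℝ)
  have h3 := hL.jet3_spray hp (X t) (Z t)
  have h4 := hL.gForm_cartanOp hp (X t) (accel L γ t) (Z t)
  have h5 := hL.gForm_cartanOp hp (Z t) (accel L γ t) (X t)
  rw [jet3_symm_left hs] at h4
  rw [jet3_symm_left hs, jet3_symm_right hL.slit_isOpen hL.energy_contDiffOn hp] at h5
  rw [hL.gForm_symm hp] at h5
  have h6 : ∀ a b, gForm L (γ t, deriv γ t) a b
    = 1 / 2 * jet2 (energy L) (γ t, deriv γ t) (0, a) (0, b) := fun _ _ => rfl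
  convert! h2 using 1
  rw [velocity_eq_spray_add_accel L]
  simp only [Function.comp_apply, map_add, add_apply, mul_add]
  simp only [covVec, ← gBilin_apply, map_add, add_apply] at h3 h4 h5 h6 ⊢
  have h7 := h6 (deriv X t) (Z t)
  have h8 := h6 (X t) (deriv Z t)
  linarith

end IsLocalFinsler

/-- Solutions of a smooth autonomous differential equation are smooth. -/
lemma contDiffOn_of_hasDerivAt {S : Type*} [NormedAddCommGroup S] [NormedSpace ℝ S] {f : S → S}
    {Ω : Set S} (hf : ContDiffOn ℝ ∞ f Ω) {α : ℝ → S} {J : Set ℝ} (hJ : IsOpen J)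
    (hα : ∀ t ∈ J, HasDerivAt α (f (α t)) t) (hm : Set.MapsTo α J Ω) : ContDiffOn ℝ ∞ α J := by
  rw [contDiffOn_infty]
  intro m
  induction m with
  | zero =>
    exact contDiffOn_zero.2 fun t ht => (hα t ht).continuousAt.continuousWithinAt
  | succ m ih =>
    push_cast
    rw [contDiffOn_succ_iff_deriv_of_isOpen hJ]
    refine ⟨fun t ht => (hα t ht).differentiableAt.differentiableWithinAt, by simp, ?_⟩
    refine (((hf.of_le (by exact_mod_cast le_top)).comp ih hm)).congr fun t ht => ?_
    exact (hα t ht).deriv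

/-- The vector field on the space of triples `(x, X, Y)` whose integral curves are the circles of
curvature `k`. -/
def circleField (L : Coord n → Coord n → ℝ) (k : ℝ) (s : Coord n × Coord n × Coord n) :
    Coord n × Coord n × Coord n :=
  (s.2.1, k • s.2.2 - (2 : ℝ) • sprayVec L (s.1, s.2.1),
    -k • s.2.1 - connOp L (s.1, s.2.1) s.2.2 - cartanOp L (s.1, s.2.1) s.2.2 (k • s.2.2))

namespace IsLocalFinsler

variable {U : Set (Coord n)} {L : Coord n → Coord n → ℝ}

lemma circleField_smooth (hL : IsLocalFinsler U L) (k : ℝ) {s : Coord n × Coord n × Coord n}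
    (hs : (s.1, s.2.1) ∈ slit U) : ContDiffAt ℝ ∞ (circleField L k) s := by
  have h1 : ContDiffAt ℝ ∞ (fun s : Coord n × Coord n × Coord n => (s.1, s.2.1)) s := by fun_prop
  have h2 : ContDiffAt ℝ ∞ (fun s : Coord n × Coord n × Coord n => s.2.1) s := by fun_prop
  have h3 : ContDiffAt ℝ ∞ (fun s : Coord n × Coord n × Coord n => s.2.2) s := by fun_prop
  have hG := (hL.sprayVec_smooth hs).comp s h1
  have hN := (hL.connOp_smooth hs).comp s h1
  have hC := (hL.cartanOp_smooth hs).comp s h1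
  exact h2.prodMk (((h3.const_smul k).sub (hG.const_smul (2 : ℝ))).prodMk
    (((h2.const_smul (-k)).sub (hN.clm_apply h3)).sub
      ((hC.clm_apply h3).clm_apply (h3.const_smul k))))

/-- Along a solution of the circle equations the relations `g(X, X) = 1 = g(Y, Y)` persist, because
`g(X, X) + g(Y, Y)` and `(g(X, X) - g(Y, Y))² + 4 g(X, Y)²` are first integrals. -/
lemma circle_conservation (hL : IsLocalFinsler U L) {γ Y : ℝ → Coord n} {k : ℝ} {J : Set ℝ}
    (hJ : IsOpen J) (hJc : IsPreconnected J) (hγ : ContDiffOn ℝ ∞ γ J) (hY : ContDiffOn ℝ ∞ Y J)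
    (hmem : ∀ s ∈ J, (γ s, deriv γ s) ∈ slit U)
    (h1 : ∀ s ∈ J, accel L γ s = k • Y s) (h2 : ∀ s ∈ J, covVec L γ Y s = -k • deriv γ s)
    {t : ℝ} (ht : t ∈ J) (hX1 : gForm L (γ t, deriv γ t) (deriv γ t) (deriv γ t) = 1)
    (hXY : gForm L (γ t, deriv γ t) (deriv γ t) (Y t) = 0)
    (hY1 : gForm L (γ t, deriv γ t) (Y t) (Y t) = 1) {s : ℝ} (hs : s ∈ J) :
    gForm L (γ s, deriv γ s) (deriv γ s) (deriv γ s) = 1 ∧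
      gForm L (γ s, deriv γ s) (Y s) (Y s) = 1 := by
  set A : ℝ → ℝ := fun s => gForm L (γ s, deriv γ s) (deriv γ s) (deriv γ s) with hA
  set B : ℝ → ℝ := fun s => gForm L (γ s, deriv γ s) (deriv γ s) (Y s) with hB
  set D : ℝ → ℝ := fun s => gForm L (γ s, deriv γ s) (Y s) (Y s) with hD
  have hγs : ∀ s ∈ J, ContDiffAt ℝ ∞ γ s := fun s hs => hγ.contDiffAt (hJ.mem_nhds hs)
  have hγd : ∀ s ∈ J, DifferentiableAt ℝ (deriv γ) s := fun s hs =>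
    differentiableAt_of_smooth (deriv_smooth (hγs s hs))
  have hYd : ∀ s ∈ J, DifferentiableAt ℝ Y s := fun s hs =>
    differentiableAt_of_smooth (hY.contDiffAt (hJ.mem_nhds hs))
  have hcX : ∀ s ∈ J, covVec L γ (deriv γ) s = k • Y s := fun s hs => by
    rw [hL.covVec_velocity (hmem s hs), h1 s hs]
  have dA : ∀ s ∈ J, HasDerivAt A (2 * k * B s) s := by
    intro s hs
    convert! hL.hasDerivAt_gForm (hγs s hs) (hmem s hs) (hγd s hs) (hγd s hs) using 1
    rw [hcX s hs, hL.gForm_symm (hmem s hs) (k • Y s)]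
    simp only [hB, ← gBilin_apply, map_smul, smul_eq_mul]
    ring
  have dB : ∀ s ∈ J, HasDerivAt B (k * D s - k * A s) s := by
    intro s hs
    convert! hL.hasDerivAt_gForm (hγs s hs) (hmem s hs) (hγd s hs) (hYd s hs) using 1
    rw [hcX s hs, h2 s hs]
    simp only [hA, hD, ← gBilin_apply, map_smul, smul_apply, smul_eq_mul]
    ring
  have dD : ∀ s ∈ J, HasDerivAt D (-2 * k * B s) s := by
    intro s hs
    convert! hL.hasDerivAt_gForm (hγs s hs) (hmem s hs) (hYd s hs) (hYd s hs) using 1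
    rw [h2 s hs, hL.gForm_symm (hmem s hs) (Y s)]
    simp only [hB, ← gBilin_apply, map_smul, smul_apply, smul_eq_mul]
    ring
  have dS : ∀ s ∈ J, HasDerivAt (fun s => A s + D s) 0 s := by
    intro s hs
    convert! (dA s hs).add (dD s hs) using 1
    ring
  have dP : ∀ s ∈ J, HasDerivAt (fun s => (A s - D s) ^ 2 + 4 * B s ^ 2) 0 s := by
    intro s hs
    convert! (((dA s hs).sub (dD s hs)).pow 2).add (((dB s hs).pow 2).const_mul 4) using 1
    simp
    ring
  have cS := hJ.is_const_of_deriv_eq_zero hJc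
    (fun s hs => (dS s hs).differentiableAt.differentiableWithinAt)
    (fun s hs => (dS s hs).deriv) hs ht
  have cP := hJ.is_const_of_deriv_eq_zero hJc
    (fun s hs => (dP s hs).differentiableAt.differentiableWithinAt)
    (fun s hs => (dP s hs).deriv) hs ht
  have hA1 : A t = 1 := hX1
  have hB1 : B t = 0 := hXY
  have hD1 : D t = 1 := hY1
  simp only [hA1, hB1, hD1] at cS cP
  have : A s - D s = 0 := by nlinarith [sq_nonneg (A s - D s), sq_nonneg (B s)]
  change A s = 1 ∧ D s = 1
  constructor <;> linarith

/-- Local existence of a circle with given position `x`, unit velocity `X` and covariant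
acceleration `V` orthogonal to `X`. -/
lemma exists_circle (hL : IsLocalFinsler U L) {x X V : Coord n} (hx : x ∈ U) (hX : X ≠ 0)
    (hE : energy L (x, X) = 1) (hV : V ≠ 0) (hXV : gForm L (x, X) X V = 0) :
    ∃ ε > (0 : ℝ), ∃ (γ Y : ℝ → Coord n) (k : ℝ), 0 < k ∧ γ 0 = x ∧ deriv γ 0 = X ∧
      accel L γ 0 = V ∧ ContDiffOn ℝ ∞ γ (Set.Ioo (-ε) ε) ∧ ContDiffOn ℝ ∞ Y (Set.Ioo (-ε) ε) ∧
      ∀ s ∈ Set.Ioo (-ε) ε, (γ s, deriv γ s) ∈ slit U ∧ L (γ s) (deriv γ s) = 1 ∧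
        gForm L (γ s, deriv γ s) (Y s) (Y s) = 1 ∧ accel L γ s = k • Y s ∧
        covVec L γ Y s = -k • deriv γ s := by
  have hp : (x, X) ∈ slit U := ⟨hx, hX⟩
  have hVV := hL.gForm_pos hp hV
  set k := √(gForm L (x, X) V V) with hk
  have hk0 : 0 < k := Real.sqrt_pos.2 hVV
  have hkk : k * k = gForm L (x, X) V V := Real.mul_self_sqrt hVV.le
  obtain ⟨α, hα0, ε₀, hε₀, hα⟩ :=
    ContDiffAt.exists_forall_mem_closedBall_exists_eq_forall_mem_Ioo_hasDerivAt₀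
      ((hL.circleField_smooth k (s := (x, X, k⁻¹ • V)) hp).of_le (by exact_mod_cast le_top)) 0
  have hopen : IsOpen {s : Coord n × Coord n × Coord n | (s.1, s.2.1) ∈ slit U} :=
    hL.slit_isOpen.preimage (by fun_prop)
  have hαc : ContinuousAt α 0 := (hα 0 (by simp [hε₀])).continuousAt
  obtain ⟨ε₁, hε₁, hball⟩ := Metric.mem_nhds_iff.1 (hαc.preimage_mem_nhds
    (hopen.mem_nhds (by rw [hα0]; exact hp)))
  have hε : 0 < min ε₀ ε₁ := lt_min hε₀ hε₁
  set ε := min ε₀ ε₁ with hεdef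
  set J := Set.Ioo (-ε) ε with hJ
  have h0 : (0 : ℝ) ∈ J := ⟨by linarith, hε⟩
  have hα' : ∀ s ∈ J, HasDerivAt α (circleField L k (α s)) s := fun s hs =>
    hα s ⟨by linarith [hs.1, min_le_left ε₀ ε₁], by linarith [hs.2, min_le_left ε₀ ε₁]⟩
  have hmem : ∀ s ∈ J, ((α s).1, (α s).2.1) ∈ slit U := fun s hs => hball (by
    rw [Metric.mem_ball, Real.dist_eq, sub_zero, abs_lt]
    exact ⟨by linarith [hs.1, min_le_right ε₀ ε₁], by linarith [hs.2, min_le_right ε₀ ε₁]⟩)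
  have hsm : ContDiffOn ℝ ∞ α J := contDiffOn_of_hasDerivAt
    (Ω := {s : Coord n × Coord n × Coord n | (s.1, s.2.1) ∈ slit U})
    (fun s hs => (hL.circleField_smooth k hs).contDiffWithinAt) isOpen_Ioo hα' hmem
  set γ : ℝ → Coord n := fun s => (α s).1 with hγdef
  set Y : ℝ → Coord n := fun s => (α s).2.2 with hYdef
  have hγ' : ∀ s ∈ J, deriv γ s = (α s).2.1 := fun s hs =>
    ((ContinuousLinearMap.fst ℝ (Coord n) (Coord n × Coord n)).hasFDerivAt.comp_hasDerivAt s
      (hα' s hs)).deriv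
  have hγ'' : ∀ s ∈ J, deriv (deriv γ) s = (circleField L k (α s)).2.1 := fun s hs => by
    have hev : deriv γ =ᶠ[𝓝 s] fun s => (α s).2.1 := by
      filter_upwards [isOpen_Ioo.mem_nhds hs] with r hr using hγ' r hr
    rw [hev.deriv_eq]
    exact (((ContinuousLinearMap.fst ℝ (Coord n) (Coord n)).comp
      (ContinuousLinearMap.snd ℝ (Coord n) (Coord n × Coord n))).hasFDerivAt.comp_hasDerivAt s
        (hα' s hs)).deriv
  have hacc : ∀ s ∈ J, accel L γ s = k • Y s := fun s hs => by
    rw [accel, hγ'' s hs, hγ' s hs]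
    simp [circleField, hγdef, hYdef]
  have hcov : ∀ s ∈ J, covVec L γ Y s = -k • deriv γ s := fun s hs => by
    have : deriv Y s = (circleField L k (α s)).2.2 :=
      (((ContinuousLinearMap.snd ℝ (Coord n) (Coord n)).comp
        (ContinuousLinearMap.snd ℝ (Coord n) (Coord n × Coord n))).hasFDerivAt.comp_hasDerivAt s
          (hα' s hs)).deriv
    rw [covVec, this, hacc s hs, hγ' s hs]
    simp only [circleField, hγdef, hYdef]
    abel
  have hmem' : ∀ s ∈ J, (γ s, deriv γ s) ∈ slit U := fun s hs => by
    rw [hγ' s hs]; exact hmem s hs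
  have hγsm : ContDiffOn ℝ ∞ γ J := hsm.fst
  have hYsm : ContDiffOn ℝ ∞ Y J := hsm.snd.snd
  have e0 : γ 0 = x := by simp [hγdef, hα0]
  have e1 : deriv γ 0 = X := by rw [hγ' 0 h0, hα0]
  have e2 : Y 0 = k⁻¹ • V := by simp [hYdef, hα0]
  have hcons := fun s (hs : s ∈ J) => hL.circle_conservation isOpen_Ioo isPreconnected_Ioo hγsm
    hYsm hmem' hacc hcov h0 (by rw [e0, e1]; exact (hL.gForm_self hp).trans hE)
    (by rw [e0, e1, e2, ← gBilin_apply, map_smul, gBilin_apply, hXV, smul_zero])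
    (by rw [e0, e1, e2, ← gBilin_apply, map_smul, map_smul, smul_apply, gBilin_apply, ← hkk]
        simp only [smul_eq_mul]
        field_simp) hs
  refine ⟨ε, hε, γ, Y, k, hk0, e0, e1, ?_, hγsm, hYsm, fun s hs => ⟨hmem' s hs, ?_,
    (hcons s hs).2, hacc s hs, hcov s hs⟩⟩
  · rw [hacc 0 h0, e2, smul_smul, mul_inv_cancel₀ hk0.ne', one_smul]
  · have h1 := (hcons s hs).1
    have h2 := hL.gForm_self (hmem' s hs)
    simp only [energy] at h2
    rw [h1] at h2
    have h3 := hL.nonneg _ (hmem' s hs).1 (deriv γ s)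
    nlinarith

end IsLocalFinsler

/-! ### Change of parameter -/

/-- The fibre dilation `(x, y) ↦ (x, r y)`. -/
def dilation (n : ℕ) (r : ℝ) : (Coord n × Coord n) →L[ℝ] (Coord n × Coord n) :=
  (ContinuousLinearMap.fst ℝ (Coord n) (Coord n)).prod
    (r • ContinuousLinearMap.snd ℝ (Coord n) (Coord n))

lemma dilation_apply (r : ℝ) (p : Coord n × Coord n) : dilation n r p = (p.1, r • p.2) := rfl

namespace IsLocalFinsler

variable {U : Set (Coord n)} {L : Coord n → Coord n → ℝ} {p : Coord n × Coord n} {r : ℝ}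

lemma dilation_mem (hp : p ∈ slit U) (hr : 0 < r) : dilation n r p ∈ slit U :=
  ⟨hp.1, smul_ne_zero hr.ne' hp.2⟩

lemma fderiv_energy_dilation (hL : IsLocalFinsler U L) (hp : p ∈ slit U) (hr : 0 < r)
    (a : Coord n × Coord n) :
    fderiv ℝ (energy L) (dilation n r p) (dilation n r a) = r ^ 2 * fderiv ℝ (energy L) p a := by
  have h1 := (hasFDerivAt_of_smooth (hL.energy_smooth (dilation_mem hp hr))).comp p
    (dilation n r).hasFDerivAt
  have h2 := (hasFDerivAt_of_smooth (hL.energy_smooth hp)).const_mul (r ^ 2)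
  have h3 : energy L ∘ dilation n r =ᶠ[𝓝 p] fun z => r ^ 2 * energy L z := by
    filter_upwards [hL.slit_mem_nhds hp] with z hz
    exact hL.energy_homogeneous hz hr
  exact congrArg (fun T => T a) (h1.unique (h2.congr_of_eventuallyEq h3))

lemma jet2_energy_dilation (hL : IsLocalFinsler U L) (hp : p ∈ slit U) (hr : 0 < r)
    (a b : Coord n × Coord n) :
    jet2 (energy L) (dilation n r p) (dilation n r a) (dilation n r b)
      = r ^ 2 * jet2 (energy L) p a b := by
  have h1 := ((hasFDerivAt_of_smooth (contDiffAt_fderiv (hL.energy_smooth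
    (dilation_mem hp hr)))).comp p (dilation n r).hasFDerivAt).clm_apply
    (hasFDerivAt_const (dilation n r b) p)
  have h2 := ((hasFDerivAt_of_smooth (contDiffAt_fderiv (hL.energy_smooth hp))).clm_apply
    (hasFDerivAt_const b p)).const_mul (r ^ 2)
  have h3 : (fun z => (fderiv ℝ (energy L) ∘ dilation n r) z (dilation n r b)) =ᶠ[𝓝 p]
      fun z => r ^ 2 * fderiv ℝ (energy L) z b := by
    filter_upwards [hL.slit_mem_nhds hp] with z hz
    exact hL.fderiv_energy_dilation hz hr b
  have := congrArg (fun T => T a) (h1.unique (h2.congr_of_eventuallyEq h3))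
  simpa using this

/-- The spray coefficients are positively homogeneous of degree two. -/
lemma sprayVec_dilation (hL : IsLocalFinsler U L) (hp : p ∈ slit U) (hr : 0 < r) :
    sprayVec L (dilation n r p) = r ^ 2 • sprayVec L p := by
  refine (hL.sprayVec_unique (dilation_mem hp hr) fun w => ?_).symm
  have e1 : (((dilation n r p).2, (-2 : ℝ) • r ^ 2 • sprayVec L p) : Coord n × Coord n)
      = r • dilation n r (p.2, (-2 : ℝ) • sprayVec L p) := by
    simp only [dilation_apply, Prod.smul_mk, smul_smul]
    ring_nf
  have e2 : ((0, w) : Coord n × Coord n) = r⁻¹ • dilation n r (0, w) := by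
    simp [dilation_apply, smul_smul, hr.ne']
  have e3 : ((w, 0) : Coord n × Coord n) = dilation n r (w, 0) := by simp [dilation_apply]
  rw [e1, e2, e3, hL.fderiv_energy_dilation hp hr, ← hL.spray_eq hp w]
  simp only [map_smul, smul_apply, smul_eq_mul]
  rw [hL.jet2_energy_dilation hp hr]
  field_simp

/-- The nonlinear connection is positively homogeneous of degree one. -/
lemma connOp_dilation (hL : IsLocalFinsler U L) (hp : p ∈ slit U) (hr : 0 < r) (w : Coord n) :
    connOp L (dilation n r p) w = r • connOp L p w := by
  have h1 := (hL.hasFDerivAt_sprayVec (dilation_mem hp hr)).comp p (dilation n r).hasFDerivAt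
  have h2 := (hL.hasFDerivAt_sprayVec hp).const_smul (r ^ 2)
  have h3 : sprayVec L ∘ dilation n r =ᶠ[𝓝 p] fun z => r ^ 2 • sprayVec L z := by
    filter_upwards [hL.slit_mem_nhds hp] with z hz
    exact hL.sprayVec_dilation hz hr
  have h4 := congrArg (fun T => r⁻¹ • T (0, w)) (h1.unique (h2.congr_of_eventuallyEq h3))
  have e : dilation n r (0, w) = r • (0, w) := by simp [dilation_apply]
  simp only [ContinuousLinearMap.comp_apply, e, map_smul, smul_apply, smul_smul] at h4
  have e1 : r⁻¹ * r = 1 := by field_simp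
  have e2 : r⁻¹ * r ^ 2 = r := by field_simp
  rw [e1, e2, one_smul] at h4
  exact h4

variable {γ : ℝ → Coord n} {σ : ℝ → ℝ} {t : ℝ}

lemma deriv_reparam (hγ : ContDiffAt ℝ ∞ γ (σ t)) (hσ : ContDiffAt ℝ ∞ σ t) :
    deriv (γ ∘ σ) t = deriv σ t • deriv γ (σ t) :=
  ((smooth_hasDerivAt hγ).scomp t (smooth_hasDerivAt hσ)).deriv

lemma accel_reparam (hL : IsLocalFinsler U L) (hγ : ∀ᶠ s in 𝓝 (σ t), ContDiffAt ℝ ∞ γ s)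
    (hσ : ∀ᶠ s in 𝓝 t, ContDiffAt ℝ ∞ σ s) (hσ' : 0 < deriv σ t)
    (hp : (γ (σ t), deriv γ (σ t)) ∈ slit U) :
    accel L (γ ∘ σ) t = deriv σ t ^ 2 • accel L γ (σ t)
      + deriv (deriv σ) t • deriv γ (σ t) := by
  have hσt := hσ.self_of_nhds
  have hγt := hγ.self_of_nhds
  have h1 : deriv (γ ∘ σ) =ᶠ[𝓝 t] fun s => deriv σ s • (deriv γ ∘ σ) s := by
    filter_upwards [hσ, hσt.continuousAt.eventually hγ] with s hs hs'
    exact deriv_reparam hs' hs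
  have h2 := (smooth_hasDerivAt (deriv_smooth hσt)).smul
    ((smooth_hasDerivAt (deriv_smooth hγt)).scomp t (smooth_hasDerivAt hσt))
  have h3 := hL.sprayVec_dilation hp hσ'
  rw [dilation_apply] at h3
  have h4 : deriv (fun s => deriv σ s • (deriv γ ∘ σ) s) t = _ := h2.deriv
  rw [accel, h1.deriv_eq, h4, deriv_reparam hγt hσt]
  simp only [Function.comp_apply] at h3 ⊢
  rw [h3, accel, smul_add, smul_smul, smul_smul, smul_smul]
  ring_nf
  abel

/-- Under a change of parameter the third-order operator `jerk` picks up multiples of the covariant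
acceleration and of the velocity. -/
lemma jerk_reparam (hL : IsLocalFinsler U L) (hγ : ∀ᶠ s in 𝓝 (σ t), ContDiffAt ℝ ∞ γ s)
    (hσ : ∀ᶠ s in 𝓝 t, ContDiffAt ℝ ∞ σ s) (hσ' : 0 < deriv σ t)
    (hp : (γ (σ t), deriv γ (σ t)) ∈ slit U) :
    jerk L (γ ∘ σ) t = deriv σ t ^ 3 • jerk L γ (σ t)
      + (3 * deriv σ t * deriv (deriv σ) t) • accel L γ (σ t)
      + deriv (deriv (deriv σ)) t • deriv γ (σ t) := by
  have hσt := hσ.self_of_nhds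
  have hγt := hγ.self_of_nhds
  have hγp : ContDiffAt ℝ ∞ (fun s => (γ s, deriv γ s)) (σ t) := hγt.prodMk (deriv_smooth hγt)
  have h1 : accel L (γ ∘ σ) =ᶠ[𝓝 t] fun s => deriv σ s ^ 2 • (accel L γ ∘ σ) s
      + deriv (deriv σ) s • (deriv γ ∘ σ) s := by
    filter_upwards [hσ.eventually_nhds, hσt.continuousAt.eventually hγ.eventually_nhds,
      (deriv_smooth hσt).continuousAt.eventually (lt_mem_nhds hσ'),
      hσt.continuousAt.eventually (hγp.continuousAt.eventually (hL.slit_mem_nhds hp))]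
      with s h1 h2 h3 h4
    exact hL.accel_reparam h2 h1 h3 h4
  have hd := smooth_hasDerivAt hσt
  have hdd := smooth_hasDerivAt (deriv_smooth hσt)
  have hddd := smooth_hasDerivAt (deriv_smooth (deriv_smooth hσt))
  have hg := (smooth_hasDerivAt (deriv_smooth hγt)).scomp t hd
  have ha := (smooth_hasDerivAt (hL.accel_smooth hγt hp)).scomp t hd
  have h2 := ((hdd.pow 2).smul ha).add (hddd.smul hg)
  have h3 := fun w => hL.connOp_dilation hp hσ' w
  have h4 := fun u w => hL.cartanOp_smul hp.1 hp.2 hσ' u w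
  have h5 := hL.connOp_self hp
  have h6 := hL.cartanOp_self hp
  have h7 := fun w => (hL.cartanOp_symm hp (deriv γ (σ t)) w).trans (h6 w)
  have h8 : deriv (deriv γ) (σ t) = accel L γ (σ t)
      - (2 : ℝ) • sprayVec L (γ (σ t), deriv γ (σ t)) := by simp [accel]
  have h9 : deriv (fun s => deriv σ s ^ 2 • (accel L γ ∘ σ) s
      + deriv (deriv σ) s • (deriv γ ∘ σ) s) t = _ := h2.deriv
  rw [jerk, covVec, h1.deriv_eq, h9, hL.accel_reparam hγ hσ hσ' hp,
    deriv_reparam hγt hσt]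
  simp only [dilation_apply, Function.comp_apply, Pi.pow_apply] at h3 h4 h5 h6 h7 ⊢
  rw [jerk, covVec, h3, h4]
  simp only [map_add, map_smul, add_apply, smul_apply, h5, h6, h7, h8, smul_zero, add_zero]
  match_scalars <;> field_simp <;> ring

end IsLocalFinsler

/-! ### Comparison of two Finsler functions with common circles -/

/-- Some curve `γ` with position `x`, velocity `X` and covariant acceleration `V` for `L` satisfies
at that point the third-order equation of the circles of `L`, and becomes, after a change `σ` of
parameter, a solution of the equation of the circles of `L'` with covariant acceleration orthogonal
to the velocity. -/
def HasCommonCircle (L L' : Coord n → Coord n → ℝ) (x X V : Coord n) : Prop :=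
  ∃ (γ : ℝ → Coord n) (σ : ℝ → ℝ) (t c c' : ℝ),
    (∀ᶠ s in 𝓝 (σ t), ContDiffAt ℝ ∞ γ s) ∧ (∀ᶠ s in 𝓝 t, ContDiffAt ℝ ∞ σ s) ∧
    0 < deriv σ t ∧ γ (σ t) = x ∧ deriv γ (σ t) = X ∧ accel L γ (σ t) = V ∧
    jerk L γ (σ t) = c • X ∧ gForm L' (x, X) (accel L' (γ ∘ σ) t) X = 0 ∧
    jerk L' (γ ∘ σ) t = c' • X

namespace IsLocalFinsler

variable {U : Set (Coord n)} {L L' : Coord n → Coord n → ℝ}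

/-- The covariant acceleration `V` of a common circle satisfies this identity modulo the velocity
`X`; it is polynomial of degree two in `V`. The vector `V' = V + D` is the covariant acceleration
for `L'` of the same curve. The last term comes from the change of parameter: its second derivative
is determined by the orthogonality of acceleration and velocity. -/
lemma circle_identity (hL : IsLocalFinsler U L) (hL' : IsLocalFinsler U L') {x X V : Coord n}
    (hx : x ∈ U) (hX : X ≠ 0) (h : HasCommonCircle L L' x X V)
    (ℓ : Coord n →L[ℝ] ℝ) (hℓ : ℓ X = 0) {D V' : Coord n}
    (hD : D = (2 : ℝ) • (sprayVec L' (x, X) - sprayVec L (x, X))) (hV' : V' = V + D) :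
    gForm L' (x, X) X X * ℓ (-connOp L (x, X) V - cartanOp L (x, X) V V
      + (2 : ℝ) • (fderiv ℝ (sprayVec L') (x, X) (X, V - (2 : ℝ) • sprayVec L (x, X))
        - fderiv ℝ (sprayVec L) (x, X) (X, V - (2 : ℝ) • sprayVec L (x, X)))
      + connOp L' (x, X) V' + cartanOp L' (x, X) V' V') - 3 * gForm L' (x, X) V' X * ℓ V' = 0 := by
  obtain ⟨γ, σ, t, c, c', hγ, hσ, hσ', hγ0, hγ1, hγ2, hj, ho, hj'⟩ := h
  have hp : (x, X) ∈ slit U := ⟨hx, hX⟩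
  have hp' : (γ (σ t), deriv γ (σ t)) ∈ slit U := by rw [hγ0, hγ1]; exact hp
  have hγt := hγ.self_of_nhds
  have hdd : deriv (deriv γ) (σ t) = V - (2 : ℝ) • sprayVec L (x, X) := by
    rw [← hγ2, accel, hγ0, hγ1, add_sub_cancel_right]
  have hacc : accel L' γ = fun s => accel L γ s
      + (2 : ℝ) • (sprayVec L' (γ s, deriv γ s) - sprayVec L (γ s, deriv γ s)) := by
    ext1 s
    simp only [accel, smul_sub]
    abel
  have hacc0 : accel L' γ (σ t) = V' := by
    rw [hacc, hV', hD, ← hγ2]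
    simp only [hγ0, hγ1]
  have hpair : HasDerivAt (fun s => (γ s, deriv γ s))
      (X, V - (2 : ℝ) • sprayVec L (x, X)) (σ t) := by
    have := (smooth_hasDerivAt hγt).prodMk (smooth_hasDerivAt (deriv_smooth hγt))
    rwa [hdd, hγ1] at this
  have hs1 := (hL.hasFDerivAt_sprayVec hp').comp_hasDerivAt _ hpair
  have hs2 := (hL'.hasFDerivAt_sprayVec hp').comp_hasDerivAt _ hpair
  have h1 := ((smooth_hasDerivAt (hL.accel_smooth hγt hp')).add
    ((hs2.sub hs1).const_smul (2 : ℝ)))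
  have hda : deriv (accel L' γ) (σ t) = deriv (accel L γ) (σ t)
      + (2 : ℝ) • (fderiv ℝ (sprayVec L') (x, X) (X, V - (2 : ℝ) • sprayVec L (x, X))
        - fderiv ℝ (sprayVec L) (x, X) (X, V - (2 : ℝ) • sprayVec L (x, X))) := by
    rw [hacc]
    rw [hγ0, hγ1] at h1
    exact h1.deriv
  have hdV : deriv (accel L γ) (σ t) = c • X - connOp L (x, X) V - cartanOp L (x, X) V V := by
    rw [← hj, jerk, covVec, hγ0, hγ1, hγ2]
    abel
  have hjL' : ℓ (jerk L' γ (σ t)) = ℓ (-connOp L (x, X) V - cartanOp L (x, X) V V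
      + (2 : ℝ) • (fderiv ℝ (sprayVec L') (x, X) (X, V - (2 : ℝ) • sprayVec L (x, X))
        - fderiv ℝ (sprayVec L) (x, X) (X, V - (2 : ℝ) • sprayVec L (x, X)))
      + connOp L' (x, X) V' + cartanOp L' (x, X) V' V') := by
    rw [jerk, covVec, hγ0, hγ1, hacc0, hda, hdV]
    simp only [map_add, map_sub, map_smul, map_neg, hℓ, smul_zero]
    ring
  rw [← hjL']
  have h2 := congrArg ℓ hj'
  rw [hL'.jerk_reparam hγ hσ hσ' hp', hacc0, hγ1] at h2
  simp only [map_add, map_smul, hℓ, smul_eq_mul, mul_zero, add_zero] at h2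
  rw [hL'.accel_reparam hγ hσ hσ' hp', hacc0, hγ1] at ho
  simp only [← gBilin_apply, map_add, map_smul, add_apply, smul_apply, smul_eq_mul] at ho ⊢
  have h3 : deriv σ t ^ 3 * (gBilin L' (x, X) X X * ℓ (jerk L' γ (σ t))
      - 3 * gBilin L' (x, X) V' X * ℓ V') = 0 := by
    linear_combination gBilin L' (x, X) X X * h2 - 3 * deriv σ t * ℓ V' * ho
  exact (mul_eq_zero.1 h3).resolve_left (by positivity)

/-- The part of degree two of `circle_identity`, extracted as a second difference of its values at
`V`, `2 V` and `3 V`: the acceleration may be rescaled by positive factors. -/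
lemma quadratic_identity (hL : IsLocalFinsler U L) (hL' : IsLocalFinsler U L') {x X : Coord n}
    (hx : x ∈ U) (hX : X ≠ 0)
    (h : ∀ V ≠ 0, gForm L (x, X) X V = 0 → HasCommonCircle L L' x X V)
    {V : Coord n} (hV : gForm L (x, X) X V = 0) {ℓ : Coord n →L[ℝ] ℝ} (hℓ : ℓ X = 0) :
    gForm L' (x, X) X X * ℓ (cartanOp L' (x, X) V V - cartanOp L (x, X) V V)
      = 3 * gForm L' (x, X) V X * ℓ V := by
  -- There is no circle with zero acceleration, but the identity is trivial for `V = 0`.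
  rcases eq_or_ne V 0 with rfl | hV0
  · simp
  set D := (2 : ℝ) • (sprayVec L' (x, X) - sprayVec L (x, X)) with hD
  have key := fun (s : ℝ) (hs : 0 < s) => hL.circle_identity hL' hx hX (h (s • V)
    (smul_ne_zero hs.ne' hV0) (by rw [← gBilin_apply, map_smul, gBilin_apply, hV, smul_zero]))
    ℓ hℓ hD rfl
  have e : ∀ s : ℝ, ((X, s • V - (2 : ℝ) • sprayVec L (x, X)) : Coord n × Coord n)
      = (X, -(2 : ℝ) • sprayVec L (x, X)) + s • (0, V) := by
    intro s
    simp [sub_eq_neg_add]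
  have k1 := key 1 one_pos
  have k2 := key 2 two_pos
  have k3 := key 3 three_pos
  rw [e] at k1 k2 k3
  simp only [← gBilin_apply, map_add, map_sub, map_neg, map_smul, add_apply, smul_apply,
    smul_eq_mul] at k1 k2 k3 ⊢
  linear_combination (k1 - 2 * k2 + k3) / 2

end IsLocalFinsler

/-! ### Determinants and traces -/

section Matrices

variable {ι : Type*} [Fintype ι] [DecidableEq ι]

lemma det_one_le_of_posSemidef {A : Matrix ι ι ℝ} (h : (A - 1).PosSemidef) : 1 ≤ A.det := by
  have hA : A.IsHermitian := by
    have := h.1.add Matrix.isHermitian_one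
    rwa [sub_add_cancel] at this
  have h1 : ∀ i, 1 ≤ hA.eigenvalues i := by
    intro i
    have h2 := h.dotProduct_mulVec_nonneg (hA.eigenvectorBasis i)
    have h3 := hA.eigenvectorBasis.orthonormal.1 i
    rw [Matrix.sub_mulVec, Matrix.one_mulVec, dotProduct_sub] at h2
    have h4 : star ⇑(hA.eigenvectorBasis i) ⬝ᵥ ⇑(hA.eigenvectorBasis i) = 1 := by
      rw [dotProduct_comm, ← EuclideanSpace.inner_eq_star_dotProduct, real_inner_self_eq_norm_sq,
        h3, one_pow]
    have h5 := hA.eigenvalues_eq i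
    simp only [RCLike.re_to_real] at h5
    rw [h4] at h2
    linarith
  rw [hA.det_eq_prod_eigenvalues]
  exact Finset.one_le_prod fun i _ => h1 i

open scoped MatrixOrder in
/-- The determinant is monotone on positive definite matrices. -/
lemma det_le_det_of_posSemidef_sub {A B : Matrix ι ι ℝ} (hB : B.PosDef)
    (h : (A - B).PosSemidef) : B.det ≤ A.det := by
  obtain ⟨S, hS⟩ := CStarAlgebra.nonneg_iff_eq_star_mul_self.mp hB.posSemidef.nonneg
  rw [Matrix.star_eq_conjTranspose] at hS
  have hdet : B.det = S.det * S.det := by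
    rw [hS, Matrix.det_mul, Matrix.det_conjTranspose, star_trivial]
  have hSu : IsUnit S.det := by
    refine isUnit_iff_ne_zero.2 fun h0 => hB.det_pos.ne' ?_
    rw [hdet, h0, mul_zero]
  have hSS : S * S⁻¹ = 1 := Matrix.mul_nonsing_inv S hSu
  have h1 : (S⁻¹.conjTranspose * A * S⁻¹ - 1).PosSemidef := by
    have h2 := h.conjTranspose_mul_mul_same S⁻¹
    convert! h2 using 1
    rw [Matrix.mul_sub, Matrix.sub_mul, hS]
    congr 1
    rw [← Matrix.mul_assoc, Matrix.mul_assoc, hSS, Matrix.mul_one, ← Matrix.conjTranspose_mul, hSS,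
      Matrix.conjTranspose_one]
  have h3 := det_one_le_of_posSemidef h1
  have h4 : S.det * S⁻¹.det = 1 := by rw [← Matrix.det_mul, hSS, Matrix.det_one]
  rw [Matrix.det_mul, Matrix.det_mul, Matrix.det_conjTranspose, star_trivial] at h3
  calc B.det ≤ B.det * (S⁻¹.det * A.det * S⁻¹.det) := le_mul_of_one_le_right hB.det_pos.le h3
    _ = (S.det * S⁻¹.det) ^ 2 * A.det := by rw [hdet]; ring
    _ = A.det := by rw [h4]; ring

/-- The determinant of a matrix given as a function of two indices. -/
def detFun (A : ι → ι → ℝ) : ℝ := (Matrix.of A).det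

lemma differentiable_detFun : Differentiable ℝ (detFun : (ι → ι → ℝ) → ℝ) := by
  unfold detFun
  simp only [Matrix.det_apply, Matrix.of_apply]
  fun_prop

lemma hasDerivAt_det_one_add_smul (M : Matrix ι ι ℝ) :
    HasDerivAt (fun t : ℝ => (1 + t • M).det) M.trace 0 := by
  have h := (Matrix.det (1 + (Polynomial.X : Polynomial ℝ) • M.map Polynomial.C)).hasDerivAt 0
  rw [Matrix.derivative_det_one_add_X_smul] at h
  convert! h using 1
  ext t
  rw [← Polynomial.coe_evalRingHom, RingHom.map_det]
  congr 1
  ext i j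
  simp [Matrix.one_apply, apply_ite]
  exact mul_comm _ _

/-- Jacobi's formula at an invertible matrix. -/
lemma fderiv_detFun (A H : ι → ι → ℝ) (hA : IsUnit (Matrix.of A).det) :
    fderiv ℝ detFun A H = (Matrix.of A).det * ((Matrix.of A)⁻¹ * Matrix.of H).trace := by
  have h1 : HasDerivAt (fun t : ℝ => A + t • H) H 0 := by
    have := ((hasDerivAt_id (0 : ℝ)).smul_const H).const_add A
    rwa [one_smul] at this
  have h2 : HasFDerivAt (detFun : (ι → ι → ℝ) → ℝ) (fderiv ℝ detFun A) (A + (0 : ℝ) • H) := by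
    rw [zero_smul, add_zero]
    exact (differentiable_detFun A).hasFDerivAt
  have h3 := h2.comp_hasDerivAt (0 : ℝ) h1
  have h4 := (hasDerivAt_det_one_add_smul ((Matrix.of A)⁻¹ * Matrix.of H)).const_mul
    (Matrix.of A).det
  refine h3.unique ?_
  convert! h4 using 1
  ext t
  rw [← Matrix.det_mul, Matrix.mul_add, Matrix.mul_one, Matrix.mul_smul, ← Matrix.mul_assoc,
    Matrix.mul_nonsing_inv _ hA, Matrix.one_mul]
  rfl

end Matrices

/-- If `B(V, W) ≡ c (m(V) W + m(W) V)` modulo `y`, where `B(V, y) = 0` and `m(y) = 0`, then the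
trace of `B(V, ·)` is `n c m(V)`: on the quotient by `y`, of dimension `n - 1`, the right-hand side
has trace `c ((n - 1) m(V) + m(V))`. -/
lemma trace_of_modEq (B : Coord n →L[ℝ] Coord n →L[ℝ] Coord n) (m : Coord n →L[ℝ] ℝ) (c : ℝ)
    {y : Coord n} (hy : y ≠ 0) (hm : m y = 0) (hB : ∀ V, B V y = 0)
    (h : ∀ (ℓ : Coord n →L[ℝ] ℝ), ℓ y = 0 → ∀ V W, ℓ (B V W) = c * (m V * ℓ W + m W * ℓ V))
    (V : Coord n) : ∑ i, B V (basisVec i) i = n * c * m V := by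
  let T : Coord n →L[ℝ] Coord n :=
    B V - (c * m V) • ContinuousLinearMap.id ℝ _ - c • m.smulRight V
  have hT : ∀ w, T w = B V w - (c * m V) • w - c • m w • V := fun w => rfl
  have hℓT : ∀ (ℓ : Coord n →L[ℝ] ℝ), ℓ y = 0 → ∀ w, ℓ (T w) = 0 := by
    intro ℓ hℓ w
    rw [hT]
    simp only [map_sub, map_smul, h ℓ hℓ V w, smul_eq_mul]
    ring
  let τ : Coord n →L[ℝ] ℝ := (‖y‖ ^ 2)⁻¹ • (innerSL ℝ y).comp T
  have hτ : ∀ w, T w = τ w • y := by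
    intro w
    have hyy : ‖y‖ ^ 2 ≠ 0 := pow_ne_zero 2 (norm_ne_zero_iff.2 hy)
    have h1 : inner ℝ (T w - τ w • y) y = 0 := by
      rw [inner_sub_left, inner_smul_left, real_inner_self_eq_norm_sq]
      simp only [τ, smul_apply, ContinuousLinearMap.comp_apply, innerSL_apply_apply, smul_eq_mul,
        conj_trivial]
      rw [real_inner_comm]
      field_simp
      ring
    have h2 := hℓT (innerSL ℝ (T w - τ w • y)) (by rw [innerSL_apply_apply, h1]) w
    rw [innerSL_apply_apply] at h2
    have h3 : inner ℝ (T w - τ w • y) (T w - τ w • y) = 0 := by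
      rw [inner_sub_right (𝕜 := ℝ) (T w - τ w • y), h2, inner_smul_right, h1]
      simp
    exact sub_eq_zero.1 (inner_self_eq_zero.1 h3)
  have htr : ∑ i, T (basisVec i) i = τ y := by
    have h1 := LinearMap.trace_smulRight (τ : Coord n →ₗ[ℝ] ℝ) y
    rw [LinearMap.trace_eq_sum_inner _ (EuclideanSpace.basisFun (Fin n) ℝ)] at h1
    rw [← ContinuousLinearMap.coe_coe τ, ← h1]
    refine Finset.sum_congr rfl fun i _ => ?_
    rw [hτ]
    simp [basisVec, inner_smul_right, EuclideanSpace.inner_single_left]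
  have hTy : T y = (-(c * m V)) • y := by
    rw [hT, hB, hm]
    simp
  have hτy : τ y = -(c * m V) := by
    have h1 := (hτ y).symm.trans hTy
    exact smul_left_injective ℝ hy h1
  rw [hτy] at htr
  have h5 : ∑ i, m (basisVec i) * V i = m V := by
    rw [map_eq_sum m V]
    exact Finset.sum_congr rfl fun i _ => by rw [smul_eq_mul, mul_comm]
  simp only [hT, PiLp.sub_apply, PiLp.smul_apply, smul_eq_mul, Finset.sum_sub_distrib,
    basisVec_apply, if_true, mul_one, Finset.sum_const, Finset.card_univ, Fintype.card_fin,
    nsmul_eq_mul, ← Finset.mul_sum, h5] at htr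
  linarith

/-! ### Rigidity in a tangent space -/

namespace IsLocalFinsler

variable {U : Set (Coord n)} {L L' : Coord n → Coord n → ℝ} {p : Coord n × Coord n}

lemma energy_pos (hL : IsLocalFinsler U L) (hp : p ∈ slit U) : 0 < energy L p := by
  rw [← hL.gForm_self hp]
  exact hL.gForm_pos hp hp.2

lemma pos (hL : IsLocalFinsler U L) (hp : p ∈ slit U) : 0 < L p.1 p.2 := by
  have h1 := hL.energy_pos hp
  have h2 := hL.nonneg p.1 hp.1 p.2
  rw [energy] at h1
  exact lt_of_le_of_ne h2 fun h => by rw [← h] at h1; simp at h1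

/-- The logarithmic derivative of `det g` is twice the trace of the Cartan tensor. -/
lemma exists_hasFDerivAt_det (hL : IsLocalFinsler U L) (hp : p ∈ slit U) :
    ∃ T : (Coord n × Coord n) →L[ℝ] ℝ, HasFDerivAt (fun z => (gMat L z).det) T p ∧
      ∀ V, T (0, V) = (gMat L p).det * (2 * ∑ i, cartanOp L p V (basisVec i) i) := by
  have hdet : IsUnit (gMat L p).det := (hL.gMat_posDef hp).det_pos.ne'.isUnit
  have h1 : HasFDerivAt (fun z : Coord n × Coord n => fun i j => gLower L i j z.1 z.2)
      (ContinuousLinearMap.pi fun i => ContinuousLinearMap.pi fun j => (1 / 2 : ℝ) •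
        ((jet3 (energy L) p).flip (0, basisVec i)).flip (0, basisVec j)) p :=
    hasFDerivAt_pi.2 fun i => hasFDerivAt_pi.2 fun j => hL.hasFDerivAt_gLower hp i j
  have h2 := (differentiable_detFun (fun i j => gLower L i j p.1 p.2)).hasFDerivAt.comp p h1
  refine ⟨_, h2, fun V => ?_⟩
  rw [ContinuousLinearMap.comp_apply, fderiv_detFun _ _ hdet]
  change (gMat L p).det * _ = _
  congr 1
  rw [Matrix.trace, Finset.mul_sum]
  refine Finset.sum_congr rfl fun i _ => ?_
  rw [Matrix.diag_apply, Matrix.mul_apply, hL.raise_eq hp (gBilin L p (cartanOp L p V (basisVec i)))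
    (fun w => (gBilin_apply _ _ _ _).symm), Finset.mul_sum]
  refine Finset.sum_congr rfl fun k _ => ?_
  rw [gBilin_apply, hL.gForm_cartanOp hp]
  have e : (Matrix.of fun a b => gLower L a b p.1 p.2)⁻¹ i k = gUpper L i k p.1 p.2 := rfl
  rw [e]
  simp only [ContinuousLinearMap.pi_apply, smul_apply, ContinuousLinearMap.flip_apply,
    smul_eq_mul, Matrix.of_apply]
  rw [jet3_symm_right hL.slit_isOpen hL.energy_contDiffOn hp]
  ring

/-- The identity satisfied by the fundamental and Cartan tensors of two Finsler functions with the
same circles, at the vector `p.2` attached to the point `p.1`. -/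
def QuadraticIdentity (L L' : Coord n → Coord n → ℝ) (p : Coord n × Coord n) : Prop :=
  ∀ V, gForm L p p.2 V = 0 → ∀ ℓ : Coord n →L[ℝ] ℝ, ℓ p.2 = 0 →
    gForm L' p p.2 p.2 * ℓ (cartanOp L' p V V - cartanOp L p V V)
      = 3 * gForm L' p V p.2 * ℓ V

lemma quadraticIdentity_smul (hL : IsLocalFinsler U L) (hL' : IsLocalFinsler U L')
    {x y : Coord n} (hx : x ∈ U) (hy : y ≠ 0) {r : ℝ} (hr : 0 < r)
    (h : QuadraticIdentity L L' (x, r • y)) : QuadraticIdentity L L' (x, y) := by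
  intro V hV ℓ hℓ
  simp only at hV hℓ ⊢
  have h1 := h V (by
    simp only
    rw [hL.gForm_smul hx hy hr, ← gBilin_apply, map_smul, smul_apply, gBilin_apply, hV,
      smul_zero]) ℓ (by simp [hℓ])
  simp only [hL'.gForm_smul hx hy hr, hL.cartanOp_smul hx hy hr,
    hL'.cartanOp_smul hx hy hr, ← gBilin_apply, map_smul, smul_apply, smul_eq_mul, map_sub] at h1 ⊢
  have h2 : r * (gBilin L' (x, y) y y * (ℓ (cartanOp L' (x, y) V V) - ℓ (cartanOp L (x, y) V V)))
      = r * (3 * gBilin L' (x, y) V y * ℓ V) := by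
    have e : r * r⁻¹ = 1 := mul_inv_cancel₀ hr.ne'
    linear_combination h1 - r * gBilin L' (x, y) y y * (ℓ (cartanOp L' (x, y) V V)
      - ℓ (cartanOp L (x, y) V V)) * e
  exact mul_left_cancel₀ hr.ne' h2

/-- The logarithmic differential of `L' / L`. -/
def logRatioForm (L L' : Coord n → Coord n → ℝ) (p : Coord n × Coord n) : Coord n →L[ℝ] ℝ :=
  (energy L' p)⁻¹ • (gBilin L' p).flip p.2 - (energy L p)⁻¹ • (gBilin L p).flip p.2

lemma logRatioForm_apply (V : Coord n) : logRatioForm L L' p V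
    = (energy L' p)⁻¹ * gForm L' p V p.2 - (energy L p)⁻¹ * gForm L p V p.2 := by
  simp [logRatioForm, gBilin_apply]

/-- The trace of the quadratic identity. It holds in all directions `V`, since both sides vanish in
the direction of the vector `p.2` itself. -/
lemma sum_cartanOp_sub (hL : IsLocalFinsler U L) (hL' : IsLocalFinsler U L') (hp : p ∈ slit U)
    (h : QuadraticIdentity L L' p) (V : Coord n) :
    ∑ i, cartanOp L' p V (basisVec i) i - ∑ i, cartanOp L p V (basisVec i) i
      = n * (3 / 2) * logRatioForm L L' p V := by
  have hE := hL.energy_pos hp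
  have hE' := hL'.energy_pos hp
  have hs := hL.gForm_self hp
  have hs' := hL'.gForm_self hp
  have hc := hL.cartanOp_self hp
  have hc' := hL'.cartanOp_self hp
  have hm : logRatioForm L L' p p.2 = 0 := by
    rw [logRatioForm_apply, hs, hs']
    field_simp
    ring
  have hdiag : ∀ (ℓ : Coord n →L[ℝ] ℝ), ℓ p.2 = 0 → ∀ V,
      ℓ (cartanOp L' p V V - cartanOp L p V V) = 3 * logRatioForm L L' p V * ℓ V := by
    intro ℓ hℓ V
    -- The component of `V` along `p.2` drops out of both sides.
    set a := (energy L p)⁻¹ * gForm L p V p.2 with ha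
    have h1 := h (V - a • p.2) (by
      rw [← gBilin_apply, map_sub, map_smul, gBilin_apply, gBilin_apply, hs,
        hL.gForm_symm hp p.2, smul_eq_mul, ha]
      field_simp
      ring) ℓ hℓ
    have hc1 := fun w => (hL.cartanOp_symm hp p.2 w).trans (hc w)
    have hc1' := fun w => (hL'.cartanOp_symm hp p.2 w).trans (hc' w)
    have h2 : gForm L' p (V - a • p.2) p.2 = energy L' p * logRatioForm L L' p V := by
      rw [logRatioForm_apply, ← gBilin_apply, map_sub, map_smul, sub_apply, smul_apply,
        gBilin_apply, gBilin_apply, hs', ← ha, smul_eq_mul]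
      field_simp
    rw [h2, hs'] at h1
    simp only [map_sub, map_smul, sub_apply, smul_apply, hc, hc', hc1, hc1', smul_zero, sub_zero,
      hℓ] at h1 ⊢
    refine mul_left_cancel₀ hE'.ne' ?_
    linear_combination h1
  have hpol : ∀ (ℓ : Coord n →L[ℝ] ℝ), ℓ p.2 = 0 → ∀ V W,
      ℓ ((cartanOp L' p - cartanOp L p) V W)
        = 3 / 2 * (logRatioForm L L' p V * ℓ W + logRatioForm L L' p W * ℓ V) := by
    intro ℓ hℓ V W
    have h1 := hdiag ℓ hℓ (V + W)
    have h2 := hdiag ℓ hℓ V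
    have h3 := hdiag ℓ hℓ W
    simp only [map_add, add_apply, map_sub, sub_apply, hL.cartanOp_symm hp W V,
      hL'.cartanOp_symm hp W V] at h1 h2 h3 ⊢
    linarith
  have := trace_of_modEq (cartanOp L' p - cartanOp L p) (logRatioForm L L' p) (3 / 2) hp.2 hm
    (fun V => by rw [sub_apply, sub_apply, hc, hc', sub_zero]) hpol V
  simpa [Finset.sum_sub_distrib] using this

/-- The function `log (det g' / det g) - 3n log (L' / L)`. -/
def logDetFun (L L' : Coord n → Coord n → ℝ) (p : Coord n × Coord n) : ℝ :=
  Real.log (gMat L' p).det - Real.log (gMat L p).det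
    - 3 * n / 2 * (Real.log (energy L' p) - Real.log (energy L p))

lemma hasFDerivAt_logDetFun (hL : IsLocalFinsler U L) (hL' : IsLocalFinsler U L') (hp : p ∈ slit U)
    (h : QuadraticIdentity L L' p) :
    HasFDerivAt (fun y => logDetFun L L' (p.1, y)) (0 : Coord n →L[ℝ] ℝ) p.2 := by
  obtain ⟨T, hT, hTV⟩ := hL.exists_hasFDerivAt_det hp
  obtain ⟨T', hT', hTV'⟩ := hL'.exists_hasFDerivAt_det hp
  have hd := (hL.gMat_posDef hp).det_pos
  have hd' := (hL'.gMat_posDef hp).det_pos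
  have hE := hL.energy_pos hp
  have hE' := hL'.energy_pos hp
  have h1 := ((hT'.log hd'.ne').sub (hT.log hd.ne')).sub
    ((((hasFDerivAt_of_smooth (hL'.energy_smooth hp)).log hE'.ne').sub
      ((hasFDerivAt_of_smooth (hL.energy_smooth hp)).log hE.ne')).const_mul (3 * n / 2 : ℝ))
  have h2 := HasFDerivAt.comp (f := fun y : Coord n => (p.1, y)) p.2 h1
    (hasFDerivAt_prodMk_right p.1 p.2)
  convert! h2 using 1
  ext V
  have h3 := hL.sum_cartanOp_sub hL' hp h V
  rw [logRatioForm_apply] at h3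
  simp only [zero_apply, ContinuousLinearMap.comp_apply, sub_apply, smul_apply, smul_eq_mul,
    ContinuousLinearMap.inr_apply, hTV, hTV', hL.fderiv_energy_vertical hp,
    hL'.fderiv_energy_vertical hp]
  rw [inv_mul_cancel_left₀ hd.ne', inv_mul_cancel_left₀ hd'.ne']
  linarith

end IsLocalFinsler

lemma nonneg_second_deriv_of_min {f f' : ℝ → ℝ} {c : ℝ} (h : IsLocalMin f 0)
    (hf : ∀ᶠ t in 𝓝 0, HasDerivAt f (f' t) t) (hf' : HasDerivAt f' c 0) : 0 ≤ c := by
  by_contra hc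
  have hd : deriv f =ᶠ[𝓝 0] f' := by
    filter_upwards [hf] with t ht using ht.deriv
  have h2 : deriv (deriv f) 0 = c := by rw [hd.deriv_eq, hf'.deriv]
  have h3 := isLocalMax_of_deriv_deriv_neg (by rw [h2]; exact not_le.1 hc) h.deriv_eq_zero
    hf.self_of_nhds.continuousAt
  have h4 : f =ᶠ[𝓝 0] fun _ => f 0 := by
    filter_upwards [h, h3] with t h1 h2 using le_antisymm h2 h1
  have h5 : deriv (deriv f) 0 = 0 := by
    have : deriv f =ᶠ[𝓝 0] fun _ => 0 := by
      filter_upwards [h4.eventually_nhds] with t ht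
      have ht' : f =ᶠ[𝓝 t] fun _ => f 0 := ht
      rw [ht'.deriv_eq, deriv_const]
    rw [this.deriv_eq, deriv_const]
  rw [h2] at h5
  exact hc h5.ge

namespace IsLocalFinsler

variable {U : Set (Coord n)} {L L' : Coord n → Coord n → ℝ} {p : Coord n × Coord n}

lemma hasDerivAt_energy_line (hL : IsLocalFinsler U L) (hp : p ∈ slit U) (v : Coord n) :
    (∀ᶠ t in 𝓝 (0 : ℝ), HasDerivAt (fun t : ℝ => energy L (p.1, p.2 + t • v))
      (fderiv ℝ (energy L) (p.1, p.2 + t • v) (0, v)) t) ∧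
    HasDerivAt (fun t : ℝ => fderiv ℝ (energy L) (p.1, p.2 + t • v) (0, v))
      (2 * gForm L p v v) 0 := by
  have hline : ∀ t : ℝ, HasDerivAt (fun t : ℝ => ((p.1, p.2 + t • v) : Coord n × Coord n))
      (0, v) t := by
    intro t
    have := (hasDerivAt_const t p.1).prodMk
      (((hasDerivAt_id t).smul_const v).const_add p.2)
    simpa using this
  have h0 : ((p.1, p.2 + (0 : ℝ) • v) : Coord n × Coord n) = p := by simp
  constructor
  · have : ∀ᶠ t in 𝓝 (0 : ℝ), ((p.1, p.2 + t • v) : Coord n × Coord n) ∈ slit U := by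
      refine (hline 0).continuousAt.eventually (hL.slit_mem_nhds ?_)
      simpa only [h0] using hp
    filter_upwards [this] with t ht
    exact (hasFDerivAt_of_smooth (hL.energy_smooth ht)).comp_hasDerivAt t (hline t)
  · have h1 := hasFDerivAt_of_smooth (contDiffAt_fderiv (hL.energy_smooth hp))
    have h1' : HasFDerivAt (fderiv ℝ (energy L)) (jet2 (energy L) p)
      (p.1, p.2 + (0 : ℝ) • v) := by rwa [h0]
    have h2 : HasDerivAt (fun t : ℝ => fderiv ℝ (energy L) (p.1, p.2 + t • v))
      (jet2 (energy L) p (0, v)) 0 := h1'.comp_hasDerivAt (0 : ℝ) (hline 0)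
    have h3 := h2.clm_apply (hasDerivAt_const (0 : ℝ) ((0, v) : Coord n × Coord n))
    rw [map_zero, add_zero] at h3
    convert! h3 using 1
    rw [gForm]
    ring

/-- The second-order condition at an extremum of `L' / L`: if `κ' L'² ≤ κ L²` on a fibre, with
equality at `y`, then `κ' g'_y ≤ κ g_y`. -/
lemma gForm_le_of_energy_le (hL : IsLocalFinsler U L) (hL' : IsLocalFinsler U L')
    (hp : p ∈ slit U) {κ κ' : ℝ}
    (hle : ∀ y ≠ 0, κ' * energy L' (p.1, y) ≤ κ * energy L (p.1, y))
    (heq : κ' * energy L' p = κ * energy L p) (v : Coord n) :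
    κ' * gForm L' p v v ≤ κ * gForm L p v v := by
  obtain ⟨h1, h2⟩ := hL.hasDerivAt_energy_line hp v
  obtain ⟨h3, h4⟩ := hL'.hasDerivAt_energy_line hp v
  have hne : ∀ᶠ t in 𝓝 (0 : ℝ), p.2 + t • v ≠ 0 := by
    have hc : ContinuousAt (fun t : ℝ => p.2 + t • v) 0 := by fun_prop
    refine hc.eventually (isOpen_ne.mem_nhds ?_)
    simpa using hp.2
  have := nonneg_second_deriv_of_min
    (f := fun t : ℝ => κ * energy L (p.1, p.2 + t • v) - κ' * energy L' (p.1, p.2 + t • v))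
    (f' := fun t : ℝ => κ * fderiv ℝ (energy L) (p.1, p.2 + t • v) (0, v)
      - κ' * fderiv ℝ (energy L') (p.1, p.2 + t • v) (0, v))
    (c := κ * (2 * gForm L p v v) - κ' * (2 * gForm L' p v v)) ?_ ?_ ?_
  · linarith
  · filter_upwards [hne] with t ht
    have := hle _ ht
    simp [heq]
    linarith
  · filter_upwards [h1, h3] with t ht ht'
    exact (ht.const_mul κ).sub (ht'.const_mul κ')
  · exact (h2.const_mul κ).sub (h4.const_mul κ')

lemma det_le_of_gForm_le (hL : IsLocalFinsler U L) (hL' : IsLocalFinsler U L')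
    (hp : p ∈ slit U) {κ κ' : ℝ} (hκ' : 0 < κ')
    (h : ∀ v, κ' * gForm L' p v v ≤ κ * gForm L p v v) :
    κ' ^ n * (gMat L' p).det ≤ κ ^ n * (gMat L p).det := by
  have hpd : (κ' • gMat L' p).PosDef := (hL'.gMat_posDef hp).smul hκ'
  have h1 : (κ • gMat L p - κ' • gMat L' p).PosSemidef := by
    refine Matrix.PosSemidef.of_dotProduct_mulVec_nonneg ?_ ?_
    · refine Matrix.IsHermitian.sub ?_ hpd.1
      rw [Matrix.IsHermitian, Matrix.conjTranspose_smul, star_trivial,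
        (hL.gMat_isHermitian hp).eq]
    · intro v
      have := h (WithLp.toLp 2 v)
      rw [Matrix.sub_mulVec, dotProduct_sub, Matrix.smul_mulVec, Matrix.smul_mulVec,
        dotProduct_smul, dotProduct_smul, hL.dotProduct_gMat_mulVec hp,
        hL'.dotProduct_gMat_mulVec hp]
      simpa using this
  have h2 := det_le_det_of_posSemidef_sub hpd h1
  simpa [Matrix.det_smul] using h2

end IsLocalFinsler

namespace IsLocalFinsler

variable {U : Set (Coord n)} {L L' : Coord n → Coord n → ℝ} {p : Coord n × Coord n}

lemma logDetFun_const (hn : 2 ≤ n) (hL : IsLocalFinsler U L) (hL' : IsLocalFinsler U L')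
    {x : Coord n} (hx : x ∈ U) (h : ∀ y ≠ 0, QuadraticIdentity L L' (x, y)) {y z : Coord n}
    (hy : y ≠ 0) (hz : z ≠ 0) : logDetFun L L' (x, y) = logDetFun L L' (x, z) := by
  have hrank : 1 < Module.rank ℝ (Coord n) := by
    rw [← Module.finrank_eq_rank, finrank_euclideanSpace_fin]
    exact_mod_cast hn
  have hconn := isConnected_compl_singleton_of_one_lt_rank hrank (0 : Coord n)
  have hd : ∀ y : Coord n, y ≠ 0 →
      HasFDerivAt (fun y => logDetFun L L' (x, y)) (0 : Coord n →L[ℝ] ℝ) y :=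
    fun y hy => hL.hasFDerivAt_logDetFun hL' (p := (x, y)) ⟨hx, hy⟩ (h y hy)
  exact isOpen_compl_singleton.is_const_of_fderiv_eq_zero hconn.isPreconnected
    (fun y hy => (hd y hy).differentiableAt.differentiableWithinAt)
    (fun y hy => (hd y hy).fderiv) hy hz

lemma logDetFun_le (hL : IsLocalFinsler U L) (hL' : IsLocalFinsler U L') (hp : p ∈ slit U)
    {κ : ℝ} (hκ : 0 < κ) (hle : ∀ y ≠ 0, energy L' (p.1, y) ≤ κ * energy L (p.1, y))
    (heq : energy L' p = κ * energy L p) :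
    logDetFun L L' p ≤ -(n / 2) * Real.log κ := by
  have h1 := hL.det_le_of_gForm_le hL' hp one_pos
    (hL.gForm_le_of_energy_le hL' hp (κ := κ) (κ' := 1) (by simpa using hle) (by simpa using heq))
  have hd := (hL.gMat_posDef hp).det_pos
  have hd' := (hL'.gMat_posDef hp).det_pos
  have hE := hL.energy_pos hp
  rw [one_pow, one_mul] at h1
  have h2 := Real.log_le_log hd' h1
  rw [Real.log_mul (pow_pos hκ n).ne' hd.ne', Real.log_pow] at h2
  rw [logDetFun, heq, Real.log_mul hκ.ne' hE.ne']
  linarith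

lemma le_logDetFun (hL : IsLocalFinsler U L) (hL' : IsLocalFinsler U L') (hp : p ∈ slit U)
    {κ : ℝ} (hκ : 0 < κ) (hle : ∀ y ≠ 0, κ * energy L (p.1, y) ≤ energy L' (p.1, y))
    (heq : energy L' p = κ * energy L p) :
    -(n / 2) * Real.log κ ≤ logDetFun L L' p := by
  have h1 := hL'.det_le_of_gForm_le hL hp hκ
    (hL'.gForm_le_of_energy_le hL hp (κ := 1) (κ' := κ) (by simpa using hle)
      (by simpa using heq.symm))
  have hd := (hL.gMat_posDef hp).det_pos
  have hd' := (hL'.gMat_posDef hp).det_pos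
  have hE := hL.energy_pos hp
  rw [one_pow, one_mul] at h1
  have h2 := Real.log_le_log (mul_pos (pow_pos hκ n) hd) h1
  rw [Real.log_mul (pow_pos hκ n).ne' hd.ne', Real.log_pow] at h2
  rw [logDetFun, heq, Real.log_mul hκ.ne' hE.ne']
  linarith

/-- Two Finsler functions satisfying the quadratic identity at all nonzero vectors of a tangent
space are proportional there: `logDetFun` is constant, and comparing its values at a maximum and
at a minimum of `L' / L`, where the fundamental tensors are comparable, shows that the maximum
and the minimum agree. -/
theorem exists_energy_eq (hn : 2 ≤ n) (hL : IsLocalFinsler U L) (hL' : IsLocalFinsler U L')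
    {x : Coord n} (hx : x ∈ U) (h : ∀ y ≠ 0, QuadraticIdentity L L' (x, y)) :
    ∃ κ : ℝ, 0 < κ ∧ ∀ y ≠ 0, energy L' (x, y) = κ * energy L (x, y) := by
  have hp : ∀ {y : Coord n}, y ≠ 0 → ((x, y) : Coord n × Coord n) ∈ slit U := fun hy => ⟨hx, hy⟩
  let S := Metric.sphere (0 : Coord n) 1
  have hS0 : ∀ y ∈ S, y ≠ 0 := fun y hy => ne_zero_of_mem_unit_sphere ⟨y, hy⟩
  have hSne : S.Nonempty :=
    ⟨basisVec ⟨0, by omega⟩, by simp [S, basisVec]⟩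
  let q : Coord n → ℝ := fun y => energy L' (x, y) / energy L (x, y)
  have hqc : ContinuousOn q S := by
    intro y hy
    have hc : ContinuousAt (fun y : Coord n => (x, y)) y := by fun_prop
    refine ContinuousAt.continuousWithinAt (ContinuousAt.div ?_ ?_ ?_)
    · exact ContinuousAt.comp (f := fun y : Coord n => (x, y))
        (hL'.energy_smooth (hp (hS0 y hy))).continuousAt hc
    · exact ContinuousAt.comp (f := fun y : Coord n => (x, y))
        (hL.energy_smooth (hp (hS0 y hy))).continuousAt hc
    · exact (hL.energy_pos (hp (hS0 y hy))).ne'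
  have hcomp : IsCompact S := isCompact_sphere 0 1
  have hqpos : ∀ y ≠ 0, 0 < q y :=
    fun y hy => div_pos (hL'.energy_pos (hp hy)) (hL.energy_pos (hp hy))
  have hq : ∀ y ≠ 0, energy L' (x, y) = q y * energy L (x, y) := fun y hy =>
    (div_mul_cancel₀ _ (hL.energy_pos (hp hy)).ne').symm
  have hqs : ∀ y ≠ 0, ∃ z ∈ S, q z = q y := by
    intro y hy
    have hr : 0 < ‖y‖⁻¹ := inv_pos.2 (norm_pos_iff.2 hy)
    refine ⟨‖y‖⁻¹ • y, ?_, ?_⟩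
    · simp [S, norm_smul, norm_ne_zero_iff.2 hy]
    · simp only [q]
      rw [hL.energy_homogeneous (hp hy) hr, hL'.energy_homogeneous (hp hy) hr,
        mul_div_mul_left _ _ (pow_pos hr 2).ne']
  obtain ⟨y₁, hy₁, hmax⟩ := hcomp.exists_isMaxOn hSne hqc
  obtain ⟨y₂, hy₂, hmin⟩ := hcomp.exists_isMinOn hSne hqc
  have h1 := hS0 y₁ hy₁
  have h2 := hS0 y₂ hy₂
  have hle : ∀ y ≠ 0, q y ≤ q y₁ := by
    intro y hy
    obtain ⟨z, hz, e⟩ := hqs y hy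
    rw [← e]
    exact hmax hz
  have hge : ∀ y ≠ 0, q y₂ ≤ q y := by
    intro y hy
    obtain ⟨z, hz, e⟩ := hqs y hy
    rw [← e]
    exact hmin hz
  have k1 := hL.logDetFun_le hL' (hp h1) (hqpos y₁ h1) (fun y hy => by
    rw [hq y hy]
    exact mul_le_mul_of_nonneg_right (hle y hy) (hL.energy_pos (hp hy)).le) (hq y₁ h1)
  have k2 := hL.le_logDetFun hL' (hp h2) (hqpos y₂ h2) (fun y hy => by
    rw [hq y hy]
    exact mul_le_mul_of_nonneg_right (hge y hy) (hL.energy_pos (hp hy)).le) (hq y₂ h2)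
  rw [hL.logDetFun_const hn hL' hx h h2 h1] at k2
  have hn0 : (0 : ℝ) < n / 2 := by
    have : (2 : ℝ) ≤ n := by exact_mod_cast hn
    linarith
  have k3 : Real.log (q y₁) ≤ Real.log (q y₂) := by
    have := k2.trans k1
    nlinarith
  have k4 : q y₁ ≤ q y₂ := (Real.log_le_log_iff (hqpos y₁ h1) (hqpos y₂ h2)).1 k3
  refine ⟨q y₁, hqpos y₁ h1, fun y hy => ?_⟩
  rw [hq y hy, le_antisymm (hle y hy) (k4.trans (hge y hy))]

end IsLocalFinsler

/-! ### Coordinate expressions of Finsler structures -/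

lemma hessForm_comp_linear {V W : Type*} [AddCommGroup V] [Module ℝ V] [AddCommGroup W]
    [Module ℝ W] (A : V →ₗ[ℝ] W) (f : W → ℝ) (y u v : V) :
    hessForm (fun z => f (A z)) y u v = hessForm f (A y) (A u) (A v) := by
  simp [hessForm, lineDeriv]

/-- No differentiability is needed: `lineDeriv` commutes with constant factors in all cases. -/
lemma hessForm_const_mul {V : Type*} [AddCommGroup V] [Module ℝ V] (a : ℝ) (f : V → ℝ)
    (y u v : V) : hessForm (fun z => a * f z) y u v = a ^ 2 * hessForm f y u v := by
  simp only [hessForm, lineDeriv, mul_pow, deriv_const_mul_field']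
  ring

section Charts

variable {M : Type*} [TopologicalSpace M] [ChartedSpace (Coord n) M]
variable {e : OpenPartialHomeomorph M (Coord n)}

/-- A chart of the maximal atlas, as a partial diffeomorphism. -/
def chartDiffeomorph (he : e ∈ IsManifold.maximalAtlas (𝓡 n) ∞ M) :
    PartialDiffeomorph (𝓡 n) (𝓡 n) M (Coord n) ∞ where
  toPartialEquiv := e.toPartialEquiv
  open_source := e.open_source
  open_target := e.open_target
  contMDiffOn_toFun := contMDiffOn_of_mem_maximalAtlas he
  contMDiffOn_invFun := contMDiffOn_symm_of_mem_maximalAtlas he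

lemma isLocalDiffeomorphAt_chart (he : e ∈ IsManifold.maximalAtlas (𝓡 n) ∞ M) {x : M}
    (hx : x ∈ e.source) : IsLocalDiffeomorphAt (𝓡 n) (𝓡 n) ∞ e x :=
  ⟨chartDiffeomorph he, hx, fun _ _ => rfl⟩

lemma isLocalDiffeomorphAt_chart_symm (he : e ∈ IsManifold.maximalAtlas (𝓡 n) ∞ M)
    {x : Coord n} (hx : x ∈ e.target) : IsLocalDiffeomorphAt (𝓡 n) (𝓡 n) ∞ e.symm x :=
  ⟨(chartDiffeomorph he).symm, hx, fun _ _ => rfl⟩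

lemma mfderiv_chart_symm (he : e ∈ IsManifold.maximalAtlas (𝓡 n) ∞ M) {x : Coord n}
    (hx : x ∈ e.target) (y : Coord n) :
    mfderiv (𝓡 n) (𝓡 n) e (e.symm x) (mfderiv (𝓡 n) (𝓡 n) e.symm x y) = y := by
  have h1 : e ∘ e.symm =ᶠ[𝓝 x] id := by
    filter_upwards [e.open_target.mem_nhds hx] with z hz using e.right_inv hz
  have h2 := mfderiv_comp x ((isLocalDiffeomorphAt_chart he (e.map_target hx)).mdifferentiableAt
    (by simp)) ((isLocalDiffeomorphAt_chart_symm he hx).mdifferentiableAt (by simp))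
  rw [h1.mfderiv_eq, mfderiv_id] at h2
  exact (DFunLike.congr_fun h2 y).symm

lemma velocity_comp {h : Coord n → M} {γ : ℝ → Coord n} {s : ℝ}
    (hh : IsLocalDiffeomorphAt (𝓡 n) (𝓡 n) ∞ h (γ s)) (hγ : ContDiffAt ℝ ∞ γ s) :
    velocity (h ∘ γ) s = mfderiv (𝓡 n) (𝓡 n) h (γ s) (deriv γ s) := by
  have hd : DifferentiableAt ℝ γ s := differentiableAt_of_smooth hγ
  rw [velocity, mfderiv_comp s (hh.mdifferentiableAt (by simp)) hd.mdifferentiableAt,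
    mfderiv_eq_fderiv]
  change mfderiv (𝓡 n) (𝓡 n) h (γ s) (fderiv ℝ γ s 1) = _
  rw [fderiv_apply_one_eq_deriv]
  rfl

end Charts

section Manifold

variable {M : Type*} [TopologicalSpace M] [ChartedSpace (Coord n) M] [IsManifold (𝓡 n) ∞ M]

/-- The pull-back of `F` by the map `h` from `ℝⁿ` to `M`, as a function of position and vector. -/
def FinslerStructure.pullBack (F : FinslerStructure n M) (h : Coord n → M) (x y : Coord n) : ℝ :=
  F.toFun ⟨h x, mfderiv 𝓘(ℝ, Coord n) (𝓡 n) h x y⟩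

lemma FinslerStructure.zero (F : FinslerStructure n M) (x : M) :
    F.toFun ⟨x, (0 : TangentSpace (𝓡 n) x)⟩ = 0 := by
  have h := F.homogeneous x 0 2 two_pos
  rw [smul_zero] at h
  linarith

lemma mfderiv_bijective {M₁ M₂ : Type*} [TopologicalSpace M₁] [ChartedSpace (Coord n) M₁]
    [TopologicalSpace M₂] [ChartedSpace (Coord n) M₂] {f : M₁ → M₂} {x : M₁}
    (hf : IsLocalDiffeomorphAt (𝓡 n) (𝓡 n) ∞ f x) :
    Function.Bijective (mfderiv (𝓡 n) (𝓡 n) f x) := by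
  have := (hf.mfderivToContinuousLinearEquiv (by simp)).bijective
  exact this

lemma contMDiffOn_tangentMap_model {U : Set (Coord n)} (hU : IsOpen U) {h : Coord n → M}
    (hh : ContMDiffOn 𝓘(ℝ, Coord n) (𝓡 n) ∞ h U) :
    ContMDiffOn 𝓘(ℝ, Coord n × Coord n) (𝓡 n).tangent ∞
      (fun p : Coord n × Coord n =>
        (⟨h p.1, mfderiv 𝓘(ℝ, Coord n) (𝓡 n) h p.1 p.2⟩ : TangentBundle (𝓡 n) M))
      {p | p.1 ∈ U} := by
  have h1 := hh.contMDiffOn_tangentMapWithin (m := ∞) (by simp) hU.uniqueMDiffOn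
  have h2 : ContMDiff 𝓘(ℝ, Coord n × Coord n) (𝓘(ℝ, Coord n)).tangent ∞
      (fun p : Coord n × Coord n => (⟨p.1, p.2⟩ : TangentBundle 𝓘(ℝ, Coord n) (Coord n))) := by
    have h3 := contMDiff_tangentBundleModelSpaceHomeomorph_symm (I := 𝓘(ℝ, Coord n)) (n := ∞)
    rw [modelWithCornersSelf_prod]
    exact h3
  refine (h1.comp h2.contMDiffOn fun p hp => hp).congr fun p hp => ?_
  simp only [Function.comp_apply, tangentMapWithin]
  rw [mfderivWithin_of_isOpen hU hp]

lemma FinslerStructure.isLocalFinsler_pullBack (F : FinslerStructure n M) {U : Set (Coord n)}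
    (hU : IsOpen U) {h : Coord n → M} (hh : ∀ x ∈ U, IsLocalDiffeomorphAt (𝓡 n) (𝓡 n) ∞ h x) :
    IsLocalFinsler U (F.pullBack h) where
  isOpen := hU
  nonneg x _ y := F.nonneg _
  smooth := by
    have h1 : ContMDiffOn 𝓘(ℝ, Coord n) (𝓡 n) ∞ h U :=
      fun x hx => (hh x hx).contMDiffAt.contMDiffWithinAt
    have h2 := (contMDiffOn_tangentMap_model hU h1).mono
      (fun p (hp : p ∈ slit U) => hp.1)
    exact (F.smooth.comp h2 fun p hp => (map_ne_zero_iff _ (mfderiv_bijective (hh p.1 hp.1)).1).2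
      hp.2).contDiffOn
  homogeneous x hx y r hr :=
    (congrArg (fun z : TangentSpace (𝓡 n) (h x) => F.toFun ⟨h x, z⟩)
      (map_smul (mfderiv (𝓡 n) (𝓡 n) h x) r y)).trans (F.homogeneous _ _ r hr)
  posDef x hx y v hy hv := by
    have hinj := (mfderiv_bijective (hh x hx)).1
    have h1 := hessForm_comp_linear (mfderiv (𝓡 n) (𝓡 n) h x).toLinearMap
      (fun z : TangentSpace (𝓡 n) (h x) => F.toFun ⟨h x, z⟩) y v v
    have h2 := F.posDef (h x) (mfderiv (𝓡 n) (𝓡 n) h x y) (mfderiv (𝓡 n) (𝓡 n) h x v)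
      ((map_ne_zero_iff _ hinj).2 hy) ((map_ne_zero_iff _ hinj).2 hv)
    exact h2.trans_eq h1.symm

lemma FinslerStructure.isLocalFinsler_localExpr (F : FinslerStructure n M)
    {e : OpenPartialHomeomorph M (Coord n)}
    (he : e ∈ IsManifold.maximalAtlas (𝓡 n) ∞ M) : IsLocalFinsler e.target (F.localExpr e) :=
  F.isLocalFinsler_pullBack e.open_target fun _ hx => isLocalDiffeomorphAt_chart_symm he hx

end Manifold

/-! ### Circles in charts -/

lemma covDeriv_congr {L : Coord n → Coord n → ℝ} {γ γ' X X' : ℝ → Coord n} {t : ℝ}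
    (hγ : γ =ᶠ[𝓝 t] γ') (hX : X =ᶠ[𝓝 t] X') (i : Fin n) :
    covDeriv L γ X t i = covDeriv L γ' X' t i := by
  simp only [covDeriv, hγ.eq_of_nhds, hX.eq_of_nhds, hγ.deriv.eq_of_nhds, hX.deriv.eq_of_nhds,
    hγ.deriv.deriv.eq_of_nhds]

/-- The circle equations imply the third-order equation `∇∇γ' = -k² γ'`. -/
lemma jerk_eq_of_circle_equations {L : Coord n → Coord n → ℝ} {γ Z : ℝ → Coord n} {k t : ℝ}
    (h1 : ∀ᶠ s in 𝓝 t, accel L γ s = k • Z s)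
    (h2 : covVec L γ Z t = -k • deriv γ t) : jerk L γ t = -(k ^ 2) • deriv γ t := by
  have h3 : accel L γ =ᶠ[𝓝 t] fun s => k • Z s := h1
  have h4 : deriv (accel L γ) t = k • deriv Z t := by
    rw [h3.deriv_eq, deriv_fun_const_smul_field]
  have h5 : jerk L γ t = k • covVec L γ Z t := by
    rw [jerk, covVec, covVec, h4, smul_add, smul_add]
    congr 2
    · rw [h1.self_of_nhds, map_smul]
    · rw [h1.self_of_nhds]
      simp only [map_smul, smul_apply]
  rw [h5, h2, smul_smul]
  ring_nf

/-- The circle equations in a chart, eliminating the auxiliary field `Z`. -/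
lemma jerk_of_circleEquationsAt {L : Coord n → Coord n → ℝ} {U : Set (Coord n)}
    (hL : IsLocalFinsler U L) {γ Z : ℝ → Coord n} {k t : ℝ} (hγ : ContDiffAt ℝ ∞ γ t)
    (hp : (γ t, deriv γ t) ∈ slit U)
    (h : ∀ᶠ s in 𝓝 t, ∀ i : Fin n, covDeriv L γ (deriv γ) s i = k * Z s i ∧
      covDeriv L γ Z s i = -k * deriv γ s i) : jerk L γ t = -(k ^ 2) • deriv γ t := by
  have hc : ContinuousAt (fun s => (γ s, deriv γ s)) t :=
    (hγ.prodMk (deriv_smooth hγ)).continuousAt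
  refine jerk_eq_of_circle_equations (Z := Z) ?_ ?_
  · filter_upwards [h, hc.eventually (hL.slit_mem_nhds hp)] with s hs hps
    ext i
    rw [← hL.covVec_velocity hps, ← hL.covDeriv_eq hps, (hs i).1]
    rfl
  · ext i
    rw [← hL.covDeriv_eq hp, (h.self_of_nhds i).2]
    rfl

section Manifold

variable {M : Type*} [TopologicalSpace M] [ChartedSpace (Coord n) M] [IsManifold (𝓡 n) ∞ M]

lemma FinslerStructure.gForm_localExpr (F : FinslerStructure n M)
    {e : OpenPartialHomeomorph M (Coord n)} (he : e ∈ IsManifold.maximalAtlas (𝓡 n) ∞ M)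
    {p : Coord n × Coord n} (hp : p ∈ slit e.target) (u w : Coord n) :
    F.fundTensor (e.symm p.1) (mfderiv (𝓡 n) (𝓡 n) e.symm p.1 p.2)
      (mfderiv (𝓡 n) (𝓡 n) e.symm p.1 u) (mfderiv (𝓡 n) (𝓡 n) e.symm p.1 w)
      = gForm (F.localExpr e) p u w := by
  rw [← (F.isLocalFinsler_localExpr he).hessForm_eq hp]
  exact (hessForm_comp_linear (mfderiv (𝓡 n) (𝓡 n) e.symm p.1).toLinearMap
    (fun z : TangentSpace (𝓡 n) (e.symm p.1) => F.toFun ⟨e.symm p.1, z⟩) p.2 u w).symm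

/-- A solution of the circle equations in a chart is a circle, with the normal field carried to `M`
by the differential of the inverse of the chart. -/
lemma isCircle_of_chart (F : FinslerStructure n M) {e : OpenPartialHomeomorph M (Coord n)}
    (he : e ∈ IsManifold.maximalAtlas (𝓡 n) ∞ M) {ε k : ℝ} (hk : 0 < k) {γ Y : ℝ → Coord n}
    (hγ : ContDiffOn ℝ ∞ γ (Set.Ioo (-ε) ε)) (hY : ContDiffOn ℝ ∞ Y (Set.Ioo (-ε) ε))
    (h : ∀ s ∈ Set.Ioo (-ε) ε, (γ s, deriv γ s) ∈ slit e.target ∧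
      F.localExpr e (γ s) (deriv γ s) = 1 ∧
      gForm (F.localExpr e) (γ s, deriv γ s) (Y s) (Y s) = 1 ∧
      accel (F.localExpr e) γ s = k • Y s ∧ covVec (F.localExpr e) γ Y s = -k • deriv γ s) :
    IsCircle F (Set.Ioo (-ε) ε) (e.symm ∘ γ) := by
  have hL := F.isLocalFinsler_localExpr he
  have hmem : ∀ s ∈ Set.Ioo (-ε) ε, γ s ∈ e.target := fun s hs => (h s hs).1.1
  have hvel : ∀ s ∈ Set.Ioo (-ε) ε, velocity (e.symm ∘ γ) s
      = mfderiv (𝓡 n) (𝓡 n) e.symm (γ s) (deriv γ s) := fun s hs =>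
    velocity_comp (isLocalDiffeomorphAt_chart_symm he (hmem s hs))
      (hγ.contDiffAt (isOpen_Ioo.mem_nhds hs))
  refine ⟨isOpen_Ioo, Set.ordConnected_Ioo, ?_, ?_, k, hk,
    fun s => mfderiv (𝓡 n) (𝓡 n) e.symm (γ s) (Y s), ?_, ?_⟩
  · exact (contMDiffOn_symm_of_mem_maximalAtlas he).comp hγ.contMDiffOn hmem
  · intro s hs
    rw [hvel s hs]
    exact (h s hs).2.1
  · intro s hs
    rw [hvel s hs]
    exact (F.gForm_localExpr he (h s hs).1 (Y s) (Y s)).trans (h s hs).2.2.1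
  · intro s₀ hs₀
    refine ⟨e, he, e.map_target (hmem s₀ hs₀), ?_⟩
    have hc : ∀ s ∈ Set.Ioo (-ε) ε, (e ∘ e.symm ∘ γ) =ᶠ[𝓝 s] γ := by
      intro s hs
      filter_upwards [isOpen_Ioo.mem_nhds hs] with r hr using e.right_inv (hmem r hr)
    have hcY : ∀ s ∈ Set.Ioo (-ε) ε, components e (e.symm ∘ γ)
        (fun s => mfderiv (𝓡 n) (𝓡 n) e.symm (γ s) (Y s)) =ᶠ[𝓝 s] Y := by
      intro s hs
      filter_upwards [isOpen_Ioo.mem_nhds hs] with r hr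
        using mfderiv_chart_symm he (hmem r hr) (Y r)
    refine ⟨(hY.contDiffAt (isOpen_Ioo.mem_nhds hs₀)).congr_of_eventuallyEq (hcY s₀ hs₀), ?_⟩
    filter_upwards [isOpen_Ioo.mem_nhds hs₀] with s hs i
    obtain ⟨hp, -, -, h4, h5⟩ := h s hs
    rw [covDeriv_congr (hc s hs) (hc s hs).deriv, covDeriv_congr (hc s hs) (hcY s hs),
      (hcY s hs).eq_of_nhds, (hc s hs).deriv.eq_of_nhds, hL.covDeriv_eq hp, hL.covDeriv_eq hp,
      hL.covVec_velocity hp, h4, h5]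
    exact ⟨rfl, rfl⟩

lemma FinslerStructure.pullBack_comp (F : FinslerStructure n M) {h : Coord n → M}
    {ψ : Coord n → Coord n} {g : Coord n → M} {x : Coord n} (hg : g =ᶠ[𝓝 x] h ∘ ψ)
    (hh : MDifferentiableAt (𝓡 n) (𝓡 n) h (ψ x)) (hψ : ContDiffAt ℝ ∞ ψ x) (y : Coord n) :
    F.pullBack g x y = F.pullBack h (ψ x) (fderiv ℝ ψ x y) := by
  have h1 : mfderiv (𝓡 n) (𝓡 n) (h ∘ ψ) x y
      = mfderiv (𝓡 n) (𝓡 n) h (ψ x) (fderiv ℝ ψ x y) := by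
    rw [mfderiv_comp x hh (differentiableAt_of_smooth hψ).mdifferentiableAt, mfderiv_eq_fderiv]
    rfl
  have h2 : F.pullBack g x y = F.pullBack (h ∘ ψ) x y := by
    unfold FinslerStructure.pullBack
    rw [hg.mfderiv_eq, hg.eq_of_nhds]
  rw [h2]
  exact congrArg (fun z : TangentSpace (𝓡 n) (h (ψ x)) => F.toFun ⟨h (ψ x), z⟩) h1

/-- For a local diffeomorphism `g` from `ℝⁿ` to `M`, the pull-back of `F` by `g` and the coordinate
expression of `F` in a chart `e` are related by the coordinate change `e ∘ g`. -/
lemma FinslerStructure.isCoordChange (F : FinslerStructure n M) {U : Set (Coord n)} (hU : IsOpen U)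
    {g : Coord n → M} (hg : ∀ x ∈ U, IsLocalDiffeomorphAt (𝓡 n) (𝓡 n) ∞ g x)
    {e : OpenPartialHomeomorph M (Coord n)} (he : e ∈ IsManifold.maximalAtlas (𝓡 n) ∞ M) :
    IsCoordChange (U ∩ g ⁻¹' e.source) (e ∘ g) (F.pullBack g) (F.localExpr e) := by
  have hcont : ContinuousOn g U := fun x hx => (hg x hx).contMDiffAt.continuousAt.continuousWithinAt
  have hopen : IsOpen (U ∩ g ⁻¹' e.source) := hcont.isOpen_inter_preimage hU e.open_source
  have hloc : ∀ x ∈ U ∩ g ⁻¹' e.source, IsLocalDiffeomorphAt (𝓡 n) (𝓡 n) ∞ (e ∘ g) x :=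
    fun x hx => (hg x hx.1).comp _ _ (isLocalDiffeomorphAt_chart he hx.2)
  have hsm : ∀ x ∈ U ∩ g ⁻¹' e.source, ContDiffAt ℝ ∞ (e ∘ g) x :=
    fun x hx => (hloc x hx).contMDiffAt.contDiffAt
  refine ⟨hopen, fun x hx => (hsm x hx).contDiffWithinAt, fun x hx => ?_, fun x hx y => ?_⟩
  · have h1 := mfderiv_bijective (hloc x hx)
    rw [mfderiv_eq_fderiv] at h1
    exact h1
  · refine F.pullBack_comp (h := e.symm) ?_ ?_ (hsm x hx) y
    · filter_upwards [hopen.mem_nhds hx] with z hz using (e.left_inv hz.2).symm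
    · exact (isLocalDiffeomorphAt_chart_symm he (e.map_source hx.2)).mdifferentiableAt (by simp)

/-- In the coordinates given by a local diffeomorphism `g` from `ℝⁿ` to `M`, a circle `g ∘ γ` is a
curve whose covariant acceleration is orthogonal to its velocity, and whose third covariant
derivative is a multiple of the velocity. -/
lemma IsCircle.pullBack {F : FinslerStructure n M} {U : Set (Coord n)} (hU : IsOpen U)
    {g : Coord n → M} (hg : ∀ x ∈ U, IsLocalDiffeomorphAt (𝓡 n) (𝓡 n) ∞ g x) {J : Set ℝ}
    {γ : ℝ → Coord n} (hJ : IsCircle F J (g ∘ γ)) {t : ℝ} (ht : t ∈ J)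
    (hγ : ∀ᶠ s in 𝓝 t, ContDiffAt ℝ ∞ γ s) (hp : (γ t, deriv γ t) ∈ slit U) :
    gForm (F.pullBack g) (γ t, deriv γ t) (accel (F.pullBack g) γ t) (deriv γ t) = 0 ∧
      ∃ c : ℝ, jerk (F.pullBack g) γ t = c • deriv γ t := by
  obtain ⟨hJo, -, -, hunit, k, -, Y, -, hY⟩ := hJ
  have hL := F.isLocalFinsler_pullBack hU hg
  have hγt := hγ.self_of_nhds
  constructor
  · have h1 := hL.hasDerivAt_energy hγt hp
    have h2 : (fun s => energy (F.pullBack g) (γ s, deriv γ s)) =ᶠ[𝓝 t] fun _ => 1 := by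
      filter_upwards [hγ, hJo.mem_nhds ht, hγt.continuousAt.eventually (hU.mem_nhds hp.1)]
        with s h3 h4 h5
      have h6 := hunit s h4
      rw [velocity_comp (hg _ h5) h3] at h6
      have h7 : F.pullBack g (γ s) (deriv γ s) = 1 := h6
      rw [energy, h7, one_pow]
    have h8 := (h1.congr_of_eventuallyEq h2.symm).unique (hasDerivAt_const t (1 : ℝ))
    linarith
  · obtain ⟨e, he, hsource, -, heq⟩ := hY t ht
    have hψ := F.isCoordChange hU hg he
    have hL' := F.isLocalFinsler_localExpr he
    have hmaps : Set.MapsTo (e ∘ g) (U ∩ g ⁻¹' e.source) e.target :=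
      fun x hx => e.map_source hx.2
    have hpW : (γ t, deriv γ t) ∈ slit (U ∩ g ⁻¹' e.source) := ⟨⟨hp.1, hsource⟩, hp.2⟩
    have hd := hψ.deriv_comp_eq hγt hpW.1
    have hinj := (hψ.bijective _ hpW.1).1
    have h1 := jerk_of_circleEquationsAt hL' (γ := (e ∘ g) ∘ γ)
      ((hψ.smoothAt hpW.1).comp t hγt)
      ⟨hmaps hpW.1, by rw [hd]; exact (map_ne_zero_iff _ hinj).2 hp.2⟩ heq
    rw [hψ.jerk_eq hL hL' Set.inter_subset_left hmaps hγ hpW, hd, ← map_smul] at h1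
    exact ⟨_, hinj h1⟩

end Manifold

/-! ### Circle-preserving local diffeomorphisms -/

section Manifold

variable {M : Type*} [TopologicalSpace M] [ChartedSpace (Coord n) M]
  {M' : Type*} [TopologicalSpace M'] [ChartedSpace (Coord n) M'] {φ : M → M'}
  {e : OpenPartialHomeomorph M (Coord n)}

lemma isLocalDiffeomorphAt_comp_chart_symm (hφ : IsLocalDiffeomorph (𝓡 n) (𝓡 n) ∞ φ)
    (he : e ∈ IsManifold.maximalAtlas (𝓡 n) ∞ M) :
    ∀ x ∈ e.target, IsLocalDiffeomorphAt (𝓡 n) (𝓡 n) ∞ (φ ∘ e.symm) x :=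
  fun x hx => (isLocalDiffeomorphAt_chart_symm he hx).comp _ _ (hφ (e.symm x))

variable [IsManifold (𝓡 n) ∞ M']

lemma pullBack_comp_chart_symm (F' : FinslerStructure n M')
    (hφ : IsLocalDiffeomorph (𝓡 n) (𝓡 n) ∞ φ) (he : e ∈ IsManifold.maximalAtlas (𝓡 n) ∞ M)
    {z : Coord n} (hz : z ∈ e.target) (w : Coord n) :
    F'.pullBack (φ ∘ e.symm) z w = F'.toFun ⟨φ (e.symm z),
      mfderiv (𝓡 n) (𝓡 n) φ (e.symm z) (mfderiv (𝓡 n) (𝓡 n) e.symm z w)⟩ := by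
  have h1 := mfderiv_comp z ((hφ (e.symm z)).mdifferentiableAt (by simp))
    ((isLocalDiffeomorphAt_chart_symm he hz).mdifferentiableAt (by simp))
  exact congrArg (fun v : TangentSpace (𝓡 n) (φ (e.symm z)) => F'.toFun ⟨φ (e.symm z), v⟩)
    (DFunLike.congr_fun h1 w)

variable [IsManifold (𝓡 n) ∞ M] {F : FinslerStructure n M} {F' : FinslerStructure n M'}

/-- Every unit vector `X` and every nonzero vector `V` orthogonal to it are the velocity and the
acceleration of a circle of `F`, whose image is a circle of `F'`. -/
lemma PreservesCircles.hasCommonCircle (hcirc : PreservesCircles F F' φ)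
    (hφ : IsLocalDiffeomorph (𝓡 n) (𝓡 n) ∞ φ) (he : e ∈ IsManifold.maximalAtlas (𝓡 n) ∞ M)
    {x X V : Coord n} (hx : x ∈ e.target) (hX : X ≠ 0) (hE : energy (F.localExpr e) (x, X) = 1)
    (hV : V ≠ 0) (hXV : gForm (F.localExpr e) (x, X) X V = 0) :
    HasCommonCircle (F.localExpr e) (F'.pullBack (φ ∘ e.symm)) x X V := by
  have hL := F.isLocalFinsler_localExpr he
  have hg := isLocalDiffeomorphAt_comp_chart_symm hφ he
  have hL' := F'.isLocalFinsler_pullBack e.open_target hg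
  obtain ⟨ε, hε, γ, Y, k, hk, hγ0, hγ1, hγ2, hγ, hY, h⟩ := hL.exists_circle hx hX hE hV hXV
  obtain ⟨J, σ, hbij, hσ, hσ', hJ⟩ := hcirc _ _ (isCircle_of_chart F he hk hγ hY h)
  have h0 : (0 : ℝ) ∈ Set.Ioo (-ε) ε := ⟨neg_lt_zero.2 hε, hε⟩
  obtain ⟨t, ht, hσt⟩ := hbij.surjOn h0
  have hγs : ∀ s ∈ Set.Ioo (-ε) ε, ContDiffAt ℝ ∞ γ s :=
    fun s hs => hγ.contDiffAt (isOpen_Ioo.mem_nhds hs)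
  have hσs : ∀ s ∈ J, ContDiffAt ℝ ∞ σ s := fun s hs => hσ.contDiffAt (hJ.1.mem_nhds hs)
  have hcomp : ∀ᶠ s in 𝓝 t, ContDiffAt ℝ ∞ (γ ∘ σ) s := by
    filter_upwards [hJ.1.mem_nhds ht] with s hs
    exact (hγs _ (hbij.mapsTo hs)).comp s (hσs s hs)
  have hd : deriv (γ ∘ σ) t = deriv σ t • X := by
    rw [← hγ1, ← hσt]
    exact ((smooth_hasDerivAt (hγs _ (hbij.mapsTo ht))).scomp t
      (smooth_hasDerivAt (hσs t ht))).deriv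
  have hpos := hσ' t ht
  have ht0 : (γ ∘ σ) t = x := by rw [Function.comp_apply, hσt, hγ0]
  have hp : ((γ ∘ σ) t, deriv (γ ∘ σ) t) ∈ slit e.target := by
    rw [ht0, hd]
    exact ⟨hx, smul_ne_zero hpos.ne' hX⟩
  obtain ⟨h1, c, h2⟩ := IsCircle.pullBack (γ := γ ∘ σ) e.open_target hg hJ ht hcomp hp
  rw [ht0, hd, hL'.gForm_smul hx hX hpos, ← gBilin_apply, map_smul, gBilin_apply, smul_eq_mul]
    at h1
  have hjerk : jerk (F.localExpr e) γ 0 = -(k ^ 2) • X := by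
    rw [← hγ1]
    refine jerk_eq_of_circle_equations (Z := Y) ?_ (h 0 h0).2.2.2.2
    filter_upwards [isOpen_Ioo.mem_nhds h0] with s hs using (h s hs).2.2.2.1
  refine ⟨γ, σ, t, -(k ^ 2), c * deriv σ t, ?_, ?_, hpos, by rw [hσt, hγ0], by rw [hσt, hγ1],
    by rw [hσt, hγ2], by rw [hσt, hjerk], (mul_eq_zero.1 h1).resolve_left hpos.ne', ?_⟩
  · rw [hσt]
    filter_upwards [isOpen_Ioo.mem_nhds h0] with s hs using hγs s hs
  · filter_upwards [hJ.1.mem_nhds ht] with s hs using hσs s hs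
  · rw [h2, hd, smul_smul]

/-- The two Finsler functions are proportional on each tangent space. -/
lemma PreservesCircles.exists_energy_eq (hn : 2 ≤ n) (hcirc : PreservesCircles F F' φ)
    (hφ : IsLocalDiffeomorph (𝓡 n) (𝓡 n) ∞ φ) (he : e ∈ IsManifold.maximalAtlas (𝓡 n) ∞ M)
    {x : Coord n} (hx : x ∈ e.target) : ∃ κ : ℝ, 0 < κ ∧ ∀ y ≠ 0,
      energy (F'.pullBack (φ ∘ e.symm)) (x, y) = κ * energy (F.localExpr e) (x, y) := by
  have hL := F.isLocalFinsler_localExpr he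
  have hL' := F'.isLocalFinsler_pullBack e.open_target (isLocalDiffeomorphAt_comp_chart_symm hφ he)
  refine hL.exists_energy_eq hn hL' hx fun y hy => ?_
  have hpos := hL.pos (p := (x, y)) ⟨hx, hy⟩
  have hr : 0 < (F.localExpr e x y)⁻¹ := inv_pos.2 hpos
  refine hL.quadraticIdentity_smul hL' hx hy hr fun V hV ℓ hℓ => ?_
  have hne : (F.localExpr e x y)⁻¹ • y ≠ 0 := smul_ne_zero hr.ne' hy
  refine hL.quadratic_identity hL' hx hne (fun W hW hXW => ?_) hV hℓ
  refine hcirc.hasCommonCircle hφ he hx hne ?_ hW hXW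
  rw [energy, hL.homogeneous x hx y _ hr, inv_mul_cancel₀ hpos.ne', one_pow]

lemma PreservesCircles.exists_factor (hn : 2 ≤ n) (hcirc : PreservesCircles F F' φ)
    (hφ : IsLocalDiffeomorph (𝓡 n) (𝓡 n) ∞ φ) (x : M) : ∃ a : ℝ, 0 < a ∧
      ∀ y : TangentSpace (𝓡 n) x,
        F'.toFun ⟨φ x, mfderiv (𝓡 n) (𝓡 n) φ x y⟩ = a * F.toFun ⟨x, y⟩ := by
  obtain ⟨e, he, hx⟩ : ∃ e ∈ IsManifold.maximalAtlas (𝓡 n) ∞ M, x ∈ e.source :=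
    ⟨_, IsManifold.chart_mem_maximalAtlas x, mem_chart_source _ x⟩
  obtain ⟨z, hz, rfl⟩ : ∃ z ∈ e.target, e.symm z = x := ⟨e x, e.map_source hx, e.left_inv hx⟩
  obtain ⟨κ, hκ, h⟩ := hcirc.exists_energy_eq hn hφ he hz
  refine ⟨√κ, Real.sqrt_pos.2 hκ, fun y => ?_⟩
  obtain ⟨w, rfl⟩ := (mfderiv_bijective (isLocalDiffeomorphAt_chart_symm he hz)).2 y
  rcases eq_or_ne w 0 with rfl | hw
  · rw [map_zero, map_zero, F.zero, F'.zero, mul_zero]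
  · have h1 := h w hw
    rw [energy, energy, ← Real.sq_sqrt hκ.le, ← mul_pow] at h1
    simp only at h1
    have h2 := (sq_eq_sq₀ (F'.nonneg _) (mul_nonneg (Real.sqrt_nonneg κ) (F.nonneg _))).1 h1
    exact (pullBack_comp_chart_symm F' hφ he hz w).symm.trans h2

end Manifold

end Finsler
end

theorem theorem1 (n : ℕ) (hn : 2 ≤ n)
    (M : Type*) [TopologicalSpace M] [ChartedSpace (Finsler.Coord n) M] [IsManifold (𝓡 n) ∞ M]
    (M' : Type*) [TopologicalSpace M'] [ChartedSpace (Finsler.Coord n) M'] [IsManifold (𝓡 n) ∞ M']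
    (F : Finsler.FinslerStructure n M) (F' : Finsler.FinslerStructure n M')
    (φ : M → M') (hφ : IsLocalDiffeomorph (𝓡 n) (𝓡 n) ∞ φ)
    (hcirc : Finsler.PreservesCircles F F' φ) :
    Finsler.IsConformal F F' φ := by
  open Finsler in
  choose α hα hfactor using hcirc.exists_factor hn hφ
  refine ⟨α, fun x => ?_, hα, fun x y u v _ => ?_⟩
  · -- In a chart, `α` is the ratio of the two Finsler functions at a fixed nonzero vector.
    have he := IsManifold.chart_mem_maximalAtlas (I := 𝓡 n) (n := ∞) x
    have hx : x ∈ (chartAt (Coord n) x).source := mem_chart_source _ x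
    set e := chartAt (Coord n) x
    let w : Coord n := basisVec ⟨0, by omega⟩
    have hw : w ≠ 0 := by
      intro h
      have := congrArg (fun v : Coord n => v ⟨0, by omega⟩) h
      simp [w, basisVec] at this
    have hL := F.isLocalFinsler_localExpr he
    have hL' := F'.isLocalFinsler_pullBack e.open_target
      (isLocalDiffeomorphAt_comp_chart_symm hφ he)
    have hpair : ContDiffAt ℝ ∞ (fun z : Coord n => (z, w)) (e x) :=
      contDiffAt_id.prodMk contDiffAt_const
    have hp : (e x, w) ∈ slit e.target := ⟨e.map_source hx, hw⟩
    have h1 : ContDiffAt ℝ ∞ (fun z => F.localExpr e z w) (e x) :=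
      ContDiffAt.comp (g := fun p : Coord n × Coord n => F.localExpr e p.1 p.2) (e x)
        (hL.smooth.contDiffAt (hL.slit_mem_nhds hp)) hpair
    have h2 : ContDiffAt ℝ ∞ (fun z => F'.pullBack (φ ∘ e.symm) z w) (e x) :=
      ContDiffAt.comp (g := fun p : Coord n × Coord n => F'.pullBack (φ ∘ e.symm) p.1 p.2) (e x)
        (hL'.smooth.contDiffAt (hL'.slit_mem_nhds hp)) hpair
    have hr := h2.div h1 (hL.pos hp).ne'
    refine (hr.contMDiffAt.comp x
      (contMDiffAt_of_mem_maximalAtlas he hx)).congr_of_eventuallyEq ?_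
    filter_upwards [e.open_source.mem_nhds hx] with x' hx'
    have h1 := hfactor (e.symm (e x')) (mfderiv (𝓡 n) (𝓡 n) e.symm (e x') w)
    rw [← pullBack_comp_chart_symm F' hφ he (e.map_source hx')] at h1
    have h2 : F'.pullBack (φ ∘ e.symm) (e x') w = α (e.symm (e x')) * F.localExpr e (e x') w := h1
    rw [Function.comp_apply, Pi.div_apply, h2, mul_div_cancel_right₀ _
      (hL.pos (p := (e x', w)) ⟨e.map_source hx', hw⟩).ne', e.left_inv hx']
  · have h1 := hessForm_comp_linear (mfderiv (𝓡 n) (𝓡 n) φ x).toLinearMap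
      (fun z : TangentSpace (𝓡 n) (φ x) => F'.toFun ⟨φ x, z⟩) y u v
    have h2 : (fun z : TangentSpace (𝓡 n) x =>
        F'.toFun ⟨φ x, (mfderiv (𝓡 n) (𝓡 n) φ x).toLinearMap z⟩)
          = fun z => α x * F.toFun ⟨x, z⟩ := funext (hfactor x)
    rw [h2, hessForm_const_mul] at h1
    exact h1.symm
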